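/- **Theorem.** Rectangle Stabbing has a parameterized $\frac74$-approximation algorithm. Precisely: let the input consist of a finite set $\mathcal R$ of axis-parallel closed rectangles $[a,b]\times[c,d]$ ($a\le b$, $c\le d$ real), a finite set $\mathcal L$ of horizontal or vertical lines in $\mathbb R^2$, both given as lists in arbitrary order, and an integer $k\ge 0$. A line stabs a rectangle if the two intersect, and a solution is a subset $S\subseteq\mathcal L$ such that every rectangle of $\mathcal R$ is stabbed by some line of $S$. There is a deterministic algorithm that on every such input halts and either correctly reports that there is no solution with at most $k$ lines, or returns a solution with at most $\frac74 k$ lines. Its running time is $k^{O(k)}\cdot n^{O(1)}$ with $n=|\mathcal R|+|\mathcal L|$; that is, there are constants $A,B,D\in\mathbb N$ such that it makes at most $A\cdot k^{Bk}\cdot(n+1)^{D}$ steps (where $0^0=1$). Here algorithms are programs of a random access machine on natural numbers, with indirect addressing, addition, (truncated) subtraction and comparison at unit cost, which accesses the real coordinates of the input only through unit-cost comparisons of two of them. -/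

import Mathlib

namespace RectStab

/-! ### Rectangles, lines, stabbing -/

/-- An axis-parallel closed rectangle `[left, right] × [bottom, top]`, possibly degenerate. -/
structure Rect where
  left : ℝ
  right : ℝ
  bottom : ℝ
  top : ℝ
  left_le_right : left ≤ right
  bottom_le_top : bottom ≤ top

/-- The region of the plane covered by a rectangle. -/
def Rect.toSet (R : Rect) : Set (ℝ × ℝ) :=
  Set.Icc R.left R.right ×ˢ Set.Icc R.bottom R.top

/-- An axis-parallel line, given by its direction and its position. -/
inductive Line where
  | horizontal (y : ℝ)
  | vertical (x : ℝ)

/-- The set of points of a line: `ℝ × {y}` or `{x} × ℝ`. -/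
def Line.toSet : Line → Set (ℝ × ℝ)
  | .horizontal y => Set.univ ×ˢ {y}
  | .vertical x => {x} ×ˢ Set.univ

/-- The coordinate that determines the line (given its direction). -/
def Line.pos : Line → ℝ
  | .horizontal y => y
  | .vertical x => x

/-- Numerical code of the direction: `0` for horizontal, `1` for vertical. -/
def Line.dir : Line → ℕ
  | .horizontal _ => 0
  | .vertical _ => 1

/-- A line stabs a rectangle if they have a common point. -/
def Stabs (l : Line) (R : Rect) : Prop := (R.toSet ∩ l.toSet).Nonempty

/-- `S` is a solution of the instance `(𝓡, 𝓛)`: a subset of `𝓛` stabbing every rectangle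
of `𝓡`. -/
def IsSolution (𝓡 : Finset Rect) (𝓛 S : Finset Line) : Prop :=
  S ⊆ 𝓛 ∧ ∀ R ∈ 𝓡, ∃ l ∈ S, Stabs l R

/-! ### Random access machine programs with a step count

A program works on finitely many integer arrays (the numerals occurring in it as array names),
with indirect addressing, addition, truncated subtraction and comparison of natural numbers.
There is no unit-cost multiplication. The real coordinates of the input are kept in read-only
arrays; they are atomic, and the only operation on them is the comparison `≤` of two entries. -/

/-- Contents of the integer arrays: `σ a i` is the entry with index `i` of array `a`. -/
abbrev State := ℕ → ℕ → ℕ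

/-- Contents of the read-only arrays of real numbers. -/
abbrev Coords := ℕ → ℕ → ℝ

/-- Integer expressions. -/
inductive Expr where
  | const (c : ℕ)
  | read (a : ℕ) (i : Expr)
  | add (e f : Expr)
  | sub (e f : Expr)

/-- The value of an expression. -/
def Expr.eval (σ : State) : Expr → ℕ
  | .const c => c
  | .read a i => σ a (i.eval σ)
  | .add e f => e.eval σ + f.eval σ
  | .sub e f => e.eval σ - f.eval σ

/-- The number of steps to evaluate an expression: one for each operation in it. -/
def Expr.cost : Expr → ℕ
  | .const _ => 1
  | .read _ i => i.cost + 1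
  | .add e f => e.cost + f.cost + 1
  | .sub e f => e.cost + f.cost + 1

/-- Tests. `coordLe a e b f` compares entry `e` of the real array `a` with entry `f` of the
real array `b`. -/
inductive Test where
  | le (e f : Expr)
  | coordLe (a : ℕ) (e : Expr) (b : ℕ) (f : Expr)
  | not (p : Test)
  | and (p q : Test)

/-- The outcome of a test. -/
def Test.holds (X : Coords) (σ : State) : Test → Prop
  | .le e f => e.eval σ ≤ f.eval σ
  | .coordLe a e b f => X a (e.eval σ) ≤ X b (f.eval σ)
  | .not p => ¬ p.holds X σ
  | .and p q => p.holds X σ ∧ q.holds X σ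

/-- The number of steps to perform a test: one for each operation in it. -/
def Test.cost : Test → ℕ
  | .le e f => e.cost + f.cost + 1
  | .coordLe _ e _ f => e.cost + f.cost + 1
  | .not p => p.cost + 1
  | .and p q => p.cost + q.cost + 1

/-- Programs. `assign a i e` stores the value of `e` in entry `i` of array `a`. -/
inductive Program where
  | skip
  | assign (a : ℕ) (i e : Expr)
  | seq (P Q : Program)
  | ite (p : Test) (P Q : Program)
  | loop (p : Test) (P : Program)

/-- The state after storing `v` in entry `i` of array `a`. -/
def State.store (σ : State) (a i v : ℕ) : State :=
  fun b j => if b = a ∧ j = i then v else σ b j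

/-- `Exec X P σ τ t`: on coordinates `X`, program `P` started in state `σ` halts in state `τ`
after exactly `t` steps. -/
inductive Exec (X : Coords) : Program → State → State → ℕ → Prop where
  | skip (σ : State) : Exec X .skip σ σ 1
  | assign (a : ℕ) (i e : Expr) (σ : State) :
      Exec X (.assign a i e) σ (σ.store a (i.eval σ) (e.eval σ)) (i.cost + e.cost + 1)
  | seq {P Q : Program} {σ τ ρ : State} {s t : ℕ} :
      Exec X P σ τ s → Exec X Q τ ρ t → Exec X (.seq P Q) σ ρ (s + t)
  | ite_true {p : Test} {P Q : Program} {σ τ : State} {t : ℕ} :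
      p.holds X σ → Exec X P σ τ t → Exec X (.ite p P Q) σ τ (p.cost + t)
  | ite_false {p : Test} {P Q : Program} {σ τ : State} {t : ℕ} :
      ¬ p.holds X σ → Exec X Q σ τ t → Exec X (.ite p P Q) σ τ (p.cost + t)
  | loop_stop {p : Test} {P : Program} {σ : State} :
      ¬ p.holds X σ → Exec X (.loop p P) σ σ p.cost
  | loop_step {p : Test} {P : Program} {σ τ ρ : State} {s t : ℕ} :
      p.holds X σ → Exec X P σ τ s → Exec X (.loop p P) τ ρ t →
      Exec X (.loop p P) σ ρ (p.cost + s + t)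

/-- Programs are deterministic: final state and number of steps are determined by the input. -/
theorem Exec.unique {X : Coords} {P : Program} {σ τ : State} {t : ℕ} (h : Exec X P σ τ t) :
    ∀ {τ' : State} {t' : ℕ}, Exec X P σ τ' t' → τ' = τ ∧ t' = t := by
  induction h with
  | skip σ => intro τ' t' h'; cases h'; exact ⟨rfl, rfl⟩
  | assign a i e σ => intro τ' t' h'; cases h'; exact ⟨rfl, rfl⟩
  | seq _ _ ih₁ ih₂ =>
    intro τ' t' h'
    cases h' with
    | seq h₁ h₂ =>
      obtain ⟨rfl, rfl⟩ := ih₁ h₁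
      obtain ⟨rfl, rfl⟩ := ih₂ h₂
      exact ⟨rfl, rfl⟩
  | ite_true hp _ ih =>
    intro τ' t' h'
    cases h' with
    | ite_true _ h₁ => obtain ⟨rfl, rfl⟩ := ih h₁; exact ⟨rfl, rfl⟩
    | ite_false hn _ => exact absurd hp hn
  | ite_false hn _ ih =>
    intro τ' t' h'
    cases h' with
    | ite_true hp _ => exact absurd hp hn
    | ite_false _ h₁ => obtain ⟨rfl, rfl⟩ := ih h₁; exact ⟨rfl, rfl⟩
  | loop_stop hn =>
    intro τ' t' h'
    cases h' with
    | loop_stop _ => exact ⟨rfl, rfl⟩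
    | loop_step hp _ _ => exact absurd hp hn
  | loop_step hp _ _ ih₁ ih₂ =>
    intro τ' t' h'
    cases h' with
    | loop_stop hn => exact absurd hp hn
    | loop_step _ h₁ h₂ =>
      obtain ⟨rfl, rfl⟩ := ih₁ h₁
      obtain ⟨rfl, rfl⟩ := ih₂ h₂
      exact ⟨rfl, rfl⟩

/-! ### Input and output conventions -/

/-- The real input arrays: arrays `0, 1, 2, 3` hold the left, right, bottom and top coordinates
of the rectangles, array `4` holds the positions of the lines (padded by `0`). -/
def inputCoords (rs : List Rect) (ls : List Line) : Coords
  | 0, i => (rs.map Rect.left).getD i 0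
  | 1, i => (rs.map Rect.right).getD i 0
  | 2, i => (rs.map Rect.bottom).getD i 0
  | 3, i => (rs.map Rect.top).getD i 0
  | 4, i => (ls.map Line.pos).getD i 0
  | _, _ => 0

/-- The initial state: array `0` holds `k`, the number of rectangles and the number of lines,
array `1` holds the directions of the lines; everything else is `0`. -/
def inputState (rs : List Rect) (ls : List Line) (k : ℕ) : State
  | 0, i => [k, rs.length, ls.length].getD i 0
  | 1, i => (ls.map Line.dir).getD i 0
  | _, _ => 0

open Classical in
/-- The answer given by a final state: if entry `0` of array `2` is `0`, the answer is `none`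
("there is no solution with at most `k` lines"); otherwise the answer is the set of the lines
whose entry in array `3` is nonzero. -/
noncomputable def answer (ls : List Line) (σ : State) : Option (Finset Line) :=
  if σ 2 0 = 0 then none
  else some ((Finset.univ.filter fun j : Fin ls.length => σ 3 j ≠ 0).image ls.get)

/-- `l` lists the elements of the finite set `S`, in some order, each exactly once. -/
def Lists {α : Type*} (l : List α) (S : Finset α) : Prop :=
  l.Nodup ∧ ∀ x, x ∈ l ↔ x ∈ S

end RectStab

/-! Ranking the lines of each direction and placing both directions on one axis turns every
rectangle into a pair of integer intervals (`Inst`, `Ranks.hit_axisPos`). Fix a solution `A` of at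
most `k` lines and let the first kind be a direction that accounts for at least half of it; the
program tries both directions.

The first-kind part of the axis is cut into strips that are as long as possible subject to this: the
rectangles strictly inside a strip can be stabbed by `k` lines of the second kind. By maximality
every such strip but the last contains a line of `A` (`Inst.Sol.exists_mem_of_mark`), so there are
at most `k + 1` of them. The greedy second-kind positions for each of them become marks that cut the
second-kind part. This gives O(k²) strips in all (`Inst.total_le`), and no rectangle is strictly
inside strips of both kinds, because one inside a first-kind strip is crossed by a second-kind mark
(`Inst.Sol.exists_mark_of_inside`). Guessing the number `m p` of lines of `A` in every strip `p`
takes k^O(k) attempts (`Inst.Sol.exists_guess`, `Inst.pow_le`).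

For the right guess it remains to learn which rectangles inside a strip are stabbed by `A` there.
Start without flags; repeatedly select positions and flag the rectangles that are missed. A strip
with `m p > 0` normally contributes its end mark `p` and `m p` greedy points for the flagged
rectangles inside it. A missed rectangle is stabbed by `A` in some strip. If it protruded to the
right it would contain `p`; if it protruded to the left it would contain the last greedy point,
which is not to the right of any line of `A` in the strip. So it lies inside the strip and is
flagged rightly (`Inst.Sol.good_of_not_hitBy`). Rightly flagged rectangles are hit
(`Inst.Sol.hitBy_of_flag`), so every unsuccessful round flags a new one and `n` rounds suffice
(`Inst.Sol.hitBy_flag`).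

Selecting `m p + 1` positions everywhere would only give a factor 2. The saving: in first-kind
strips with `m p = 1` whose number has a chosen parity, only one position is selected, the least
upper end of the flagged rectangles inside. It is not to the left of the line of `A`, which takes
care of protrusion to the right; protrusion to the left is caught by the end mark of the preceding
strip, which has the other parity. Over both parities together a first-kind strip costs at most `3 *
m p` and a second-kind strip at most `4 * m p`. As at most half of `A` is of the second kind, the
sum is at most 7/2 times the size of `A`, and the better parity achieves 7/4
(`Inst.Sol.sum_card_le`, `Inst.Sol.exists_parity`). Wrong guesses do no harm, since hits and size
are verified before a selection is recorded (`Ranks.sound`).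

For the running time, the algorithm is written with terms and commands all of whose loops run up to
a stored bound. The cost of a fixed command is polynomial in the largest bound
(`Cmd.compile_correct`, `Cmd.polyBdd_cost`), and all bounds, the number of guesses included, are at
most `7 * (k ^ (5 * k) * (n + m + 1))`. -/

namespace RectStab

/-! ### A term language with bounded iteration, compiled to random access machine programs -/

/-- Terms over the arrays of a state. Registers live in array `5`, loop bounds in array `6`,
array `7` is scratch space of the compiled code. `iter d j s b` iterates `b` for `σ 6 j` rounds,
starting from `s`, with accumulator register `d` and round counter register `d + 1`. -/
inductive Term where
  | const (c : ℕ)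
  | var (i : ℕ)
  | rd (a : ℕ) (t : Term)
  | add (s t : Term)
  | sub (s t : Term)
  | le (s t : Term)
  | cle (a : ℕ) (s : Term) (b : ℕ) (t : Term)
  | ite (c s t : Term)
  | iter (d j : ℕ) (s b : Term)

open Classical in
/-- The value of a term. -/
noncomputable def Term.eval (X : Coords) : Term → State → ℕ
  | .const c, _ => c
  | .var i, σ => σ 5 i
  | .rd a t, σ => σ a (t.eval X σ)
  | .add s t, σ => s.eval X σ + t.eval X σ
  | .sub s t, σ => s.eval X σ - t.eval X σ
  | .le s t, σ => if s.eval X σ ≤ t.eval X σ then 1 else 0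
  | .cle a s b t, σ => if X a (s.eval X σ) ≤ X b (t.eval X σ) then 1 else 0
  | .ite c s t, σ => if c.eval X σ ≠ 0 then s.eval X σ else t.eval X σ
  | .iter d j s b, σ => Nat.rec (motive := fun _ => ℕ) (s.eval X σ)
      (fun i acc => b.eval X ((σ.store 5 d acc).store 5 (d + 1) i)) (σ 6 j)

/-- The term only reads registers below `L` and its own bound registers. -/
def Term.ok : ℕ → Term → Bool
  | _, .const _ => true
  | L, .var i => decide (i < L)
  | L, .rd a t => decide (a ≠ 5) && decide (a ≠ 7) && t.ok L
  | L, .add s t => s.ok L && t.ok L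
  | L, .sub s t => s.ok L && t.ok L
  | L, .le s t => s.ok L && t.ok L
  | L, .cle _ s _ t => s.ok L && t.ok L
  | L, .ite c s t => c.ok L && s.ok L && t.ok L
  | L, .iter d _ s b => decide (d = L) && s.ok L && b.ok (L + 2)

/-- Bound for the running time of the compiled term if all loop bounds are at most `M`. -/
def Term.cost (M : ℕ) : Term → ℕ
  | .const _ => 3
  | .var _ => 4
  | .rd _ t => t.cost M + 5
  | .add s t => s.cost M + t.cost M + 7
  | .sub s t => s.cost M + t.cost M + 7
  | .le s t => s.cost M + t.cost M + 12
  | .cle _ s _ t => s.cost M + t.cost M + 12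
  | .ite c s t => c.cost M + s.cost M + t.cost M + 4
  | .iter _ _ s b => s.cost M + M * (b.cost M + 24) + 24

/-- Entry `i` of the scratch array. -/
def scratch (i : ℕ) : Expr := .read 7 (.const i)

/-- Register `i`. -/
def register (i : ℕ) : Expr := .read 5 (.const i)

/-- Store an expression in entry `i` of array `a`. -/
def put (a i : ℕ) (e : Expr) : Program := .assign a (.const i) e

/-- The program that stores the value of a term in scratch entry `sp`. -/
def Term.compile : Term → ℕ → Program
  | .const c, sp => put 7 sp (.const c)
  | .var i, sp => put 7 sp (register i)
  | .rd a t, sp => .seq (t.compile sp) (put 7 sp (.read a (scratch sp)))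
  | .add s t, sp => .seq (s.compile sp) (.seq (t.compile (sp + 1))
      (put 7 sp (.add (scratch sp) (scratch (sp + 1)))))
  | .sub s t, sp => .seq (s.compile sp) (.seq (t.compile (sp + 1))
      (put 7 sp (.sub (scratch sp) (scratch (sp + 1)))))
  | .le s t, sp => .seq (s.compile sp) (.seq (t.compile (sp + 1))
      (.ite (.le (scratch sp) (scratch (sp + 1))) (put 7 sp (.const 1)) (put 7 sp (.const 0))))
  | .cle a s b t, sp => .seq (s.compile sp) (.seq (t.compile (sp + 1))
      (.ite (.coordLe a (scratch sp) b (scratch (sp + 1)))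
        (put 7 sp (.const 1)) (put 7 sp (.const 0))))
  | .ite c s t, sp => .seq (c.compile sp)
      (.ite (.le (scratch sp) (.const 0)) (t.compile sp) (s.compile sp))
  | .iter d j s b, sp => .seq (s.compile sp) (.seq (put 5 d (scratch sp))
      (.seq (put 5 (d + 1) (.const 0)) (.seq
        (.loop (.not (.le (.read 6 (.const j)) (register (d + 1))))
          (.seq (b.compile sp) (.seq (put 5 d (scratch sp))
            (put 5 (d + 1) (.add (register (d + 1)) (.const 1))))))
        (put 7 sp (register d)))))

/-! ### Correctness of compiled terms -/

/-- Two states agree outside of the scratch array and the registers from `L` on. -/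
def Agree (L : ℕ) (σ τ : State) : Prop := ∀ a i, a ≠ 7 → (a = 5 → i < L) → σ a i = τ a i

theorem State.store_self (σ : State) (a i v : ℕ) : σ.store a i v a i = v := by
  simp [State.store]

theorem State.store_of_ne (σ : State) {a i v b j : ℕ} (h : ¬(b = a ∧ j = i)) :
    σ.store a i v b j = σ b j := by
  simp only [State.store, if_neg h]

theorem Agree.refl (L : ℕ) (σ : State) : Agree L σ σ := fun _ _ _ _ => rfl

theorem Agree.mono {L L' : ℕ} (h : L' ≤ L) {σ τ : State} (H : Agree L σ τ) : Agree L' σ τ :=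
  fun a i h7 h5 => H a i h7 fun e => (h5 e).trans_le h

theorem Agree.trans {L : ℕ} {σ τ ρ : State} (h : Agree L σ τ) (h' : Agree L τ ρ) : Agree L σ ρ :=
  fun a i h7 h5 => (h a i h7 h5).trans (h' a i h7 h5)

theorem agree_scratch (L : ℕ) (τ : State) (i v : ℕ) : Agree L τ (τ.store 7 i v) :=
  fun _ _ h7 _ => (State.store_of_ne _ fun h => h7 h.1).symm

theorem agree_register {L d : ℕ} (h : L ≤ d) (τ : State) (v : ℕ) : Agree L τ (τ.store 5 d v) :=
  fun _ _ _ h5 => (State.store_of_ne _ fun e => by have := h5 e.1; omega).symm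

theorem Agree.store {L : ℕ} {σ τ : State} (h : Agree L σ τ) (a i v : ℕ) :
    Agree L (σ.store a i v) (τ.store a i v) := by
  intro b j h7 h5
  simp only [State.store]
  split_ifs
  · rfl
  · exact h b j h7 h5

/-- All loop bounds of the state are at most `M`. -/
def Bdd (M : ℕ) (σ : State) : Prop := ∀ j, σ 6 j ≤ M

theorem Bdd.store {M : ℕ} {σ : State} (h : Bdd M σ) {a : ℕ} (ha : a ≠ 6) (i v : ℕ) :
    Bdd M (σ.store a i v) := fun j => by
  rw [State.store_of_ne _ fun e => ha e.1.symm]; exact h j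

/-- Total correctness rule for a loop whose number of rounds is known in advance: the invariant is
indexed by the round and decides the test. Induction on the number of rounds that remain. -/
theorem exec_loop {X : Coords} {p : Test} {P : Program} (I : ℕ → State → Prop) (n c : ℕ)
    (hstep : ∀ i < n, ∀ σ, I i σ → p.holds X σ ∧ ∃ τ t, Exec X P σ τ t ∧ t ≤ c ∧ I (i + 1) τ)
    (hend : ∀ σ, I n σ → ¬ p.holds X σ) {σ : State} (h0 : I 0 σ) :
    ∃ τ t, Exec X (.loop p P) σ τ t ∧ t ≤ n * (p.cost + c) + p.cost ∧ I n τ := by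
  have key : ∀ m i, i + m = n → ∀ σ, I i σ →
      ∃ τ t, Exec X (.loop p P) σ τ t ∧ t ≤ m * (p.cost + c) + p.cost ∧ I n τ := by
    intro m
    induction m with
    | zero =>
      intro i hi σ hσ
      obtain rfl : i = n := by omega
      exact ⟨σ, p.cost, by constructor; exact hend σ hσ, by omega, hσ⟩
    | succ m ih =>
      intro i hi σ hσ
      obtain ⟨hp, τ, t, he, ht, hI⟩ := hstep i (by omega) σ hσ
      obtain ⟨ρ, s, he', hs, hI'⟩ := ih (i + 1) (by omega) τ hI
      exact ⟨ρ, _, .loop_step hp he he', by rw [Nat.succ_mul]; omega, hI'⟩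
  exact key n 0 (by omega) σ h0

theorem exec_put (X : Coords) (a i : ℕ) (e : Expr) (σ : State) :
    Exec X (put a i e) σ (σ.store a i (e.eval σ)) (e.cost + 2) := by
  have := Exec.assign (X := X) a (.const i) e σ
  simp only [Expr.eval, Expr.cost] at this
  rw [show e.cost + 2 = 1 + e.cost + 1 by omega]
  exact this

/-- `P`, started in `σ'`, computes `v` in scratch entry `sp`, with at most `n` steps and without
other visible effects. -/
def Computes (X : Coords) (P : Program) (σ' : State) (L sp v n : ℕ) : Prop :=
  ∃ τ t, Exec X P σ' τ t ∧ t ≤ n ∧ τ 7 sp = v ∧ (∀ i < sp, τ 7 i = σ' 7 i) ∧ Agree L σ' τ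

theorem computes_put {X : Coords} {σ' : State} {L sp v n : ℕ} {e : Expr} (hv : e.eval σ' = v)
    (hn : e.cost + 2 ≤ n) : Computes X (put 7 sp e) σ' L sp v n :=
  ⟨_, _, exec_put X 7 sp e σ', hn, by rw [State.store_self, hv],
    fun i hi => State.store_of_ne _ (by omega), agree_scratch _ _ _ _⟩

theorem Computes.seq {X : Coords} {P Q : Program} {σ' : State} {L sp v w n m : ℕ}
    (h : Computes X P σ' L sp v n)
    (h' : ∀ τ, τ 7 sp = v → Agree L σ' τ → Computes X Q τ L sp w m) :
    Computes X (.seq P Q) σ' L sp w (n + m) := by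
  obtain ⟨τ, t, he, ht, hv, hs, hA⟩ := h
  obtain ⟨ρ, u, he', hu, hw, hs', hA'⟩ := h' τ hv hA
  exact ⟨ρ, _, .seq he he', by omega, hw, fun i hi => (hs' i hi).trans (hs i hi), hA.trans hA'⟩

/-- The scratch array is a stack: the second operand is computed from `sp + 1` on and leaves the
first result in `sp` untouched. -/
theorem Computes.binary {X : Coords} {P Q R : Program} {σ' : State} {L sp v w u n m r : ℕ}
    (h : Computes X P σ' L sp v n)
    (h' : ∀ τ, Agree L σ' τ → Computes X Q τ L (sp + 1) w m)
    (h'' : ∀ τ, τ 7 sp = v → τ 7 (sp + 1) = w → Agree L σ' τ → Computes X R τ L sp u r) :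
    Computes X (.seq P (.seq Q R)) σ' L sp u (n + m + r) := by
  rw [add_assoc]
  refine h.seq fun τ hv hA => ?_
  obtain ⟨ρ, t, he, ht, hw, hs, hB⟩ := h' τ hA
  obtain ⟨θ, s, he', hs', hu, hi, hC⟩ := h'' ρ ((hs sp (by omega)).trans hv) hw (hA.trans hB)
  exact ⟨θ, _, .seq he he', by omega, hu, fun i h => (hi i h).trans (hs i (by omega)),
    hB.trans hC⟩

theorem Computes.ite {X : Coords} {p : Test} {P Q : Program} {σ' : State} {L sp v n m r : ℕ}
    (hp : p.holds X σ' → Computes X P σ' L sp v n)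
    (hn : ¬p.holds X σ' → Computes X Q σ' L sp v m) (hr : p.cost + n + m ≤ r) :
    Computes X (.ite p P Q) σ' L sp v r := by
  by_cases h : p.holds X σ'
  · obtain ⟨τ, t, he, ht, h'⟩ := hp h
    exact ⟨τ, _, .ite_true h he, by omega, h'⟩
  · obtain ⟨τ, t, he, ht, h'⟩ := hn h
    exact ⟨τ, _, .ite_false h he, by omega, h'⟩

/-- `Term.eval` binds a variable by a store into the abstract state, while the running program
already has the value in its register; this reconciles the two. -/
theorem agree_succ {L v : ℕ} {σ ρ : State} (h : Agree L σ ρ) (hv : ρ 5 L = v) :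
    Agree (L + 1) (σ.store 5 L v) ρ := by
  intro a i h7 h5
  simp only [State.store]
  split_ifs with e
  · rw [e.1, e.2, hv]
  · exact h a i h7 fun e5 => by have := h5 e5; omega

theorem agree_registers {L v w : ℕ} {σ ρ : State} (h : Agree L σ ρ) (hv : ρ 5 L = v)
    (hw : ρ 5 (L + 1) = w) : Agree (L + 2) ((σ.store 5 L v).store 5 (L + 1) w) ρ :=
  agree_succ (agree_succ h hv) hw

/-- The value is taken in `σ` but the program runs in `σ'`, which may differ in scratch entries and
free registers; the induction needs this slack because earlier subprograms have altered exactly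
those. -/
theorem Term.compile_correct (X : Coords) (M : ℕ) (t : Term) : ∀ (L sp : ℕ) (σ σ' : State),
    t.ok L → Agree L σ σ' → Bdd M σ →
    Computes X (t.compile sp) σ' L sp (t.eval X σ) (t.cost M) := by
  induction t with
  | const c => exact fun L sp σ σ' _ hA hB => computes_put rfl (by simp [Expr.cost, Term.cost])
  | var i =>
    intro L sp σ σ' ok hA hB
    simp only [Term.ok, decide_eq_true_eq] at ok
    exact computes_put (hA 5 i (by omega) fun _ => ok).symm
      (by simp [register, Expr.cost, Term.cost])
  | rd a t ih =>
    intro L sp σ σ' ok hA hB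
    simp only [Term.ok, Bool.and_eq_true, decide_eq_true_eq] at ok
    refine (ih L sp σ σ' ok.2 hA hB).seq fun τ hv hτ => computes_put ?_ ?_
    · simp only [scratch, Expr.eval, hv]
      exact ((hA.trans hτ) a _ ok.1.2 fun e => (ok.1.1 e).elim).symm
    · simp [scratch, Expr.cost]
  | add s t ih₁ ih₂ =>
    intro L sp σ σ' ok hA hB
    simp only [Term.ok, Bool.and_eq_true] at ok
    exact (ih₁ L sp σ σ' ok.1 hA hB).binary (fun τ hτ => ih₂ L _ σ τ ok.2 (hA.trans hτ) hB)
      fun τ hv hw hτ => computes_put (by simp only [scratch, Expr.eval, hv, hw, Term.eval])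
        (by simp [scratch, Expr.cost])
  | sub s t ih₁ ih₂ =>
    intro L sp σ σ' ok hA hB
    simp only [Term.ok, Bool.and_eq_true] at ok
    exact (ih₁ L sp σ σ' ok.1 hA hB).binary (fun τ hτ => ih₂ L _ σ τ ok.2 (hA.trans hτ) hB)
      fun τ hv hw hτ => computes_put (by simp only [scratch, Expr.eval, hv, hw, Term.eval])
        (by simp [scratch, Expr.cost])
  | le s t ih₁ ih₂ =>
    intro L sp σ σ' ok hA hB
    simp only [Term.ok, Bool.and_eq_true] at ok
    refine (ih₁ L sp σ σ' ok.1 hA hB).binary (fun τ hτ => ih₂ L _ σ τ ok.2 (hA.trans hτ) hB)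
      fun τ hv hw hτ => Computes.ite (n := 3) (m := 3)
        (fun h => ?_) (fun h => ?_) (by simp [Test.cost, scratch, Expr.cost])
    all_goals
      refine computes_put ?_ (by simp [Expr.cost])
      simp only [Test.holds, scratch, Expr.eval, hv, hw] at h
      simp [Expr.eval, Term.eval, h]
  | cle a s b t ih₁ ih₂ =>
    intro L sp σ σ' ok hA hB
    simp only [Term.ok, Bool.and_eq_true] at ok
    refine (ih₁ L sp σ σ' ok.1 hA hB).binary (fun τ hτ => ih₂ L _ σ τ ok.2 (hA.trans hτ) hB)
      fun τ hv hw hτ => Computes.ite (n := 3) (m := 3)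
        (fun h => ?_) (fun h => ?_) (by simp [Test.cost, scratch, Expr.cost])
    all_goals
      refine computes_put ?_ (by simp [Expr.cost])
      simp only [Test.holds, scratch, Expr.eval, hv, hw] at h
      simp only [Expr.eval, Term.eval, h, if_true, if_false]
  | ite c s t ih₁ ih₂ ih₃ =>
    intro L sp σ σ' ok hA hB
    simp only [Term.ok, Bool.and_eq_true] at ok
    rw [show (Term.ite c s t).cost M = c.cost M + (s.cost M + t.cost M + 4) by
      simp only [Term.cost]; omega]
    refine (ih₁ L sp σ σ' ok.1.1 hA hB).seq fun τ hv hτ => ?_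
    refine Computes.ite (n := t.cost M) (m := s.cost M) (fun h => ?_) (fun h => ?_)
      (by simp only [Test.cost, scratch, Expr.cost]; omega)
    · simp only [Test.holds, scratch, Expr.eval, hv, Nat.le_zero] at h
      simpa only [Term.eval, h, ne_eq, not_true, if_false] using
        ih₃ L sp σ τ ok.2 (hA.trans hτ) hB
    · simp only [Test.holds, scratch, Expr.eval, hv, Nat.le_zero] at h
      simpa only [Term.eval, h, ne_eq, not_false_iff, if_true] using
        ih₂ L sp σ τ ok.1.2 (hA.trans hτ) hB
  | iter d j s b ih₁ ih₂ =>
    intro L sp σ σ' ok hA hB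
    simp only [Term.ok, Bool.and_eq_true, decide_eq_true_eq] at ok
    obtain ⟨⟨rfl, oks⟩, okb⟩ := ok
    set acc : ℕ → ℕ := fun n => Nat.rec (motive := fun _ => ℕ) (s.eval X σ)
      (fun i acc => b.eval X ((σ.store 5 d acc).store 5 (d + 1) i)) n with hacc
    rw [show (Term.iter d j s b).eval X σ = acc (σ 6 j) from rfl]
    obtain ⟨τ, t, he, ht, hv, hs, hτ⟩ := ih₁ d sp σ σ' oks hA hB
    have e₂ := exec_put X 5 d (scratch sp) τ
    have e₃ := exec_put X 5 (d + 1) (.const 0) (τ.store 5 d ((scratch sp).eval τ))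
    have A₃ : Agree d σ' ((τ.store 5 d ((scratch sp).eval τ)).store 5 (d + 1) 0) :=
      hτ.trans ((agree_register le_rfl _ _).trans (agree_register (by omega) _ _))
    obtain ⟨ρ, u, he', hu, h5, h5', hsρ, hρ⟩ := exec_loop (X := X)
      (p := .not (.le (.read 6 (.const j)) (register (d + 1))))
      (P := .seq (b.compile sp) (.seq (put 5 d (scratch sp))
            (put 5 (d + 1) (.add (register (d + 1)) (.const 1)))))
      -- Accumulator and counter follow the recursion, while pending scratch values and outer
      -- registers survive; the loop bound in array `6` is covered by `Agree`.
      (fun i ρ => ρ 5 d = acc i ∧ ρ 5 (d + 1) = i ∧ (∀ i < sp, ρ 7 i = σ' 7 i) ∧ Agree d σ' ρ)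
      (σ 6 j) (b.cost M + 13)
      (by
        rintro i hi ρ ⟨h5, h5', hsρ, hρ⟩
        refine ⟨?_, ?_⟩
        · simp only [Test.holds, Expr.eval, register, h5']
          rw [← (hA.trans hρ) 6 j (by omega) (by omega)]
          omega
        obtain ⟨θ, v, hθ, hv, hw, hsθ, hAθ⟩ := ih₂ (d + 2) sp _ ρ okb
          (agree_registers (hA.trans hρ) h5 h5') ((hB.store (by omega) _ _).store (by omega) _ _)
        refine ⟨_, _, .seq hθ (.seq (exec_put X 5 d (scratch sp) θ) (exec_put X 5 (d + 1) _ _)),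
          ?_, ?_, ?_, ?_, ?_⟩
        · simp only [Expr.cost, scratch, register]; omega
        · rw [State.store_of_ne _ (by omega), State.store_self]
          simp only [scratch, Expr.eval, hw]; rfl
        · rw [State.store_self]
          simp only [register, Expr.eval]
          rw [State.store_of_ne _ (by omega), ← hAθ 5 _ (by omega) (by omega), h5']
        · intro i hi
          rw [State.store_of_ne _ (by omega), State.store_of_ne _ (by omega), hsθ i hi, hsρ i hi]
        · exact (hρ.trans (hAθ.mono (by omega))).trans
            ((agree_register le_rfl _ _).trans (agree_register (by omega) _ _)))
      (by
        rintro ρ ⟨-, h5', -, hρ⟩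
        simp only [Test.holds, Expr.eval, register, h5', not_not]
        rw [← (hA.trans hρ) 6 j (by omega) (by omega)])
      (σ := (τ.store 5 d ((scratch sp).eval τ)).store 5 (d + 1) 0)
      ⟨by rw [State.store_of_ne _ (by omega), State.store_self]; simpa only [scratch, Expr.eval],
        by rw [State.store_self],
        fun i hi => by
          rw [State.store_of_ne _ (by omega), State.store_of_ne _ (by omega), hs i hi], A₃⟩
    refine ⟨_, _, .seq he (.seq e₂ (.seq e₃ (.seq he' (exec_put X 7 sp (register d) ρ)))),
      ?_, ?_, ?_, ?_⟩
    · have : σ 6 j * ((Test.le (.read 6 (.const j)) (register (d + 1))).not.cost + (b.cost M + 13))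
          ≤ M * (b.cost M + 24) := by
        refine Nat.mul_le_mul (hB j) ?_
        simp only [Test.cost, Expr.cost, register]; omega
      simp only [Test.cost, Expr.cost, register, scratch, Term.cost] at *
      omega
    · rw [State.store_self]; exact h5
    · intro i hi
      rw [State.store_of_ne _ (by omega), hsρ i hi]
    · exact hρ.trans (agree_scratch _ _ _ _)

/-! ### Commands -/

/-- Commands: `set a i t` stores `t` in entry `i` of array `a`; `tab a j d t` stores the value of
`t` in entry `i` of array `a`, for `i < σ 6 j` in increasing order, where `t` may read `i` in
register `d`; `rep d j c` repeats `c` for `σ 6 j` rounds, counted in register `d`. -/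
inductive Cmd where
  | set (a i : ℕ) (t : Term)
  | tab (a j d : ℕ) (t : Term)
  | seq (c c' : Cmd)
  | rep (d j : ℕ) (c : Cmd)

/-- The state after filling in the first `n` entries of array `a`. -/
noncomputable def tabulate (X : Coords) (a d : ℕ) (t : Term) (σ : State) : ℕ → State
  | 0 => σ
  | n + 1 => (tabulate X a d t σ n).store a n (t.eval X ((tabulate X a d t σ n).store 5 d n))

/-- The state after `n` rounds of `f`, counted in register `d`. -/
def rounds (f : State → State) (d : ℕ) (σ : State) : ℕ → State
  | 0 => σ
  | n + 1 => f ((rounds f d σ n).store 5 d n)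

/-- The effect of a command. -/
noncomputable def Cmd.exec (X : Coords) : Cmd → State → State
  | .set a i t, σ => σ.store a i (t.eval X σ)
  | .tab a j d t, σ => tabulate X a d t σ (σ 6 j)
  | .seq c c', σ => c'.exec X (c.exec X σ)
  | .rep d j c, σ => rounds (c.exec X) d σ (σ 6 j)

/-- The command writes to array `a`. -/
def Cmd.writes (a : ℕ) : Cmd → Bool
  | .set b _ _ => decide (b = a)
  | .tab b _ _ _ => decide (b = a)
  | .seq c c' => c.writes a || c'.writes a
  | .rep _ _ c => c.writes a

/-- Well-formedness of commands using the registers from `L` on as counters. -/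
def Cmd.ok : ℕ → Cmd → Bool
  | L, .set a _ t => decide (a ≠ 5) && decide (a ≠ 7) && t.ok L
  | L, .tab a _ d t => decide (a ≠ 5) && decide (a ≠ 6) && decide (a ≠ 7) && decide (d = L)
      && t.ok (L + 1)
  | L, .seq c c' => c.ok L && c'.ok L
  | L, .rep d _ c => decide (d = L) && c.ok (L + 1) && !c.writes 6

/-- Bound for the running time of the compiled command if all loop bounds are at most `M`. -/
def Cmd.cost (M : ℕ) : Cmd → ℕ
  | .set _ _ t => t.cost M + 5
  | .tab _ _ _ t => M * (t.cost M + 20) + 20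
  | .seq c c' => c.cost M + c'.cost M
  | .rep _ _ c => M * (c.cost M + 20) + 20

/-- The program of a command. -/
def Cmd.compile : Cmd → Program
  | .set a i t => .seq (t.compile 0) (put a i (scratch 0))
  | .tab a j d t => .seq (put 5 d (.const 0))
      (.loop (.not (.le (.read 6 (.const j)) (register d)))
        (.seq (t.compile 0) (.seq (.assign a (register d) (scratch 0))
          (put 5 d (.add (register d) (.const 1))))))
  | .seq c c' => .seq c.compile c'.compile
  | .rep d j c => .seq (put 5 d (.const 0))
      (.loop (.not (.le (.read 6 (.const j)) (register d)))
        (.seq c.compile (put 5 d (.add (register d) (.const 1)))))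

/-- All loop bounds stay at most `M` during the execution of the top level commands. -/
def Cmd.Safe (X : Coords) (M : ℕ) : Cmd → State → Prop
  | .seq c c', σ => c.Safe X M σ ∧ c'.Safe X M (c.exec X σ)
  | .set _ _ _, σ => Bdd M σ
  | .tab _ _ _ _, σ => Bdd M σ
  | .rep _ _ _, σ => Bdd M σ

/-! ### Frame properties and correctness of compiled commands -/

theorem tabulate_of_ne (X : Coords) {a d : ℕ} (t : Term) (σ : State) {b : ℕ} (h : b ≠ a) (n : ℕ) :
    tabulate X a d t σ n b = σ b := by
  induction n with
  | zero => rfl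
  | succ n ih =>
    rw [tabulate, ← ih]
    exact funext fun j => State.store_of_ne _ fun e => h e.1

theorem Cmd.exec_of_not_writes (X : Coords) {a : ℕ} (ha : a ≠ 5) (c : Cmd) : ∀ σ : State,
    c.writes a = false → c.exec X σ a = σ a := by
  induction c with
  | set b i t =>
    intro σ h
    simp only [Cmd.writes, decide_eq_false_iff_not] at h
    exact funext fun j => State.store_of_ne _ fun e => h e.1.symm
  | tab b j d t =>
    intro σ h
    simp only [Cmd.writes, decide_eq_false_iff_not] at h
    exact tabulate_of_ne X t σ (fun e => h e.symm) _
  | seq c c' ih ih' =>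
    intro σ h
    simp only [Cmd.writes, Bool.or_eq_false_iff] at h
    rw [Cmd.exec, ih' _ h.2, ih _ h.1]
  | rep d j c ih =>
    intro σ h
    have : ∀ n, rounds (c.exec X) d σ n a = σ a := by
      intro n
      induction n with
      | zero => rfl
      | succ n ihn =>
        rw [rounds, ih _ h, ← ihn]
        exact funext fun j => State.store_of_ne _ fun e => ha e.1
    exact this _

theorem Cmd.exec_register (X : Coords) (c : Cmd) : ∀ (L : ℕ) (σ : State), c.ok L →
    ∀ i < L, c.exec X σ 5 i = σ 5 i := by
  induction c with
  | set b i t =>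
    intro L σ h i _
    simp only [Cmd.ok, Bool.and_eq_true, decide_eq_true_eq] at h
    exact State.store_of_ne _ fun e => h.1.1 e.1.symm
  | tab b j d t =>
    intro L σ h i _
    simp only [Cmd.ok, Bool.and_eq_true, decide_eq_true_eq] at h
    exact congrFun (tabulate_of_ne X t σ (fun e => h.1.1.1.1 e.symm) _) i
  | seq c c' ih ih' =>
    intro L σ h i hi
    simp only [Cmd.ok, Bool.and_eq_true] at h
    rw [Cmd.exec, ih' L _ h.2 i hi, ih L _ h.1 i hi]
  | rep d j c ih =>
    intro L σ h i hi
    simp only [Cmd.ok, Bool.and_eq_true, decide_eq_true_eq] at h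
    have : ∀ n, rounds (c.exec X) d σ n 5 i = σ 5 i := by
      intro n
      induction n with
      | zero => rfl
      | succ n ihn =>
        rw [rounds, ih (L + 1) _ h.1.2 i (by omega), ← ihn]
        exact State.store_of_ne _ (by omega)
    exact this _

/-- `Safe` follows the bounds only through top level commands; inside a repetition array `6` is
never written, so the bounds at its start remain in force. -/
theorem Cmd.safe_of_not_writes (X : Coords) {M : ℕ} (c : Cmd) : ∀ {σ : State},
    c.writes 6 = false → Bdd M σ → c.Safe X M σ := by
  induction c with
  | set b i t => exact fun _ h => h
  | tab b j d t => exact fun _ h => h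
  | rep d j c _ => exact fun _ h => h
  | seq c c' ih ih' =>
    intro σ h hB
    simp only [Cmd.writes, Bool.or_eq_false_iff] at h
    refine ⟨ih h.1 hB, ih' h.2 fun j => ?_⟩
    rw [c.exec_of_not_writes X (by omega) σ h.1]
    exact hB j

theorem Cmd.compile_correct (X : Coords) (M : ℕ) (c : Cmd) : ∀ (L : ℕ) (σ σ' : State),
    c.ok L → Agree L σ σ' → c.Safe X M σ →
    ∃ τ t, Exec X c.compile σ' τ t ∧ t ≤ c.cost M ∧ Agree L (c.exec X σ) τ := by
  induction c with
  | set a i t =>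
    intro L σ σ' ok hA hB
    simp only [Cmd.ok, Bool.and_eq_true, decide_eq_true_eq] at ok
    obtain ⟨τ, u, he, hu, hv, -, hτ⟩ := t.compile_correct X M L 0 σ σ' ok.2 hA hB
    refine ⟨_, _, .seq he (exec_put X a i (scratch 0) τ), ?_, ?_⟩
    · simp only [Expr.cost, scratch, Cmd.cost]; omega
    · simp only [scratch, Expr.eval, hv]
      exact (hA.trans hτ).store _ _ _
  | tab a j d t =>
    intro L σ σ' ok hA hB
    simp only [Cmd.ok, Bool.and_eq_true, decide_eq_true_eq] at ok
    obtain ⟨⟨⟨⟨ha5, ha6⟩, ha7⟩, rfl⟩, okt⟩ := ok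
    obtain ⟨ρ, u, he', hu, h5, hρ⟩ := exec_loop (X := X)
      (p := .not (.le (.read 6 (.const j)) (register d)))
      (P := .seq (t.compile 0) (.seq (.assign a (register d) (scratch 0))
          (put 5 d (.add (register d) (.const 1)))))
      (fun i ρ => ρ 5 d = i ∧ Agree d (tabulate X a d t σ i) ρ)
      (σ 6 j) (t.cost M + 14)
      (by
        rintro i hi ρ ⟨h5, hρ⟩
        have h6 : tabulate X a d t σ i 6 = σ 6 := tabulate_of_ne X t σ ha6.symm i
        refine ⟨?_, ?_⟩
        · simp only [Test.holds, Expr.eval, register, h5]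
          rw [← hρ 6 j (by omega) (by omega), h6]
          omega
        obtain ⟨θ, v, hθ, hv, hw, -, hAθ⟩ := t.compile_correct X M (d + 1) 0 _ ρ okt
          (agree_succ hρ h5) (Bdd.store (fun j => by rw [h6]; exact hB j) (by omega) _ _)
        refine ⟨_, _, .seq hθ (.seq (.assign a (register d) (scratch 0) θ)
          (exec_put X 5 d _ _)), ?_, ?_, ?_⟩
        · simp only [Expr.cost, scratch, register]; omega
        · rw [State.store_self]
          simp only [register, Expr.eval]
          rw [State.store_of_ne _ (by omega), ← hAθ 5 _ (by omega) (by omega), h5]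
        · have h5θ : θ 5 d = i := by rw [← hAθ 5 _ (by omega) (by omega), h5]
          simp only [register, scratch, Expr.eval, hw, h5θ]
          exact ((hρ.trans (hAθ.mono (by omega))).store _ _ _).trans (agree_register le_rfl _ _))
      (by
        rintro ρ ⟨h5, hρ⟩
        simp only [Test.holds, Expr.eval, register, h5, not_not]
        rw [← hρ 6 j (by omega) (by omega), tabulate_of_ne X t σ ha6.symm])
      (σ := σ'.store 5 d 0)
      ⟨by rw [State.store_self], hA.trans (agree_register le_rfl _ _)⟩
    refine ⟨_, _, .seq (exec_put X 5 d (.const 0) σ') he', ?_, hρ⟩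
    have : σ 6 j * ((Test.le (.read 6 (.const j)) (register d)).not.cost + (t.cost M + 14))
        ≤ M * (t.cost M + 20) := by
      refine Nat.mul_le_mul (hB j) ?_
      simp only [Test.cost, Expr.cost, register]; omega
    simp only [Test.cost, Expr.cost, register, Cmd.cost] at *
    omega
  | seq c c' ih ih' =>
    intro L σ σ' ok hA hS
    simp only [Cmd.ok, Bool.and_eq_true] at ok
    obtain ⟨τ, t, he, ht, hτ⟩ := ih L σ σ' ok.1 hA hS.1
    obtain ⟨ρ, u, he', hu, hρ⟩ := ih' L _ τ ok.2 hτ hS.2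
    exact ⟨ρ, _, .seq he he', by simp only [Cmd.cost]; omega, hρ⟩
  | rep d j c ih =>
    intro L σ σ' ok hA hB
    simp only [Cmd.ok, Bool.and_eq_true, decide_eq_true_eq, Bool.not_eq_true'] at ok
    obtain ⟨⟨rfl, okc⟩, hw⟩ := ok
    -- The body does not write the loop bounds, so the number of rounds is fixed when the loop is
    -- entered.
    have h6 : ∀ n, rounds (c.exec X) d σ n 6 = σ 6 := by
      intro n
      induction n with
      | zero => rfl
      | succ n ihn =>
        rw [rounds, c.exec_of_not_writes X (by omega) _ hw, ← ihn]
        exact funext fun j => State.store_of_ne _ (by omega)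
    obtain ⟨ρ, u, he', hu, h5, hρ⟩ := exec_loop (X := X)
      (p := .not (.le (.read 6 (.const j)) (register d)))
      (P := .seq c.compile (put 5 d (.add (register d) (.const 1))))
      (fun i ρ => ρ 5 d = i ∧ Agree d (rounds (c.exec X) d σ i) ρ)
      (σ 6 j) (c.cost M + 14)
      (by
        rintro i hi ρ ⟨h5, hρ⟩
        refine ⟨?_, ?_⟩
        · simp only [Test.holds, Expr.eval, register, h5]
          rw [← hρ 6 j (by omega) (by omega), h6]
          omega
        have hs : c.Safe X M ((rounds (c.exec X) d σ i).store 5 d i) :=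
          c.safe_of_not_writes X hw (Bdd.store (fun j => by rw [h6]; exact hB j) (by omega) _ _)
        obtain ⟨θ, v, hθ, hv, hAθ⟩ := ih (d + 1) _ ρ okc (agree_succ hρ h5) hs
        refine ⟨_, _, .seq hθ (exec_put X 5 d _ _), ?_, ?_, ?_⟩
        · simp only [Expr.cost, register]; omega
        · rw [State.store_self]
          simp only [register, Expr.eval]
          rw [← hAθ 5 _ (by omega) (by omega), c.exec_register X _ _ okc d (by omega),
            State.store_self]
        · exact (hAθ.mono (by omega)).trans (agree_register le_rfl _ _))
      (by
        rintro ρ ⟨h5, hρ⟩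
        simp only [Test.holds, Expr.eval, register, h5, not_not]
        rw [← hρ 6 j (by omega) (by omega), h6])
      (σ := σ'.store 5 d 0)
      ⟨by rw [State.store_self], hA.trans (agree_register le_rfl _ _)⟩
    refine ⟨_, _, .seq (exec_put X 5 d (.const 0) σ') he', ?_, hρ⟩
    have : σ 6 j * ((Test.le (.read 6 (.const j)) (register d)).not.cost + (c.cost M + 14))
        ≤ M * (c.cost M + 20) := by
      refine Nat.mul_le_mul (hB j) ?_
      simp only [Test.cost, Expr.cost, register]; omega
    simp only [Test.cost, Expr.cost, register, Cmd.cost] at *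
    omega

/-! ### Running times as polynomials in the largest loop bound -/

/-- Polynomially bounded functions. -/
def PolyBdd (f : ℕ → ℕ) : Prop := ∃ C D, ∀ M, f M ≤ C * (M + 1) ^ D

theorem polyBdd_const (c : ℕ) : PolyBdd fun _ => c := ⟨c, 0, fun M => by simp⟩

theorem polyBdd_id : PolyBdd fun M => M := ⟨1, 1, fun M => by simp⟩

theorem PolyBdd.add {f g : ℕ → ℕ} (hf : PolyBdd f) (hg : PolyBdd g) :
    PolyBdd fun M => f M + g M := by
  obtain ⟨C, D, h⟩ := hf
  obtain ⟨C', D', h'⟩ := hg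
  refine ⟨C + C', D + D', fun M => (Nat.add_le_add (h M) (h' M)).trans ?_⟩
  rw [add_mul]
  exact Nat.add_le_add (Nat.mul_le_mul_left _ (Nat.pow_le_pow_right (by omega) (by omega)))
    (Nat.mul_le_mul_left _ (Nat.pow_le_pow_right (by omega) (by omega)))

theorem PolyBdd.mul {f g : ℕ → ℕ} (hf : PolyBdd f) (hg : PolyBdd g) :
    PolyBdd fun M => f M * g M := by
  obtain ⟨C, D, h⟩ := hf
  obtain ⟨C', D', h'⟩ := hg
  refine ⟨C * C', D + D', fun M => (Nat.mul_le_mul (h M) (h' M)).trans ?_⟩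
  rw [pow_add, mul_mul_mul_comm]

/-- Each nested iteration multiplies by `M` once, and the term is fixed, so its nesting depth bounds
the degree. -/
theorem Term.polyBdd_cost (t : Term) : PolyBdd fun M => t.cost M := by
  induction t with
  | const c => exact polyBdd_const _
  | var i => exact polyBdd_const _
  | rd a t ih => exact ih.add (polyBdd_const _)
  | add s t ih ih' => exact (ih.add ih').add (polyBdd_const _)
  | sub s t ih ih' => exact (ih.add ih').add (polyBdd_const _)
  | le s t ih ih' => exact (ih.add ih').add (polyBdd_const _)
  | cle a s b t ih ih' => exact (ih.add ih').add (polyBdd_const _)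
  | ite c s t ih₁ ih₂ ih₃ => exact ((ih₁.add ih₂).add ih₃).add (polyBdd_const _)
  | iter d j s b ih ih' =>
    exact (ih.add (polyBdd_id.mul (ih'.add (polyBdd_const _)))).add (polyBdd_const _)

theorem Cmd.polyBdd_cost (c : Cmd) : PolyBdd fun M => c.cost M := by
  induction c with
  | set a i t => exact t.polyBdd_cost.add (polyBdd_const _)
  | tab a j d t => exact (polyBdd_id.mul (t.polyBdd_cost.add (polyBdd_const _))).add (polyBdd_const _)
  | seq c c' ih ih' => exact ih.add ih'
  | rep d j c ih => exact (polyBdd_id.mul (ih.add (polyBdd_const _))).add (polyBdd_const _)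

end RectStab

namespace RectStab

/-! ### Greedy stabbing of intervals -/

open Classical in
/-- The maximum of `d` and of the `f i` with `i < n` and `C i`. -/
noncomputable def maxIf (C : ℕ → Prop) (f : ℕ → ℕ) (d : ℕ) : ℕ → ℕ
  | 0 => d
  | n + 1 => if C n then max (maxIf C f d n) (f n) else maxIf C f d n

open Classical in
/-- The minimum of `d` and of the `f i` with `i < n` and `C i`. -/
noncomputable def minIf (C : ℕ → Prop) (f : ℕ → ℕ) (d : ℕ) : ℕ → ℕ
  | 0 => d
  | n + 1 => if C n then min (minIf C f d n) (f n) else minIf C f d n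

theorem le_maxIf (C : ℕ → Prop) (f : ℕ → ℕ) (d n : ℕ) : d ≤ maxIf C f d n := by
  induction n with
  | zero => exact le_rfl
  | succ n ih => rw [maxIf]; split_ifs <;> omega

theorem le_maxIf_of (C : ℕ → Prop) (f : ℕ → ℕ) (d : ℕ) {n i : ℕ} (hi : i < n) (h : C i) :
    f i ≤ maxIf C f d n := by
  induction n with
  | zero => omega
  | succ n ih =>
    rw [maxIf]
    rcases Nat.lt_succ_iff_lt_or_eq.1 hi with hi | rfl
    · have := ih hi; split_ifs <;> omega
    · rw [if_pos h]; omega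

theorem maxIf_eq (C : ℕ → Prop) (f : ℕ → ℕ) (d n : ℕ) :
    maxIf C f d n = d ∨ ∃ i < n, C i ∧ maxIf C f d n = f i := by
  induction n with
  | zero => exact .inl rfl
  | succ n ih =>
    rw [maxIf]
    split_ifs with h
    · rcases le_total (maxIf C f d n) (f n) with h' | h'
      · exact .inr ⟨n, by omega, h, max_eq_right h'⟩
      · rw [max_eq_left h']
        exact ih.imp_right fun ⟨i, hi, h⟩ => ⟨i, by omega, h⟩
    · exact ih.imp_right fun ⟨i, hi, h⟩ => ⟨i, by omega, h⟩

theorem minIf_le (C : ℕ → Prop) (f : ℕ → ℕ) (d n : ℕ) : minIf C f d n ≤ d := by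
  induction n with
  | zero => exact le_rfl
  | succ n ih => rw [minIf]; split_ifs <;> omega

theorem minIf_le_of (C : ℕ → Prop) (f : ℕ → ℕ) (d : ℕ) {n i : ℕ} (hi : i < n) (h : C i) :
    minIf C f d n ≤ f i := by
  induction n with
  | zero => omega
  | succ n ih =>
    rw [minIf]
    rcases Nat.lt_succ_iff_lt_or_eq.1 hi with hi | rfl
    · have := ih hi; split_ifs <;> omega
    · rw [if_pos h]; omega

theorem le_minIf {C : ℕ → Prop} {f : ℕ → ℕ} {d n x : ℕ} (hd : x ≤ d)
    (h : ∀ i < n, C i → x ≤ f i) : x ≤ minIf C f d n := by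
  induction n with
  | zero => exact hd
  | succ n ih =>
    have := ih fun i hi => h i (by omega)
    rw [minIf]
    split_ifs with hn
    · exact le_min this (h n (by omega) hn)
    · exact this

/-- The points chosen greedily from right to left, starting below `a`, for the intervals
`[lo R, hi R]` with `R < n` and `C R`; each point is the largest left endpoint of the intervals
to the left of the previous one, or `d` if there is none. -/
noncomputable def greedy (n : ℕ) (C : ℕ → Prop) (lo hi : ℕ → ℕ) (d a : ℕ) : ℕ → ℕ
  | 0 => a
  | i + 1 => maxIf (fun R => C R ∧ hi R < greedy n C lo hi d a i) lo d n

section greedy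
variable {n : ℕ} {C : ℕ → Prop} {lo hi : ℕ → ℕ} {d a : ℕ}

theorem le_greedy_succ (i : ℕ) : d ≤ greedy n C lo hi d a (i + 1) := le_maxIf _ _ _ _

/-- Look at the first round whose point is not beyond `hi R`: in that round `R` still competed for
the maximum, so the point is at least `lo R`. -/
theorem greedy_stabs {k R : ℕ} (hR : R < n) (hC : C R) (ha : hi R < a)
    (hk : greedy n C lo hi d a k ≤ hi R) :
    ∃ i < k, lo R ≤ greedy n C lo hi d a (i + 1) ∧ greedy n C lo hi d a (i + 1) ≤ hi R := by
  induction k with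
  | zero => rw [greedy] at hk; omega
  | succ k ih =>
    by_cases h : greedy n C lo hi d a k ≤ hi R
    · obtain ⟨i, hi, h⟩ := ih h
      exact ⟨i, by omega, h⟩
    · exact ⟨k, by omega, le_maxIf_of (fun R => C R ∧ hi R < greedy n C lo hi d a k) lo d hR
        ⟨hC, by omega⟩, hk⟩

variable {A : Finset ℕ} (hA : ∀ x ∈ A, d ≤ x)
  (hit : ∀ R < n, C R → ∃ x ∈ A, lo R ≤ x ∧ x ≤ hi R)
include hA hit

/-- The interval that defines the next greedy point ends below the previous point, so the element of
`A` stabbing it was not yet counted: each round gains one element. -/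
theorem le_card_greedy_le (i : ℕ) (h : i ≤ A.card) :
    i ≤ (A.filter fun x => greedy n C lo hi d a i ≤ x).card := by
  induction i with
  | zero => omega
  | succ i ih =>
    rcases maxIf_eq (fun R => C R ∧ hi R < greedy n C lo hi d a i) lo d n with e | ⟨R, hR, hC, e⟩
    · rw [Finset.filter_true_of_mem]
      · exact h
      · intro x hx; rw [greedy, e]; exact hA x hx
    · obtain ⟨x, hx, h1, h2⟩ := hit R hR hC.1
      refine (Nat.succ_le_succ (ih (by omega))).trans (Finset.card_lt_card ?_)
      rw [Finset.ssubset_iff_of_subset]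
      · refine ⟨x, ?_, ?_⟩
        · simp only [Finset.mem_filter]
          exact ⟨hx, by rw [greedy, e]; exact h1⟩
        · simp only [Finset.mem_filter, not_and, not_le]
          intro _; have := hC.2; omega
      · intro y hy
        simp only [Finset.mem_filter] at hy ⊢
        refine ⟨hy.1, ?_⟩
        rw [greedy, e]; have := hC.2; omega

theorem greedy_card_le {x : ℕ} (hx : x ∈ A) : greedy n C lo hi d a A.card ≤ x := by
  have h := Finset.eq_of_subset_of_card_le (Finset.filter_subset _ _)
    (le_card_greedy_le (a := a) hA hit A.card le_rfl)
  rw [← h] at hx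
  exact (Finset.mem_filter.1 hx).2

/-- Superfluous rounds fall back to the default `d`: an interval ending below the current point
would have to be stabbed by an element of `A`, but all of these are at least that point. -/
theorem greedy_le_of_card_le {k : ℕ} (hk : A.card ≤ k) {x : ℕ} (hx : x ∈ A) :
    greedy n C lo hi d a k ≤ x := by
  induction k, hk using Nat.le_induction with
  | base => exact greedy_card_le hA hit hx
  | succ k hk ih =>
    rcases maxIf_eq (fun R => C R ∧ hi R < greedy n C lo hi d a k) lo d n with e | ⟨R, hR, hC, e⟩
    · rw [greedy, e]; exact hA x hx
    · obtain ⟨y, hy, h1, h2⟩ := hit R hR hC.1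
      rw [greedy, e]; have := hC.2; omega

end greedy

/-! ### Instances on one axis -/

/-- An instance with all lines on one axis: the first kind has positions between `0` and `off`,
the second kind has positions between `off` and `w`. Rectangle `R < n` is stabbed by the lines of
the first kind in `[lx R, hx R]` and by those of the second kind in `[ly R, hy R]`. -/
structure Inst where
  n : ℕ
  k : ℕ
  off : ℕ
  w : ℕ
  lx : ℕ → ℕ
  hx : ℕ → ℕ
  ly : ℕ → ℕ
  hy : ℕ → ℕ
  off_pos : 0 < off
  off_lt : off < w
  lx_pos : ∀ R < n, 0 < lx R
  hx_lt : ∀ R < n, hx R < off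
  ly_gt : ∀ R < n, off < ly R
  hy_lt : ∀ R < n, hy R < w

namespace Inst
variable (I : Inst)

/-- Position `x` stabs rectangle `R`. -/
def Hit (x R : ℕ) : Prop := (I.lx R ≤ x ∧ x ≤ I.hx R) ∨ (I.ly R ≤ x ∧ x ≤ I.hy R)

/-- Greedy stabbing, by lines of the second kind, of the rectangles strictly between `s` and
`r`. -/
noncomputable def gr (s r : ℕ) : ℕ → ℕ :=
  greedy I.n (fun R => s < I.lx R ∧ I.hx R < r) I.ly I.hy I.off I.w

/-- The rectangles strictly between `s` and `r` are stabbed by `k` lines of the second kind. -/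
def Stab (s r : ℕ) : Prop := ∀ R < I.n, s < I.lx R ∧ I.hx R < r → I.gr s r I.k ≤ I.hy R

open Classical in
/-- The last mark at or before a position up to `off`, `0` if there is none. -/
noncomputable def last : ℕ → ℕ
  | 0 => 0
  | p + 1 => if I.off ≤ p + 1 ∨ ¬ I.Stab (last p) (p + 2) then p + 1 else last p

/-- The marks delimit the strips. -/
def Mark (p : ℕ) : Prop :=
  0 < p ∧ ((p ≤ I.off ∧ I.last p = p) ∨ (I.off < p ∧ (p = I.w ∨
    ∃ q ≤ I.off, (0 < q ∧ I.last q = q) ∧ ∃ i < I.k, p = I.gr (I.last (q - 1)) q (i + 1))))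

/-- The largest mark before `p`, `0` if there is none. -/
noncomputable def prev (p : ℕ) : ℕ := maxIf I.Mark id 0 p

open Classical in
/-- The number of marks before `p`. -/
noncomputable def ord (p : ℕ) : ℕ := Nat.count I.Mark p

/-- The lower end of `R` in the kind of lines of strip `p`. -/
def lo (p R : ℕ) : ℕ := if p ≤ I.off then I.lx R else I.ly R

/-- The upper end of `R` in the kind of lines of strip `p`. -/
def hi (p R : ℕ) : ℕ := if p ≤ I.off then I.hx R else I.hy R

/-- Rectangle `R` lies strictly inside of strip `p`. -/
def Inside (p R : ℕ) : Prop := I.prev p < I.lo p R ∧ I.hi p R < p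

/-- The strips for which a single line is selected. -/
def Single (c : ℕ) (m : ℕ → ℕ) (p : ℕ) : Prop := p ≤ I.off ∧ m p = 1 ∧ (I.ord p + c) % 2 = 0

/-- The position selected in a strip with a single line. -/
noncomputable def single (F : ℕ → Prop) (p : ℕ) : ℕ :=
  minIf (fun R => F R ∧ I.Inside p R) (I.hi p) p I.n

/-- The positions selected inside of a strip. -/
noncomputable def inner (F : ℕ → Prop) (p : ℕ) : ℕ → ℕ :=
  greedy I.n (fun R => F R ∧ I.Inside p R) (I.lo p) (I.hi p) (I.prev p) (I.w + 1)

/-- The positions selected in strip `p` if `F` is the set of flagged rectangles. -/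
def SelIn (c : ℕ) (m : ℕ → ℕ) (F : ℕ → Prop) (p x : ℕ) : Prop :=
  (I.Single c m p ∧ x = I.single F p) ∨
    (¬ I.Single c m p ∧ (x = p ∨ ∃ i < I.k, i < m p ∧ x = I.inner F p (i + 1)))

/-- The selected positions. -/
def Sel (c : ℕ) (m : ℕ → ℕ) (F : ℕ → Prop) (x : ℕ) : Prop :=
  ∃ p ≤ I.w, (I.Mark p ∧ 0 < m p) ∧ I.SelIn c m F p x

/-- The rectangle is stabbed by a selected position. -/
def HitBy (c : ℕ) (m : ℕ → ℕ) (F : ℕ → Prop) (R : ℕ) : Prop :=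
  ∃ x ≤ I.w, I.Sel c m F x ∧ I.Hit x R

/-- The flagged rectangles after `r` rounds. -/
def Flag (c : ℕ) (m : ℕ → ℕ) : ℕ → ℕ → Prop
  | 0, _ => False
  | r + 1, R => Flag c m r R ∨ (R < I.n ∧ ¬ I.HitBy c m (Flag c m r) R)

/-! ### Strips between consecutive marks and their numbering -/

theorem mark_iff_of_le {p : ℕ} (h : p ≤ I.off) : I.Mark p ↔ 0 < p ∧ I.last p = p := by
  unfold Mark
  constructor
  · rintro ⟨h0, h1 | h1⟩
    · exact ⟨h0, h1.2⟩
    · omega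
  · exact fun h' => ⟨h'.1, .inl ⟨h, h'.2⟩⟩

theorem mark_off : I.Mark I.off := by
  rw [I.mark_iff_of_le le_rfl]
  refine ⟨I.off_pos, ?_⟩
  obtain ⟨q, hq⟩ := Nat.exists_eq_succ_of_ne_zero I.off_pos.ne'
  rw [hq, last, if_pos (.inl hq.le)]

theorem mark_w : I.Mark I.w := ⟨I.off_pos.trans I.off_lt, .inr ⟨I.off_lt, .inl rfl⟩⟩

theorem prev_lt {p : ℕ} (hp : 0 < p) : I.prev p < p := by
  rcases maxIf_eq I.Mark id 0 p with h | ⟨i, hi, -, h⟩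
  · rw [prev, h]; exact hp
  · rw [prev, h]; exact hi

theorem le_prev {p q : ℕ} (hq : I.Mark q) (h : q < p) : q ≤ I.prev p :=
  le_maxIf_of I.Mark id 0 h hq

theorem prev_eq (p : ℕ) : I.prev p = 0 ∨ I.Mark (I.prev p) := by
  rcases maxIf_eq I.Mark id 0 p with h | ⟨i, hi, h', h⟩
  · exact .inl h
  · right; rw [prev, h]; exact h'

/-- On the first-kind part the marks are exactly the fixed points of `last`, so the recursion that
decides where to cut also yields the left borders of the strips. -/
theorem prev_succ {p : ℕ} (h : p ≤ I.off) : I.prev (p + 1) = I.last p := by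
  induction p with
  | zero =>
    rw [prev, maxIf, maxIf, if_neg fun h => absurd h.1 (lt_irrefl _)]; rfl
  | succ p ih =>
    have ih := ih (by omega)
    rw [prev] at ih ⊢
    rw [maxIf, ih]
    have hl : I.last p ≤ p := by
      rw [← ih]; exact Nat.lt_succ_iff.1 (I.prev_lt (by omega))
    split_ifs with h'
    · rw [((I.mark_iff_of_le h).1 h').2]; simp only [id]; omega
    · rw [I.mark_iff_of_le h] at h'
      rw [last] at h' ⊢
      split_ifs with e
      · rw [if_pos e] at h'; omega
      · rfl

theorem prev_eq_last {p : ℕ} (h0 : 0 < p) (h : p ≤ I.off) : I.prev p = I.last (p - 1) := by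
  obtain ⟨q, rfl⟩ := Nat.exists_eq_succ_of_ne_zero h0.ne'
  exact I.prev_succ (by omega)

/-- The mark that ends the strip of `x`. -/
theorem exists_strip {x : ℕ} (h0 : 0 < x) (h : x ≤ I.w) :
    ∃ p ≤ I.w, I.Mark p ∧ I.prev p < x ∧ x ≤ p := by
  classical
  have hex : ∃ p, I.Mark p ∧ x ≤ p := ⟨I.w, I.mark_w, h⟩
  refine ⟨Nat.find hex, Nat.find_min' hex ⟨I.mark_w, h⟩, (Nat.find_spec hex).1, ?_,
    (Nat.find_spec hex).2⟩
  by_contra hlt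
  rcases I.prev_eq (Nat.find hex) with e | e
  · omega
  · exact Nat.find_min hex (I.prev_lt (h0.trans_le (Nat.find_spec hex).2)) ⟨e, by omega⟩

theorem strip_unique {x p q : ℕ} (hp : I.Mark p) (hq : I.Mark q) (h1 : I.prev p < x) (h2 : x ≤ p)
    (h3 : I.prev q < x) (h4 : x ≤ q) : p = q := by
  rcases lt_trichotomy p q with h | h | h
  · have := I.le_prev hp h; omega
  · exact h
  · have := I.le_prev hq h; omega

variable {I} in
-- No mark lies strictly between `prev p` and `p`. Hence adjacent strips have opposite parity, on
-- which the selection of single lines relies.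
theorem ord_eq {p : ℕ} (h : I.prev p < p) (hp : I.Mark (I.prev p)) :
    I.ord p = I.ord (I.prev p) + 1 := by
  classical
  have key : ∀ q, I.prev p < q → q ≤ p → I.ord q = I.ord (I.prev p) + 1 := by
    intro q hq
    induction q, hq using Nat.le_induction with
    | base => intro _; unfold ord; rw [Nat.count_succ, if_pos hp]
    | succ q hq ih =>
      intro hqp
      rw [← ih (by omega)]
      unfold ord
      rw [Nat.count_succ, if_neg, add_zero]
      exact fun hm => by have := I.le_prev hm (by omega : q < p); omega
  exact key p h le_rfl

/-! ### What a solution implies about the marks -/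

/-- A solution of the instance, at most half of it of the second kind. -/
structure Sol (A : Finset ℕ) : Prop where
  card_le : A.card ≤ I.k
  mem : ∀ x ∈ A, 0 < x ∧ x < I.w ∧ x ≠ I.off
  hit : ∀ R < I.n, ∃ x ∈ A, I.Hit x R
  half : 2 * (A.filter fun x => I.off < x).card ≤ A.card

variable {I} {A : Finset ℕ} (hA : I.Sol A)
include hA

/-- Without solution lines strictly between `s` and `r`, the second-kind lines of the solution stab
all these rectangles; there are at most `k` of them, and greedy is optimal. -/
theorem Sol.gr_le {s r R : ℕ} (h : ∀ x ∈ A, ¬ (s < x ∧ x < r)) (hR : R < I.n)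
    (hs : s < I.lx R ∧ I.hx R < r) : I.gr s r I.k ≤ I.hy R := by
  have key : ∀ R < I.n, s < I.lx R ∧ I.hx R < r →
      ∃ x ∈ A.filter fun x => I.off < x, I.ly R ≤ x ∧ x ≤ I.hy R := by
    intro R hR hs
    obtain ⟨x, hx, hl | hl⟩ := hA.hit R hR
    · exact absurd ⟨hs.1.trans_le hl.1, hl.2.trans_lt hs.2⟩ (h x hx)
    · refine ⟨x, Finset.mem_filter.2 ⟨hx, (I.ly_gt R hR).trans_le hl.1⟩, hl⟩
  obtain ⟨x, hx, h1, h2⟩ := key R hR hs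
  exact (greedy_le_of_card_le (fun x hx => (Finset.mem_filter.1 hx).2.le) key
    ((Finset.card_filter_le _ _).trans hA.card_le) hx).trans h2

/-- If the strip had no solution line, even the rectangles reaching `p` but not beyond could be
stabbed by `k` second-kind lines, and no cut would have been made at `p`. The mark `off` is excluded
because it is set unconditionally. -/
theorem Sol.exists_mem_of_mark {p : ℕ} (hp : I.Mark p) (h : p < I.off) :
    ∃ x ∈ A, I.prev p < x ∧ x ≤ p := by
  by_contra hno
  push Not at hno
  rw [I.prev_eq_last hp.1 h.le] at hno
  obtain ⟨h0, hl⟩ := (I.mark_iff_of_le h.le).1 hp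
  obtain ⟨q, rfl⟩ := Nat.exists_eq_succ_of_ne_zero h0.ne'
  have hq : I.last q ≤ q := by
    rw [← I.prev_succ (by omega)]; exact Nat.lt_succ_iff.1 (I.prev_lt (by omega))
  have hs : I.Stab (I.last q) (q + 2) := fun R hR hs => hA.gr_le (fun x hx hx' => by
    have := hno x hx (by simpa using hx'.1); omega) hR hs
  rw [Nat.succ_eq_add_one, last, if_neg] at hl
  · omega
  · push Not; exact ⟨h, hs⟩

theorem Sol.exists_mark_of_inside {p R : ℕ} (hp : I.Mark p) (h : p ≤ I.off) (hR : R < I.n)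
    (hs : I.prev p < I.lx R ∧ I.hx R < p) : ∃ y, I.Mark y ∧ I.ly R ≤ y ∧ y ≤ I.hy R := by
  obtain ⟨h0, hl⟩ := (I.mark_iff_of_le h).1 hp
  have hk : I.gr (I.prev p) p I.k ≤ I.hy R := by
    rw [I.prev_eq_last h0 h] at hs ⊢
    obtain ⟨q, rfl⟩ := Nat.exists_eq_succ_of_ne_zero h0.ne'
    simp only [Nat.succ_eq_add_one, Nat.add_sub_cancel] at *
    -- If the position before the mark is a mark too, nothing lies strictly between them, yet
    -- rectangles with an empty first-kind interval may still qualify; the solution must stab those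
    -- by second-kind lines. Otherwise no cut was made at `q`, which says that `Stab` holds for the
    -- strip.
    by_cases hq : I.last q = q
    · exact hA.gr_le (fun x _ => by omega) hR hs
    · obtain _ | q := q
      · exact absurd rfl hq
      · rw [last] at hq hs ⊢
        split_ifs at hq hs ⊢ with e
        · omega
        · push Not at e
          exact e.2 R hR hs
  obtain ⟨i, hi, h1, h2⟩ := greedy_stabs (lo := I.ly) (hi := I.hy) hR hs (I.hy_lt R hR) hk
  have : I.off < I.gr (I.prev p) p (i + 1) := (I.ly_gt R hR).trans_le h1
  refine ⟨I.gr (I.prev p) p (i + 1), ⟨by omega, .inr ⟨this, .inr ⟨p, h, ⟨h0, hl⟩, i, hi, ?_⟩⟩⟩,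
    h1, h2⟩
  rw [I.prev_eq_last h0 h]

omit hA in
-- A mark within the second-kind interval of `R` and before `q` is at most `prev q`, so the interval
-- reaches the left border of the strip.
theorem not_inside_both {q R y : ℕ} (hy : I.Mark y) (h1 : I.ly R ≤ y) (h2 : y ≤ I.hy R)
    (h : I.off < q) (hq : I.Inside q R) : False := by
  unfold Inside lo hi at hq
  rw [if_neg (by omega), if_neg (by omega)] at hq
  have := I.le_prev hy (by omega : y < q)
  omega

/-- Since `off` is a mark, no strip contains positions on both sides of it, and the strip determines
which of the two intervals of `R` is hit. -/
theorem Sol.hit_kind {x p R : ℕ} (hx : x ∈ A) (h1 : I.prev p < x) (h2 : x ≤ p)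
    (hR : R < I.n) (h : I.Hit x R) : I.lo p R ≤ x ∧ x ≤ I.hi p R := by
  have hx' := hA.mem x hx
  have := I.hx_lt R hR
  have := I.ly_gt R hR
  unfold lo hi
  by_cases hpo : p ≤ I.off
  · rw [if_pos hpo, if_pos hpo]
    rcases h with h | h <;> omega
  · rw [if_neg hpo, if_neg hpo]
    have := I.le_prev I.mark_off (by omega : I.off < p)
    rcases h with h | h <;> omega

omit hA in
theorem hit_of_kind {x p R : ℕ} (h : I.lo p R ≤ x ∧ x ≤ I.hi p R) : I.Hit x R := by
  unfold lo hi at h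
  split_ifs at h
  · exact .inl h
  · exact .inr h

omit hA in
theorem le_w_of_hit {x R : ℕ} (hR : R < I.n) (h : I.Hit x R) : x ≤ I.w := by
  have := I.hx_lt R hR
  have := I.hy_lt R hR
  have := I.off_lt
  rcases h with h | h <;> omega

omit hA in
theorem hi_lt_w (p : ℕ) {R : ℕ} (hR : R < I.n) : I.hi p R < I.w := by
  have := I.hx_lt R hR
  have := I.hy_lt R hR
  have := I.off_lt
  unfold hi
  split_ifs <;> omega

/-! ### Correctness of the flags if the strip sizes are guessed right -/

/-- The lines of a solution in strip `p`. -/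
noncomputable def part (I : Inst) (A : Finset ℕ) (p : ℕ) : Finset ℕ := A.filter fun x => I.prev p < x ∧ x ≤ p

omit hA in
theorem mem_part {p x : ℕ} : x ∈ I.part A p ↔ x ∈ A ∧ I.prev p < x ∧ x ≤ p := Finset.mem_filter

/-- The flagged rectangle lies inside of a strip, and the solution stabs it there. -/
def Good (I : Inst) (A : Finset ℕ) (R : ℕ) : Prop :=
  (∃ p ≤ I.w, I.Mark p ∧ I.Inside p R) ∧
    ∀ p, I.Mark p → I.Inside p R → ∃ x ∈ I.part A p, I.lo p R ≤ x ∧ x ≤ I.hi p R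

variable {c : ℕ} {m : ℕ → ℕ} (hm : ∀ p ≤ I.w, I.Mark p → m p = (I.part A p).card)
  {F : ℕ → Prop} (hF : ∀ R < I.n, F R → I.Good A R)
include hm hF

/-- All flagged rectangles inside a strip can be stabbed by the `m p` solution lines of that strip,
so the greedy points, or the single one, stab them as well. -/
theorem Sol.hitBy_of_flag {R : ℕ} (hR : R < I.n) (hFR : F R) : I.HitBy c m F R := by
  obtain ⟨⟨p, hpw, hp, hin⟩, hgood⟩ := hF R hR hFR
  obtain ⟨x, hx, hx'⟩ := hgood p hp hin
  have hmp := hm p hpw hp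
  have hpos : 0 < m p := by rw [hmp]; exact Finset.card_pos.2 ⟨x, hx⟩
  have all : ∀ R < I.n, F R ∧ I.Inside p R → ∃ x ∈ I.part A p, I.lo p R ≤ x ∧ x ≤ I.hi p R :=
    fun R hR h => (hF R hR h.1).2 p hp h.2
  suffices h : ∃ y, I.SelIn c m F p y ∧ I.lo p R ≤ y ∧ y ≤ I.hi p R by
    obtain ⟨y, hy, h⟩ := h
    exact ⟨y, le_w_of_hit hR (hit_of_kind h), ⟨p, hpw, ⟨hp, hpos⟩, hy⟩, hit_of_kind h⟩
  by_cases hs : I.Single c m p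
  -- The only solution line `x` of the strip stabs every flagged rectangle inside it, so the least
  -- upper end is at least `x` and therefore at least `lo p R`.
  · refine ⟨_, .inl ⟨hs, rfl⟩, hx'.1.trans (le_minIf (mem_part.1 hx).2.2 ?_),
      minIf_le_of _ _ _ hR ⟨hFR, hin⟩⟩
    intro R' hR' h'
    obtain ⟨y, hy, hy'⟩ := all R' hR' h'
    obtain ⟨z, hz⟩ := Finset.card_eq_one.1 (hmp.symm.trans hs.2.1)
    rw [hz, Finset.mem_singleton] at hx hy
    rw [hx, ← hy]; exact hy'.2
  · have hg : I.inner F p (m p) ≤ x := by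
      rw [hmp]
      exact greedy_card_le (fun y hy => (mem_part.1 hy).2.1.le) all hx
    obtain ⟨i, hi, h⟩ := greedy_stabs hR ⟨hFR, hin⟩ ((hi_lt_w p hR).trans (Nat.lt_succ_self _))
      (hg.trans hx'.2)
    have hmk : m p ≤ I.k := by
      rw [hmp]; exact (Finset.card_filter_le _ _).trans hA.card_le
    exact ⟨_, .inr ⟨hs, .inr ⟨i, by omega, hi, rfl⟩⟩, h⟩

/-- In the strip `p` where the solution stabs `R`, a missed `R` cannot protrude on either side, as
it would then contain a selected position; so it lies inside. This keeps the flags right from one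
round to the next. -/
theorem Sol.good_of_not_hitBy {R : ℕ} (hR : R < I.n) (hh : ¬ I.HitBy c m F R) : I.Good A R := by
  obtain ⟨x, hx, hxR⟩ := hA.hit R hR
  have hxm := hA.mem x hx
  obtain ⟨p, hpw, hp, h1, h2⟩ := I.exists_strip hxm.1 hxm.2.1.le
  have hk := hA.hit_kind hx h1 h2 hR hxR
  have hmp := hm p hpw hp
  have hxp : x ∈ I.part A p := mem_part.2 ⟨hx, h1, h2⟩
  have hpos : 0 < m p := by rw [hmp]; exact Finset.card_pos.2 ⟨x, hxp⟩
  have all : ∀ R < I.n, F R ∧ I.Inside p R → ∃ x ∈ I.part A p, I.lo p R ≤ x ∧ x ≤ I.hi p R :=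
    fun R hR h => (hF R hR h.1).2 p hp h.2
  have hno : ∀ q ≤ I.w, I.Mark q → 0 < m q → ∀ y, I.SelIn c m F q y →
      ¬ (I.lo p R ≤ y ∧ y ≤ I.hi p R) := fun q hq hq' hmq y hy h =>
    hh ⟨y, le_w_of_hit hR (hit_of_kind h), ⟨q, hq, ⟨hq', hmq⟩, hy⟩, hit_of_kind h⟩
  have hin : I.Inside p R := by
    by_cases hs : I.Single c m p
    -- The single position lies between `x` and `p`. As `R` contains `x` but not this position, it
    -- ends before it, hence before `p`.
    · have hu : x ≤ I.single F p := by
        refine le_minIf h2 fun R' hR' h' => ?_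
        obtain ⟨y, hy, hy'⟩ := all R' hR' h'
        obtain ⟨z, hz⟩ := Finset.card_eq_one.1 (hmp.symm.trans hs.2.1)
        rw [hz, Finset.mem_singleton] at hxp hy
        rw [hxp, ← hy]; exact hy'.2
      have hup : I.single F p ≤ p := minIf_le _ _ _ _
      have := hno p hpw hp hpos _ (.inl ⟨hs, rfl⟩)
      refine ⟨?_, by omega⟩
      rcases I.prev_eq p with e | e
      · rw [e]
        unfold lo
        rw [if_pos hs.1]
        exact I.lx_pos R hR
      · have hlt := I.prev_lt hp.1
        obtain ⟨y, hy, hy'⟩ := hA.exists_mem_of_mark e (by have := hs.1; omega)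
        have hpos' : 0 < m (I.prev p) := by
          rw [hm _ (by omega) e]; exact Finset.card_pos.2 ⟨y, mem_part.2 ⟨hy, hy'⟩⟩
        have hord : I.ord p = I.ord (I.prev p) + 1 := ord_eq hlt e
        -- The preceding strip has the other parity, so its end mark `prev p` is selected, and a
        -- missed `R` cannot reach it.
        have hs' : ¬ I.Single c m (I.prev p) := fun h => by
          have := h.2.2
          have := hs.2.2
          omega
        have := hno _ (by omega) e hpos' _ (.inr ⟨hs', .inl rfl⟩)
        omega
    · have hg : I.inner F p (m p) ≤ x := by
        rw [hmp]
        exact greedy_card_le (fun y hy => (mem_part.1 hy).2.1.le) all hxp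
      have hmk : m p ≤ I.k := by
        rw [hmp]; exact (Finset.card_filter_le _ _).trans hA.card_le
      have h3 := hno p hpw hp hpos _ (.inr ⟨hs, .inl rfl⟩)
      have h4 := hno p hpw hp hpos _ (.inr ⟨hs, .inr ⟨m p - 1, by omega, by omega, rfl⟩⟩)
      -- The default of the greedy points is `prev p`, so the last one lies between the left border
      -- and `x`; since `R` reaches `x` without containing it, `R` begins after it.
      have h5 : I.prev p ≤ I.inner F p (m p - 1 + 1) := le_greedy_succ _
      rw [Nat.sub_add_cancel hpos] at h4 h5
      exact ⟨by omega, by omega⟩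
  refine ⟨⟨p, hpw, hp, hin⟩, fun q hq hq' => ?_⟩
  -- For strips of the same kind the point `x` serves again, as the interval of `R` lies within
  -- strip `q`. Different kinds are impossible: a first-kind strip around `R` forces a second-kind
  -- mark inside `R`.
  by_cases hpq : p ≤ I.off ↔ q ≤ I.off
  · have hk' : I.lo q R ≤ x ∧ x ≤ I.hi q R := by
      unfold lo hi at hk ⊢
      simp only [hpq] at hk
      exact hk
    unfold Inside at hq'
    exact ⟨x, mem_part.2 ⟨hx, by omega, by omega⟩, hk'⟩
  by_cases hpo : p ≤ I.off <;> by_cases hqo : q ≤ I.off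
  · exact (hpq (by simp only [hpo, hqo])).elim
  · unfold Inside lo hi at hin
    rw [if_pos hpo, if_pos hpo] at hin
    obtain ⟨y, hy, h⟩ := hA.exists_mark_of_inside hp hpo hR hin
    exact (not_inside_both hy h.1 h.2 (by omega) hq').elim
  · unfold Inside lo hi at hq'
    rw [if_pos hqo, if_pos hqo] at hq'
    obtain ⟨y, hy, h⟩ := hA.exists_mark_of_inside hq hqo hR hq'
    exact (not_inside_both hy h.1 h.2 (by omega) hin).elim
  · exact (hpq (by simp only [hpo, hqo])).elim

omit hF in
theorem Sol.good_of_flag (r : ℕ) : ∀ R < I.n, I.Flag c m r R → I.Good A R := by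
  induction r with
  | zero => exact fun R _ h => h.elim
  | succ r ih => exact fun R hR h => h.elim (ih R hR) fun h => hA.good_of_not_hitBy hm ih hR h.2

omit hF in
-- Flagged rectangles are hit, so a rectangle missed in some round is newly flagged. Unless all are
-- hit earlier, after `I.n` rounds everything is flagged, and then everything is hit.
theorem Sol.hitBy_flag : ∀ R < I.n, I.HitBy c m (I.Flag c m I.n) R := by
  classical
  have key : ∀ r, (∀ R < I.n, I.HitBy c m (I.Flag c m r) R) ∨
      r ≤ ((Finset.range I.n).filter (I.Flag c m r)).card := by
    intro r
    induction r with
    | zero => exact .inr (Nat.zero_le _)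
    | succ r ih =>
      by_cases hall : ∀ R < I.n, I.HitBy c m (I.Flag c m r) R
      · left
        -- Once no rectangle is missed, the flags do not change any more.
        have e : I.Flag c m (r + 1) = I.Flag c m r := funext fun R => propext
          ⟨fun h => h.elim id fun h => (h.2 (hall R h.1)).elim, .inl⟩
        rwa [e]
      · right
        have ih := ih.resolve_left hall
        push Not at hall
        obtain ⟨R, hR, hh⟩ := hall
        refine (Nat.succ_le_succ ih).trans (Finset.card_lt_card ?_)
        rw [Finset.ssubset_iff_of_subset]
        · refine ⟨R, Finset.mem_filter.2 ⟨Finset.mem_range.2 hR, .inr ⟨hR, hh⟩⟩, fun h => hh ?_⟩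
          exact hA.hitBy_of_flag hm (hA.good_of_flag hm r) hR (Finset.mem_filter.1 h).2
        · intro R' h
          rw [Finset.mem_filter] at h ⊢
          exact ⟨h.1, .inl h.2⟩
  rcases key I.n with h | h
  · exact h
  · intro R hR
    have e := Finset.eq_of_subset_of_card_le (Finset.filter_subset (I.Flag c m I.n) _)
      (by rw [Finset.card_range]; exact h)
    have : R ∈ (Finset.range I.n).filter (I.Flag c m I.n) := by rw [e]; exact Finset.mem_range.2 hR
    exact hA.hitBy_of_flag hm (hA.good_of_flag hm I.n) hR (Finset.mem_filter.1 this).2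

/-! ### Counting the selected positions -/

omit hA hm hF in
open Classical in
theorem card_sel_le (c : ℕ) (m : ℕ → ℕ) (F : ℕ → Prop) :
    ((Finset.range (I.w + 1)).filter (I.Sel c m F)).card ≤
      ∑ p ∈ (Finset.range (I.w + 1)).filter fun p => I.Mark p ∧ 0 < m p,
        if I.Single c m p then 1 else m p + 1 := by
  set cell : ℕ → Finset ℕ := fun p => if I.Single c m p then {I.single F p} else
    insert p ((Finset.range (m p)).image fun i => I.inner F p (i + 1)) with hcell
  have hsub : (Finset.range (I.w + 1)).filter (I.Sel c m F) ⊆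
      ((Finset.range (I.w + 1)).filter fun p => I.Mark p ∧ 0 < m p).biUnion cell := by
    intro x hx
    obtain ⟨p, hpw, hp, hs⟩ := (Finset.mem_filter.1 hx).2
    refine Finset.mem_biUnion.2
      ⟨p, Finset.mem_filter.2 ⟨Finset.mem_range.2 (by omega), hp⟩, ?_⟩
    rcases hs with ⟨h, rfl⟩ | ⟨h, rfl | ⟨i, -, hi, rfl⟩⟩
    · simp only [hcell, if_pos h, Finset.mem_singleton]
    · simp only [hcell, if_neg h, Finset.mem_insert_self]
    · simp only [hcell, if_neg h]
      exact Finset.mem_insert_of_mem (Finset.mem_image.2 ⟨i, Finset.mem_range.2 hi, rfl⟩)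
  refine (Finset.card_le_card hsub).trans (Finset.card_biUnion_le.trans
    (Finset.sum_le_sum fun p _ => ?_))
  simp only [hcell]
  split_ifs
  · exact (Finset.card_singleton _).le
  · refine (Finset.card_insert_le _ _).trans (Nat.succ_le_succ (Finset.card_image_le.trans ?_))
    rw [Finset.card_range]

omit hF in
open Classical in
-- Charge the selections of both parities to the solution lines of the strip: each line of the first
-- kind pays 3, each of the second kind 4. The bound depends only on the strip sizes, so the flags
-- may differ between the parities.
theorem Sol.sum_card_le (F₀ F₁ : ℕ → Prop) :
    ((Finset.range (I.w + 1)).filter (I.Sel 0 m F₀)).card +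
      ((Finset.range (I.w + 1)).filter (I.Sel 1 m F₁)).card ≤
      3 * A.card + (A.filter fun x => I.off < x).card := by
  refine (Nat.add_le_add (card_sel_le 0 m F₀) (card_sel_le 1 m F₁)).trans ?_
  rw [← Finset.sum_add_distrib]
  set P := (Finset.range (I.w + 1)).filter fun p => I.Mark p ∧ 0 < m p with hP
  set wt : ℕ → ℕ := fun x => if I.off < x then 4 else 3 with hwt
  have hle : ∀ p ∈ P, ((if I.Single 0 m p then 1 else m p + 1) +
      if I.Single 1 m p then 1 else m p + 1) ≤ ∑ x ∈ I.part A p, wt x := by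
    intro p hp
    obtain ⟨hpw, hp, hpos⟩ := Finset.mem_filter.1 hp
    have hmp := hm p (by rw [Finset.mem_range] at hpw; omega) hp
    have hw : ∀ x ∈ I.part A p, wt x = if I.off < p then 4 else 3 := by
      intro x hx
      obtain ⟨hx, h1, h2⟩ := mem_part.1 hx
      have := hA.mem x hx
      simp only [hwt]
      by_cases h : I.off < p
      · have := I.le_prev I.mark_off h
        rw [if_pos (by omega), if_pos h]
      · rw [if_neg (by omega), if_neg h]
    rw [Finset.sum_congr rfl hw, Finset.sum_const, ← hmp, smul_eq_mul]
    unfold Single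
    by_cases h : I.off < p
    -- With `m p ≥ 1` the second kind costs `2 * (m p + 1) ≤ 4 * m p`. For the first kind, `m p = 1`
    -- costs `1 + 2 = 3`, in an order given by the parity, and `m p ≥ 2` costs `2 * (m p + 1) ≤ 3 *
    -- m p`.
    · rw [if_neg (by omega), if_neg (by omega), if_pos h]; omega
    · rw [if_neg h]
      by_cases h1 : m p = 1
      · rcases Nat.mod_two_eq_zero_or_one (I.ord p) with h2 | h2
        · rw [if_pos (by omega), if_neg (by omega)]; omega
        · rw [if_neg (by omega), if_pos (by omega)]; omega
      · rw [if_neg (by omega), if_neg (by omega)]; omega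
  refine (Finset.sum_le_sum hle).trans ?_
  rw [← Finset.sum_biUnion]
  · refine (Finset.sum_le_sum_of_subset (t := A) ?_).trans ?_
    · intro x hx
      obtain ⟨p, -, hx⟩ := Finset.mem_biUnion.1 hx
      exact (mem_part.1 hx).1
    · have : ∀ x ∈ A, wt x = 3 + if I.off < x then 1 else 0 := by
        intro x _; simp only [hwt]; split_ifs <;> rfl
      rw [Finset.sum_congr rfl this, Finset.sum_add_distrib, Finset.sum_const, smul_eq_mul,
        Finset.card_filter, mul_comm]
  · intro p hp q hq hpq
    refine Finset.disjoint_left.2 fun x hx hx' => hpq ?_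
    rw [mem_part] at hx hx'
    exact I.strip_unique (Finset.mem_filter.1 hp).2.1 (Finset.mem_filter.1 hq).2.1
      hx.2.1 hx.2.2 hx'.2.1 hx'.2.2

omit hF in
open Classical in
/-- One of the two parities yields few selected positions. -/
theorem Sol.exists_parity : ∃ c < 2, (∀ R < I.n, I.HitBy c m (I.Flag c m I.n) R) ∧
    4 * ((Finset.range (I.w + 1)).filter (I.Sel c m (I.Flag c m I.n))).card ≤ 7 * I.k := by
  have h := hA.sum_card_le hm (I.Flag 0 m I.n) (I.Flag 1 m I.n)
  have := hA.half
  have := hA.card_le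
  rcases le_total ((Finset.range (I.w + 1)).filter (I.Sel 0 m (I.Flag 0 m I.n))).card
    ((Finset.range (I.w + 1)).filter (I.Sel 1 m (I.Flag 1 m I.n))).card with h' | h'
  · exact ⟨0, by omega, hA.hitBy_flag hm, by omega⟩
  · exact ⟨1, by omega, hA.hitBy_flag hm, by omega⟩

/-! ### Guesses -/

omit hA hm hF in
theorem ord_inj {p q : ℕ} (hp : I.Mark p) (hq : I.Mark q) (h : I.ord p = I.ord q) : p = q := by
  classical exact Nat.count_injective hp hq h

variable (I) in
open Classical in
/-- The number of marks. -/
noncomputable def total : ℕ := Nat.count I.Mark (I.w + 1)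

omit hA hm hF in
theorem ord_lt_total {p : ℕ} (hp : I.Mark p) (h : p ≤ I.w) : I.ord p < I.total := by
  classical exact Nat.count_strict_mono hp (by omega)

variable (I) in
open Classical in
/-- The number of lines that the guess `g` assigns to strip `p`. -/
noncomputable def guess (g p : ℕ) : ℕ :=
  ((Finset.range I.k).filter fun i =>
    g / (I.total + 1) ^ i % (I.total + 1) = I.ord p).card

omit hm hF in
/-- Some guess is right. -/
theorem Sol.exists_guess : ∃ g < (I.total + 1) ^ I.k,
    ∀ p ≤ I.w, I.Mark p → I.guess g p = (I.part A p).card := by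
  classical
  choose! s hs using fun x (hx : x ∈ A) =>
    I.exists_strip (hA.mem x hx).1 (hA.mem x hx).2.1.le
  set b := I.total + 1 with hb
  set e := A.equivFin with he
  -- Digit `i` names the strip of the `i`-th solution line. Unused digits are `total`, which is not
  -- the number of any strip.
  let d : Fin I.k → Fin b := fun i =>
    if h : (i : ℕ) < A.card then ⟨I.ord (s (e.symm ⟨i, h⟩)), by
      have h' := hs _ (e.symm ⟨i, h⟩).2
      have := ord_lt_total h'.2.1 h'.1
      omega⟩ else ⟨I.total, by omega⟩
  have hdig : ∀ i : Fin I.k, (finFunctionFinEquiv d : ℕ) / b ^ (i : ℕ) % b = d i := by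
    intro i
    have := congrArg Fin.val (congrFun (finFunctionFinEquiv.symm_apply_apply d) i)
    rw [← this]
    rfl
  refine ⟨finFunctionFinEquiv d, (finFunctionFinEquiv d).2, fun p hpw hp => ?_⟩
  refine (Finset.card_bij (fun x hx => (e ⟨x, (mem_part.1 hx).1⟩ : ℕ)) ?_ ?_ ?_).symm
  · intro x hx
    obtain ⟨hxA, h1, h2⟩ := mem_part.1 hx
    have hlt := (e ⟨x, hxA⟩).2
    have hk := hA.card_le
    rw [Finset.mem_filter, Finset.mem_range]
    refine ⟨by omega, ?_⟩
    rw [hdig ⟨(e ⟨x, hxA⟩ : ℕ), by omega⟩]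
    simp only [d, dif_pos hlt, Fin.eta, Equiv.symm_apply_apply]
    have h' := hs x hxA
    rw [I.strip_unique h'.2.1 hp h'.2.2.1 h'.2.2.2 h1 h2]
  · intro x hx y hy h
    have := e.injective (Fin.ext h)
    simpa using this
  · intro i hi
    rw [Finset.mem_filter, Finset.mem_range] at hi
    rw [hdig ⟨i, hi.1⟩] at hi
    have hlt := ord_lt_total hp hpw
    by_cases h : i < A.card
    · simp only [d, dif_pos h] at hi
      have h' := hs _ (e.symm ⟨i, h⟩).2
      have := ord_inj h'.2.1 hp hi.2
      refine ⟨e.symm ⟨i, h⟩, mem_part.2 ⟨(e.symm ⟨i, h⟩).2, ?_⟩, ?_⟩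
      · rw [← this]; exact h'.2.2
      · simp
    · simp only [d, dif_neg h] at hi
      omega

/-! ### The number of marks -/

variable (I) in
open Classical in
/-- The number of marks up to `off`. -/
noncomputable def small : ℕ := Nat.count I.Mark (I.off + 1)

omit hm hF in
-- Every mark before `off` has a solution line in its strip, different strips are disjoint, and
-- `off` itself adds one.
theorem Sol.small_le : I.small ≤ I.k + 1 := by
  classical
  choose! s hs using fun x (hx : x ∈ A) =>
    I.exists_strip (hA.mem x hx).1 (hA.mem x hx).2.1.le
  unfold small
  rw [Nat.count_succ, if_pos I.mark_off, Nat.count_eq_card_filter_range]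
  refine Nat.succ_le_succ ((Finset.card_le_card (t := A.image s) ?_).trans
    (Finset.card_image_le.trans hA.card_le))
  intro p hp
  rw [Finset.mem_filter, Finset.mem_range] at hp
  obtain ⟨x, hx, h⟩ := hA.exists_mem_of_mark hp.2 hp.1
  exact Finset.mem_image.2 ⟨x, hx, I.strip_unique (hs x hx).2.1 hp.2 (hs x hx).2.2.1
    (hs x hx).2.2.2 h.1 h.2⟩

omit hA hm hF in
-- Each first-kind strip creates at most `k` second-kind marks, and `w` is one more.
theorem total_le : I.total ≤ I.small + I.small * I.k + 1 := by
  classical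
  unfold total small
  rw [Nat.count_eq_card_filter_range, Nat.count_eq_card_filter_range]
  set P := (Finset.range (I.off + 1)).filter I.Mark with hP
  refine (Finset.card_le_card (t := (P ∪ (P ×ˢ Finset.range I.k).image fun q =>
    I.gr (I.last (q.1 - 1)) q.1 (q.2 + 1)) ∪ {I.w}) ?_).trans ?_
  · intro p hp
    rw [Finset.mem_filter, Finset.mem_range] at hp
    by_cases h : p ≤ I.off
    · exact Finset.mem_union_left _ (Finset.mem_union_left _
        (Finset.mem_filter.2 ⟨Finset.mem_range.2 (by omega), hp.2⟩))
    · rcases hp.2.2 with h' | ⟨-, rfl | ⟨q, hq, hq', i, hi, rfl⟩⟩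
      · omega
      · exact Finset.mem_union_right _ (Finset.mem_singleton_self _)
      · refine Finset.mem_union_left _ (Finset.mem_union_right _
          (Finset.mem_image.2 ⟨(q, i), Finset.mem_product.2 ⟨?_, Finset.mem_range.2 hi⟩, rfl⟩))
        exact Finset.mem_filter.2 ⟨Finset.mem_range.2 (by omega), (I.mark_iff_of_le hq).2 hq'⟩
  · refine (Finset.card_union_le _ _).trans (Nat.add_le_add ((Finset.card_union_le _ _).trans
      (Nat.add_le_add_left (Finset.card_image_le.trans ?_) _)) (Finset.card_singleton _).le)
    rw [Finset.card_product, Finset.card_range]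

omit hA hm hF in
-- For `k ≥ 1` the base is at most `6 * k ^ 2`. If `k ≥ 2`, the 6 is absorbed by `k ^ 3`, which
-- gives exponent `5 * k`; the factor 6 in front is there for `k = 1`.
theorem pow_le (h : I.small ≤ I.k + 1) : (I.total + 1) ^ I.k ≤ 6 * I.k ^ (5 * I.k) := by
  rcases Nat.eq_zero_or_pos I.k with h0 | h0
  · rw [h0]; simp
  have ht : I.total + 1 ≤ 6 * I.k ^ 2 := by
    have := I.total_le
    nlinarith
  refine (Nat.pow_le_pow_left ht _).trans ?_
  rw [mul_pow, ← pow_mul, show 5 * I.k = 3 * I.k + 2 * I.k by ring, pow_add, ← mul_assoc]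
  refine Nat.mul_le_mul_right _ ?_
  rcases Nat.lt_or_ge 1 I.k with h1 | h1
  · refine (Nat.pow_le_pow_left (?_ : 6 ≤ I.k ^ 3) I.k).trans ?_
    · calc 6 ≤ 2 ^ 3 := by norm_num
        _ ≤ I.k ^ 3 := Nat.pow_le_pow_left h1 3
    · rw [← pow_mul]; omega
  · have : I.k = 1 := by omega
    rw [this]; norm_num

end Inst
end RectStab

namespace RectStab

/-! ### Derived terms -/

namespace Term

/-- Negation; conditions are terms, read as "not zero". -/
def notT (t : Term) : Term := .ite t (.const 0) (.const 1)

/-- Conjunction. -/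
def andT (s t : Term) : Term := .ite s t (.const 0)

/-- Disjunction. -/
def orT (s t : Term) : Term := .ite s (.const 1) t

/-- Strict comparison. -/
def ltT (s t : Term) : Term := .le (.add s (.const 1)) t

/-- Equality. -/
def eqT (s t : Term) : Term := andT (.le s t) (.le t s)

/-- Bounded existential quantification over register `d + 1`. -/
def anyT (d j : ℕ) (b : Term) : Term := .iter d j (.const 0) (orT (.var d) b)

/-- Bounded universal quantification over register `d + 1`. -/
def allT (d j : ℕ) (b : Term) : Term := notT (anyT d j (notT b))

/-- Bounded sum over register `d + 1`. -/
def sumT (d j : ℕ) (b : Term) : Term := .iter d j (.const 0) (.add (.var d) b)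

/-- The number of values of register `d + 1` that satisfy a condition. -/
def countT (d j : ℕ) (b : Term) : Term := sumT d j (.ite b (.const 1) (.const 0))

/-- Bounded maximum over the values of register `d + 1` that satisfy a condition. -/
def maxT (d j : ℕ) (c b a : Term) : Term :=
  .iter d j a (.ite c (.ite (.le (.var d) b) b (.var d)) (.var d))

/-- Bounded minimum over the values of register `d + 1` that satisfy a condition. -/
def minT (d j : ℕ) (c b a : Term) : Term :=
  .iter d j a (.ite c (.ite (.le (.var d) b) (.var d) b) (.var d))

/-- The `t`-th greedy point; `c`, `lo` and `hi` refer to the interval in register `d + 3`. -/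
def greedyT (d : ℕ) (c lo hi a init t : Term) : Term :=
  .iter d 2 init (.ite (ltT (.var (d + 1)) t)
    (maxT (d + 2) 0 (andT c (ltT hi (.var d))) lo a) (.var d))

end Term

/-! ### Evaluation of terms and derived terms -/

/-- The arrays of `τ` are those of `σ`, and its registers hold the entries of `l`. -/
structure At (σ : State) (l : List ℕ) (τ : State) : Prop where
  arr : ∀ a, a ≠ 5 → a ≠ 7 → τ a = σ a
  reg : ∀ i < l.length, τ 5 i = l.getD i 0

theorem At.snoc {σ τ : State} {l : List ℕ} (h : At σ l τ) (v : ℕ) :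
    At σ (l ++ [v]) (τ.store 5 l.length v) := by
  refine ⟨fun a h5 h7 => ?_, fun i hi => ?_⟩
  · rw [← h.arr a h5 h7]
    exact funext fun j => State.store_of_ne _ fun e => h5 e.1
  · rw [List.length_append, List.length_singleton] at hi
    rcases Nat.lt_succ_iff_lt_or_eq.1 hi with hi | rfl
    · rw [State.store_of_ne _ (by omega), h.reg i hi, List.getD_append _ _ _ _ hi]
    · rw [State.store_self, List.getD_append_right _ _ _ _ le_rfl]; simp

theorem At.bind {σ τ : State} {l : List ℕ} (h : At σ l τ) {d : ℕ} (hd : l.length = d) (v w : ℕ) :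
    At σ (l ++ [v, w]) ((τ.store 5 d v).store 5 (d + 1) w) := by
  subst hd
  have := (h.snoc v).snoc w
  rwa [List.append_assoc, List.length_append] at this

section eval
variable {X : Coords} {σ τ : State} {l : List ℕ}

theorem At.eval_var (h : At σ l τ) {i : ℕ} (hi : i < l.length) :
    (Term.var i).eval X τ = l.getD i 0 := h.reg i hi

theorem At.eval_rd (h : At σ l τ) {a : ℕ} (h5 : a ≠ 5) (h7 : a ≠ 7) (t : Term) :
    (Term.rd a t).eval X τ = σ a (t.eval X τ) := by
  rw [Term.eval, h.arr a h5 h7]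

theorem eval_const (c : ℕ) : (Term.const c).eval X τ = c := rfl

theorem eval_add (s t : Term) : (Term.add s t).eval X τ = s.eval X τ + t.eval X τ := rfl

theorem eval_sub (s t : Term) : (Term.sub s t).eval X τ = s.eval X τ - t.eval X τ := rfl

open Classical in
theorem eval_ite (c s t : Term) :
    (Term.ite c s t).eval X τ = if c.eval X τ ≠ 0 then s.eval X τ else t.eval X τ := by
  rw [Term.eval]

theorem eval_ite_of {c s t : Term} {p : Prop} [Decidable p] (h : c.eval X τ ≠ 0 ↔ p) :
    (Term.ite c s t).eval X τ = if p then s.eval X τ else t.eval X τ := by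
  rw [eval_ite]; split_ifs <;> simp_all

theorem eval_le (s t : Term) : (Term.le s t).eval X τ ≠ 0 ↔ s.eval X τ ≤ t.eval X τ := by
  rw [Term.eval]; split_ifs with h <;> simp [h]

theorem eval_cle (a b : ℕ) (s t : Term) :
    (Term.cle a s b t).eval X τ ≠ 0 ↔ X a (s.eval X τ) ≤ X b (t.eval X τ) := by
  rw [Term.eval]; split_ifs with h <;> simp [h]

theorem eval_notT (t : Term) : (Term.notT t).eval X τ ≠ 0 ↔ ¬ t.eval X τ ≠ 0 := by
  rw [Term.notT, eval_ite]; split_ifs with h <;> simp [h, eval_const]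

theorem eval_andT (s t : Term) :
    (Term.andT s t).eval X τ ≠ 0 ↔ s.eval X τ ≠ 0 ∧ t.eval X τ ≠ 0 := by
  rw [Term.andT, eval_ite]; split_ifs with h <;> simp [h, eval_const]

theorem eval_orT (s t : Term) :
    (Term.orT s t).eval X τ ≠ 0 ↔ s.eval X τ ≠ 0 ∨ t.eval X τ ≠ 0 := by
  rw [Term.orT, eval_ite]; split_ifs with h <;> simp [h, eval_const]

theorem eval_ltT (s t : Term) : (Term.ltT s t).eval X τ ≠ 0 ↔ s.eval X τ < t.eval X τ := by
  rw [Term.ltT, eval_le]; rfl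

theorem eval_eqT (s t : Term) : (Term.eqT s t).eval X τ ≠ 0 ↔ s.eval X τ = t.eval X τ := by
  rw [Term.eqT, eval_andT, eval_le, eval_le]; omega

/-- The values of an iteration follow a recursion. -/
theorem At.eval_iter (h : At σ l τ) {d j : ℕ} (hd : l.length = d) {s b : Term} (f : ℕ → ℕ)
    (h0 : s.eval X τ = f 0)
    (hs : ∀ i < σ 6 j, ∀ θ, At σ (l ++ [f i, i]) θ → b.eval X θ = f (i + 1)) :
    (Term.iter d j s b).eval X τ = f (σ 6 j) := by
  have key : ∀ n ≤ σ 6 j, Nat.rec (motive := fun _ => ℕ) (s.eval X τ)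
      (fun i acc => b.eval X ((τ.store 5 d acc).store 5 (d + 1) i)) n = f n := by
    intro n
    induction n with
    | zero => exact fun _ => h0
    | succ n ih =>
      intro hn
      rw [← hs n hn _ (h.bind hd _ _), ← ih (by omega)]
  rw [Term.eval, h.arr 6 (by omega) (by omega)]
  exact key _ le_rfl

/-- Conditions are only known up to being nonzero, so the accumulator has no prescribed value and
`At.eval_iter` does not apply; the recursion is followed for its truth value instead. -/
theorem At.eval_anyT (h : At σ l τ) {d j : ℕ} (hd : l.length = d) {b : Term} {p : ℕ → Prop}
    (hs : ∀ i < σ 6 j, ∀ v θ, At σ (l ++ [v, i]) θ → (b.eval X θ ≠ 0 ↔ p i)) :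
    (Term.anyT d j b).eval X τ ≠ 0 ↔ ∃ i < σ 6 j, p i := by
  classical
  have key : ∀ n ≤ σ 6 j, (Nat.rec (motive := fun _ => ℕ) 0
      (fun i acc => (Term.orT (.var d) b).eval X ((τ.store 5 d acc).store 5 (d + 1) i)) n) ≠ 0 ↔
      ∃ i < n, p i := by
    intro n
    induction n with
    | zero => simp
    | succ n ih =>
      intro hn
      have ih := ih (by omega)
      simp only [ne_eq] at ih ⊢
      rw [← ne_eq, eval_orT, hs n hn _ _ (h.bind hd _ _), (h.bind hd _ _).eval_var (by simp; omega)]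
      rw [List.getD_append_right _ _ _ _ (by omega), hd, Nat.sub_self, List.getD_cons_zero, ne_eq, ih]
      constructor
      · rintro (⟨i, hi, h⟩ | h)
        · exact ⟨i, by omega, h⟩
        · exact ⟨n, by omega, h⟩
      · rintro ⟨i, hi, h⟩
        rcases Nat.lt_succ_iff_lt_or_eq.1 hi with hi | rfl
        · exact .inl ⟨i, hi, h⟩
        · exact .inr h
  rw [Term.anyT, Term.eval, h.arr 6 (by omega) (by omega)]
  exact key _ le_rfl

theorem At.eval_allT (h : At σ l τ) {d j : ℕ} (hd : l.length = d) {b : Term} {p : ℕ → Prop}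
    (hs : ∀ i < σ 6 j, ∀ v θ, At σ (l ++ [v, i]) θ → (b.eval X θ ≠ 0 ↔ p i)) :
    (Term.allT d j b).eval X τ ≠ 0 ↔ ∀ i < σ 6 j, p i := by
  rw [Term.allT, eval_notT, h.eval_anyT hd (p := fun i => ¬ p i)
    fun i hi v θ hθ => by rw [eval_notT, hs i hi v θ hθ]]
  push Not
  rfl

/-- The accumulator register of a loop body. -/
theorem At.eval_acc {v w : ℕ} (h : At σ (l ++ [v, w]) τ) {d : ℕ} (hd : l.length = d) :
    (Term.var d).eval X τ = v := by
  rw [h.eval_var (by simp; omega), List.getD_append_right _ _ _ _ (by omega), hd, Nat.sub_self,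
    List.getD_cons_zero]

/-- The counter register of a loop body. -/
theorem At.eval_counter {v w : ℕ} (h : At σ (l ++ [v, w]) τ) {d : ℕ} (hd : l.length = d) :
    (Term.var (d + 1)).eval X τ = w := by
  rw [h.eval_var (by simp; omega), List.getD_append_right _ _ _ _ (by omega), hd,
    Nat.add_sub_cancel_left, List.getD_cons_succ, List.getD_cons_zero]

theorem At.eval_sumT (h : At σ l τ) {d j : ℕ} (hd : l.length = d) {b : Term} {f : ℕ → ℕ}
    (hs : ∀ i < σ 6 j, ∀ v θ, At σ (l ++ [v, i]) θ → b.eval X θ = f i) :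
    (Term.sumT d j b).eval X τ = ∑ i ∈ Finset.range (σ 6 j), f i := by
  refine h.eval_iter hd (fun n => ∑ i ∈ Finset.range n, f i) (by simp [eval_const])
    fun i hi θ hθ => ?_
  rw [eval_add, hs i hi _ θ hθ, hθ.eval_acc hd, Finset.sum_range_succ]

open Classical in
theorem At.eval_countT (h : At σ l τ) {d j : ℕ} (hd : l.length = d) {b : Term} {p : ℕ → Prop}
    (hs : ∀ i < σ 6 j, ∀ v θ, At σ (l ++ [v, i]) θ → (b.eval X θ ≠ 0 ↔ p i)) :
    (Term.countT d j b).eval X τ = ((Finset.range (σ 6 j)).filter p).card := by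
  rw [Term.countT, h.eval_sumT hd (f := fun i => if p i then 1 else 0), Finset.card_filter]
  intro i hi v θ hθ
  rw [eval_ite_of (hs i hi v θ hθ)]; rfl

theorem At.eval_maxT (h : At σ l τ) {d j : ℕ} (hd : l.length = d) {c b a : Term} {C : ℕ → Prop}
    {f : ℕ → ℕ} {y : ℕ} (ha : a.eval X τ = y)
    (hc : ∀ i < σ 6 j, ∀ v θ, At σ (l ++ [v, i]) θ → (c.eval X θ ≠ 0 ↔ C i))
    (hb : ∀ i < σ 6 j, ∀ v θ, At σ (l ++ [v, i]) θ → b.eval X θ = f i) :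
    (Term.maxT d j c b a).eval X τ = maxIf C f y (σ 6 j) := by
  refine h.eval_iter hd (fun n => maxIf C f y n) ha fun i hi θ hθ => ?_
  classical
  rw [eval_ite_of (hc i hi _ θ hθ), eval_ite_of (eval_le _ _), hb i hi _ θ hθ, hθ.eval_acc hd, maxIf,
    max_def]

theorem At.eval_minT (h : At σ l τ) {d j : ℕ} (hd : l.length = d) {c b a : Term} {C : ℕ → Prop}
    {f : ℕ → ℕ} {y : ℕ} (ha : a.eval X τ = y)
    (hc : ∀ i < σ 6 j, ∀ v θ, At σ (l ++ [v, i]) θ → (c.eval X θ ≠ 0 ↔ C i))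
    (hb : ∀ i < σ 6 j, ∀ v θ, At σ (l ++ [v, i]) θ → b.eval X θ = f i) :
    (Term.minT d j c b a).eval X τ = minIf C f y (σ 6 j) := by
  refine h.eval_iter hd (fun n => minIf C f y n) ha fun i hi θ hθ => ?_
  classical
  rw [eval_ite_of (hc i hi _ θ hθ), eval_ite_of (eval_le _ _), hb i hi _ θ hθ, hθ.eval_acc hd, minIf,
    min_def]

theorem maxIf_congr {C C' : ℕ → Prop} {f : ℕ → ℕ} {y n : ℕ} (h : ∀ i < n, (C i ↔ C' i)) :
    maxIf C f y n = maxIf C' f y n := by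
  induction n with
  | zero => rfl
  | succ n ih =>
    rw [maxIf, maxIf, ih fun i hi => h i (by omega)]
    classical exact if_congr (h n (by omega)) rfl rfl

theorem At.eval_greedyT (h : At σ l τ) {d : ℕ} (hd : l.length = d) {c lo hi a init t : Term}
    {C : ℕ → Prop} {f g : ℕ → ℕ} {y z m : ℕ} (hz : init.eval X τ = z) (hm : m ≤ σ 6 2)
    (ht : ∀ v w θ, At σ (l ++ [v, w]) θ → t.eval X θ = m)
    (ha : ∀ v w θ, At σ (l ++ [v, w]) θ → a.eval X θ = y)
    (hc : ∀ i < σ 6 0, ∀ u v w θ, At σ (l ++ [u, v, w, i]) θ → (c.eval X θ ≠ 0 ↔ C i))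
    (hlo : ∀ i < σ 6 0, ∀ u v w θ, At σ (l ++ [u, v, w, i]) θ → lo.eval X θ = f i)
    (hhi : ∀ i < σ 6 0, ∀ u v w θ, At σ (l ++ [u, v, w, i]) θ → hi.eval X θ = g i) :
    (Term.greedyT d c lo hi a init t).eval X τ = greedy (σ 6 0) C f g y z m := by
  -- The loop always runs to the stored bound `σ 6 2`; from round `m` on it only carries the value
  -- along, hence the minimum.
  rw [Term.greedyT, h.eval_iter hd (fun n => greedy (σ 6 0) C f g y z (min n m))
    (by rw [hz, Nat.zero_min]; rfl)]
  · rw [Nat.min_eq_right hm]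
  · intro i hi θ hθ
    rw [eval_ite_of (eval_ltT _ _), hθ.eval_counter hd, ht _ _ θ hθ]
    split_ifs with him
    · rw [show min (i + 1) m = min i m + 1 by omega, greedy]
      refine hθ.eval_maxT (by simp [hd]) (ha _ _ θ hθ) (fun R hR v η hη => ?_)
        (fun R hR v η hη => ?_)
      · rw [List.append_assoc] at hη
        rw [eval_andT, eval_ltT, hc R hR _ _ _ η hη, hhi R hR _ _ _ η hη]
        rw [hη.eval_var (by simp; omega), List.getD_append_right _ _ _ _ (by omega), hd,
          Nat.sub_self]
        rfl
      · rw [List.append_assoc] at hη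
        exact hlo R hR _ _ _ η hη
    · rw [hθ.eval_acc hd, show min (i + 1) m = min i m by omega]

/-! ### Tables -/

theorem tabulate_rest {a d : ℕ} {t : Term} (n : ℕ) {i : ℕ} (hi : n ≤ i) :
    tabulate X a d t σ n a i = σ a i := by
  induction n with
  | zero => rfl
  | succ n ih => rw [tabulate, State.store_of_ne _ (by omega)]; exact ih (by omega)

theorem tabulate_entry {a d : ℕ} {t : Term} {n i : ℕ} (hi : i < n) :
    tabulate X a d t σ n a i = t.eval X ((tabulate X a d t σ i).store 5 d i) := by
  induction n with
  | zero => omega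
  | succ n ih =>
    rw [tabulate]
    rcases Nat.lt_succ_iff_lt_or_eq.1 hi with hi | rfl
    · rw [State.store_of_ne _ (by omega)]; exact ih hi
    · rw [State.store_self]

theorem At.at_tabulate (h : At σ l σ) {a d : ℕ} (hd : l.length = d) (ha : a ≠ 5) (t : Term)
    (i : ℕ) : At (tabulate X a d t σ i) (l ++ [i]) ((tabulate X a d t σ i).store 5 d i) := by
  have : At (tabulate X a d t σ i) l (tabulate X a d t σ i) :=
    ⟨fun _ _ _ => rfl, fun j hj => by rw [tabulate_of_ne X t σ ha.symm]; exact h.reg j hj⟩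
  subst hd
  exact this.snoc i

/-- The entries of a table satisfy a course-of-values recursion. -/
theorem At.tabulate_eq (h : At σ l σ) {a d n : ℕ} (hd : l.length = d) (ha : a ≠ 5) {t : Term}
    {f : ℕ → ℕ}
    (ht : ∀ i < n, ∀ ρ θ, (∀ b, b ≠ a → ρ b = σ b) → (∀ j < i, ρ a j = f j) →
      At ρ (l ++ [i]) θ → t.eval X θ = f i) :
    ∀ i < n, tabulate X a d t σ n a i = f i := by
  intro i
  induction i using Nat.strong_induction_on with
  | _ i ih =>
    intro hi
    rw [tabulate_entry hi]
    refine ht i hi _ _ (fun b hb => tabulate_of_ne X t σ hb i) (fun j hj => ?_)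
      (h.at_tabulate hd ha t i)
    rw [← ih j hj (by omega), tabulate_entry hj, tabulate_entry (by omega)]

/-- Besides other arrays an entry may use its own old value, which permits updating the flags in
place. -/
theorem At.tabulate_iff (h : At σ l σ) {a d n : ℕ} (hd : l.length = d) (ha : a ≠ 5) {t : Term}
    {p : ℕ → Prop}
    (ht : ∀ i < n, ∀ ρ θ, (∀ b, b ≠ a → ρ b = σ b) → ρ a i = σ a i →
      At ρ (l ++ [i]) θ → (t.eval X θ ≠ 0 ↔ p i)) :
    ∀ i < n, (tabulate X a d t σ n a i ≠ 0 ↔ p i) := by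
  intro i hi
  rw [tabulate_entry hi]
  exact ht i hi _ _ (fun b hb => tabulate_of_ne X t σ hb i) (tabulate_rest i le_rfl)
    (h.at_tabulate hd ha t i)

end eval
end RectStab

namespace RectStab

/-! ### The marks -/

section registers
variable {X : Coords} {σ τ : State} {l : List ℕ} {x₀ x₁ x₂ x₃ x₄ x₅ x₆ x₇ x₈ x₉ x₁₀ x₁₁ : ℕ}

theorem At.v0 (h : At σ (x₀ :: l) τ) :
    (Term.var 0).eval X τ = x₀ := h.eval_var (by simp)

theorem At.v1 (h : At σ (x₀ :: x₁ :: l) τ) :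
    (Term.var 1).eval X τ = x₁ := h.eval_var (by simp)

theorem At.v2 (h : At σ (x₀ :: x₁ :: x₂ :: l) τ) :
    (Term.var 2).eval X τ = x₂ := h.eval_var (by simp)

theorem At.v3 (h : At σ (x₀ :: x₁ :: x₂ :: x₃ :: l) τ) :
    (Term.var 3).eval X τ = x₃ := h.eval_var (by simp)

theorem At.v4 (h : At σ (x₀ :: x₁ :: x₂ :: x₃ :: x₄ :: l) τ) :
    (Term.var 4).eval X τ = x₄ := h.eval_var (by simp)

theorem At.v5 (h : At σ (x₀ :: x₁ :: x₂ :: x₃ :: x₄ :: x₅ :: l) τ) :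
    (Term.var 5).eval X τ = x₅ := h.eval_var (by simp)

theorem At.v7 (h : At σ (x₀ :: x₁ :: x₂ :: x₃ :: x₄ :: x₅ :: x₆ :: x₇ :: l) τ) :
    (Term.var 7).eval X τ = x₇ := h.eval_var (by simp)

theorem At.v11 (h : At σ (x₀ :: x₁ :: x₂ :: x₃ :: x₄ :: x₅ :: x₆ :: x₇ :: x₈ :: x₉ :: x₁₀ :: x₁₁ :: l) τ) :
    (Term.var 11).eval X τ = x₁₁ := h.eval_var (by simp)

end registers

/-- Scalar `j`. -/
def sc (j : ℕ) : Term := .rd 6 (.const j)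

/-- `Inst.gr s r t` -/
def grT (d : ℕ) (s r t : Term) : Term :=
  .greedyT d (.andT (.ltT s (.rd 9 (.var (d + 3)))) (.ltT (.rd 10 (.var (d + 3))) r))
    (.rd 11 (.var (d + 3))) (.rd 12 (.var (d + 3))) (sc 8) (sc 9) t

/-- `p - 1` -/
def predT (p : Term) : Term := .sub p (.const 1)

/-- The next entry of the table of `Inst.last`, in array `14`. -/
def lastT : Term :=
  .ite (.eqT (.var 0) (.const 0)) (.const 0)
    (.ite (.orT (.le (sc 8) (.var 0)) (.anyT 1 0 (.andT
        (.andT (.ltT (.rd 14 (predT (.var 0))) (.rd 9 (.var 2)))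
          (.ltT (.rd 10 (.var 2)) (.add (.var 0) (.const 1))))
        (.ltT (.rd 12 (.var 2))
          (grT 3 (.rd 14 (predT (.var 0))) (.add (.var 0) (.const 1)) (sc 2))))))
      (.var 0) (.rd 14 (predT (.var 0))))

/-- `Inst.Mark` -/
def markT : Term :=
  .andT (.ltT (.const 0) (.var 0))
    (.orT (.andT (.le (.var 0) (sc 8)) (.eqT (.rd 14 (.var 0)) (.var 0)))
      (.andT (.ltT (sc 8) (.var 0)) (.orT (.eqT (.var 0) (sc 9))
        (.anyT 1 3 (.andT (.le (.var 2) (sc 8))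
          (.andT (.andT (.ltT (.const 0) (.var 2)) (.eqT (.rd 14 (.var 2)) (.var 2)))
            (.anyT 3 2 (.eqT (.var 0)
              (grT 5 (.rd 14 (predT (.var 2))) (.var 2) (.add (.var 4) (.const 1)))))))))))

/-- The state holds the ranks of an instance. -/
structure Ranked (I : Inst) (σ : State) : Prop where
  n : σ 6 0 = I.n
  k : σ 6 2 = I.k
  w1 : σ 6 3 = I.w + 1
  n1 : σ 6 4 = I.n + 1
  two : σ 6 7 = 2
  off : σ 6 8 = I.off
  w : σ 6 9 = I.w
  k1 : σ 6 10 = I.k + 1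
  four : σ 6 11 = 4
  seven : σ 6 12 = 7
  lx : σ 9 = I.lx
  hx : σ 10 = I.hx
  ly : σ 11 = I.ly
  hy : σ 12 = I.hy

variable {X : Coords} {I : Inst}

theorem Ranked.congr {σ ρ : State} (h : Ranked I σ)
    (e : ∀ b, b = 6 ∨ b = 9 ∨ b = 10 ∨ b = 11 ∨ b = 12 → ρ b = σ b) : Ranked I ρ := by
  have e6 := e 6 (by simp)
  constructor
  all_goals first
    | rw [e6]; first
      | exact h.n
      | exact h.k
      | exact h.w1
      | exact h.n1
      | exact h.two
      | exact h.off
      | exact h.w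
      | exact h.k1
      | exact h.four
      | exact h.seven
    | rw [e _ (by simp)]; first
      | exact h.lx
      | exact h.hx
      | exact h.ly
      | exact h.hy

theorem At.eval_sc {σ τ : State} {l : List ℕ} (h : At σ l τ) (j : ℕ) :
    (sc j).eval X τ = σ 6 j := by
  rw [sc, h.eval_rd (by omega) (by omega), eval_const]

/-- The arguments `s`, `r` and `t` are evaluated anew inside the nested loops, so their values are
required with the loop registers appended. -/
theorem At.eval_grT {σ τ : State} {l : List ℕ} (h : At σ l τ) (hr : Ranked I σ) {d : ℕ}
    (hd : l.length = d) {s r t : Term} {u v m : ℕ} (hm : m ≤ I.k)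
    (ht : ∀ v w θ, At σ (l ++ [v, w]) θ → t.eval X θ = m)
    (hs : ∀ l' θ, At σ (l ++ l') θ → s.eval X θ = u)
    (hv : ∀ l' θ, At σ (l ++ l') θ → r.eval X θ = v) :
    (grT d s r t).eval X τ = I.gr u v m := by
  have e3 : ∀ x y z w θ, At σ (l ++ [x, y, z, w]) θ → (Term.var (d + 3)).eval X θ = w := by
    intro x y z w θ hθ
    rw [hθ.eval_var (by simp; omega), List.getD_append_right _ _ _ _ (by omega), hd,
      Nat.add_sub_cancel_left]
    rfl
  rw [grT, h.eval_greedyT hd (z := I.w) (y := I.off) (m := m) (f := I.ly) (g := I.hy)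
    (C := fun R => u < I.lx R ∧ I.hx R < v) (by rw [h.eval_sc, hr.w]) (by rw [hr.k]; exact hm)
    ht (fun _ _ _ hθ => by rw [hθ.eval_sc, hr.off]), hr.n]
  · rfl
  · intro R _ x y z θ hθ
    rw [eval_andT, eval_ltT, eval_ltT, hs _ _ hθ, hv _ _ hθ, hθ.eval_rd (by omega) (by omega),
      hθ.eval_rd (by omega) (by omega), e3 _ _ _ _ _ hθ, hr.lx, hr.hx]
  · intro R _ x y z θ hθ
    rw [hθ.eval_rd (by omega) (by omega), e3 _ _ _ _ _ hθ, hr.ly]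
  · intro R _ x y z θ hθ
    rw [hθ.eval_rd (by omega) (by omega), e3 _ _ _ _ _ hθ, hr.hy]

theorem eval_predT {τ : State} (t : Term) : (predT t).eval X τ = t.eval X τ - 1 := rfl

theorem tabulate_last {σ : State} (h : At σ [] σ) (hr : Ranked I σ) :
    ∀ p < I.w + 1, tabulate X 14 0 lastT σ (I.w + 1) 14 p = I.last p := by
  refine h.tabulate_eq rfl (by omega) fun p hp ρ θ hρ hj hθ => ?_
  have hr : Ranked I ρ := hr.congr fun b hb => hρ b (by omega)
  classical
  rw [lastT, eval_ite_of (eval_eqT _ _), hθ.v0, eval_const]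
  split_ifs with h0
  · rw [h0]; rfl
  obtain ⟨q, rfl⟩ := Nat.exists_eq_succ_of_ne_zero h0
  have hl : ρ 14 q = I.last q := hj q (by omega)
  rw [eval_ite_of (p := I.off ≤ q + 1 ∨ ¬ I.Stab (I.last q) (q + 2)), hθ.v0,
    hθ.eval_rd (by omega) (by omega), eval_predT, hθ.v0, Nat.succ_sub_one, hl]
  · rfl
  rw [eval_orT, eval_le, hθ.eval_sc, hθ.v0, hr.off]
  refine or_congr Iff.rfl ?_
  rw [hθ.eval_anyT (d := 1) rfl (p := fun R => (I.last q < I.lx R ∧ I.hx R < q + 2) ∧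
    I.hy R < I.gr (I.last q) (q + 2) I.k), hr.n]
  · unfold Inst.Stab
    push Not
    simp only [and_assoc]
  intro R _ v η hη
  rw [eval_andT, eval_andT, eval_ltT, eval_ltT, eval_ltT, hη.eval_grT hr (d := 3) rfl le_rfl (u := I.last q)
    (v := q + 2)]
  · rw [hη.eval_rd (by omega) (by omega), hη.eval_rd (by omega) (by omega),
      hη.eval_rd (by omega) (by omega), hη.eval_rd (by omega) (by omega), eval_predT, hη.v0, hη.v2,
      hr.lx, hr.hx, hr.hy, Nat.succ_sub_one, hl, eval_add, hη.v0]
    rfl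
  · intro v w ζ hζ
    rw [hζ.eval_sc, hr.k]
  · intro l' ζ hζ
    rw [hζ.eval_rd (by omega) (by omega), eval_predT, At.v0 hζ, Nat.succ_sub_one, hl]
  · intro l' ζ hζ
    rw [eval_add, At.v0 hζ, eval_const]

theorem tabulate_mark {σ : State} (h : At σ [] σ) (hr : Ranked I σ)
    (hl : ∀ p < I.w + 1, σ 14 p = I.last p) :
    ∀ p < I.w + 1, (tabulate X 13 0 markT σ (I.w + 1) 13 p ≠ 0 ↔ I.Mark p) := by
  refine h.tabulate_iff rfl (by omega) fun p hp ρ θ hρ _ hθ => ?_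
  have hr : Ranked I ρ := hr.congr fun b hb => hρ b (by omega)
  have hl : ∀ p < I.w + 1, ρ 14 p = I.last p := fun p hp => by rw [hρ 14 (by omega), hl p hp]
  have hoff := I.off_lt
  rw [markT, eval_andT, eval_orT, eval_andT, eval_andT, eval_orT, eval_ltT, eval_ltT, eval_le,
    eval_eqT, eval_eqT, eval_const, hθ.eval_sc, hθ.eval_sc, hθ.eval_rd (by omega) (by omega),
    hθ.v0, hl p hp, hr.off, hr.w]
  unfold Inst.Mark
  refine and_congr Iff.rfl (or_congr Iff.rfl (and_congr Iff.rfl (or_congr Iff.rfl ?_)))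
  rw [hθ.eval_anyT (d := 1) rfl (p := fun q => q ≤ I.off ∧ (0 < q ∧ I.last q = q) ∧
    ∃ i < I.k, p = I.gr (I.last (q - 1)) q (i + 1)), hr.w1]
  · exact ⟨fun ⟨q, _, h⟩ => ⟨q, h⟩, fun ⟨q, h⟩ => ⟨q, by omega, h⟩⟩
  intro q hq v η hη
  rw [hr.w1] at hq
  rw [eval_andT, eval_andT, eval_andT, eval_le, eval_ltT, eval_eqT, hη.eval_sc,
    hη.eval_rd (by omega) (by omega), hη.v2, hl q hq, hr.off, eval_const]
  refine and_congr Iff.rfl (and_congr Iff.rfl ?_)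
  rw [hη.eval_anyT (d := 3) rfl (p := fun i => p = I.gr (I.last (q - 1)) q (i + 1)), hr.k]
  intro i hi u ζ hζ
  rw [hr.k] at hi
  rw [eval_eqT, At.v0 hζ, hζ.eval_grT hr (d := 5) rfl (Nat.succ_le_of_lt hi)]
  · intro v w κ hκ
    rw [eval_add, At.v4 hκ]; rfl
  · intro l' κ hκ
    rw [hκ.eval_rd (by omega) (by omega), eval_predT, At.v2 hκ, hl _ (by omega)]
  · intro l' κ hκ
    exact At.v2 hκ

/-- `Inst.prev` -/
def prevT : Term := .maxT 1 3 (.andT (.ltT (.var 2) (.var 0)) (.rd 13 (.var 2))) (.var 2) (.const 0)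

/-- `Inst.ord` -/
def ordT : Term := .countT 1 3 (.andT (.ltT (.var 2) (.var 0)) (.rd 13 (.var 2)))

/-- The next entry of the table of parities, in array `24`. -/
def parityT : Term :=
  .ite (.eqT (.var 0) (.const 0)) (.const 0) (.sub (.const 1) (.rd 24 (predT (.var 0))))

/-- `Inst.total + 1` -/
def baseT : Term := .add (.countT 0 3 (.rd 13 (.var 1))) (.const 1)

/-- The number of guesses. -/
def guessesT : Term :=
  .ite (.le (.countT 0 3 (.andT (.le (.var 1) (sc 8)) (.rd 13 (.var 1)))) (sc 10))
    (.iter 0 2 (.const 1) (.sumT 2 5 (.var 0))) (.const 0)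

/-- Loops run over all positions because bounds are stored scalars; the condition `i < p` makes the
later rounds idle. -/
theorem maxIf_lt_and (C : ℕ → Prop) (f : ℕ → ℕ) (y : ℕ) {p n : ℕ} (h : p ≤ n) :
    maxIf (fun i => i < p ∧ C i) f y n = maxIf C f y p := by
  induction n, h using Nat.le_induction with
  | base => exact maxIf_congr fun i hi => by simp [hi]
  | succ n hn ih => rw [maxIf, if_neg (by omega), ih]

theorem tabulate_prev {σ : State} (h : At σ [] σ) (hr : Ranked I σ)
    (hm : ∀ p < I.w + 1, (σ 13 p ≠ 0 ↔ I.Mark p)) :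
    ∀ p < I.w + 1, tabulate X 21 0 prevT σ (I.w + 1) 21 p = I.prev p := by
  refine h.tabulate_eq rfl (by omega) fun p hp ρ θ hρ hj hθ => ?_
  have hr : Ranked I ρ := hr.congr fun b hb => hρ b (by omega)
  rw [prevT, hθ.eval_maxT (d := 1) rfl (C := fun q => q < p ∧ I.Mark q) (f := id) (eval_const 0),
    hr.w1, maxIf_lt_and _ _ _ hp.le]
  · rfl
  · intro q hq v η hη
    rw [hr.w1] at hq
    rw [eval_andT, eval_ltT, hη.eval_rd (by omega) (by omega), hη.v0, hη.v2, hρ 13 (by omega),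
      hm q hq]
  · intro q hq v η hη
    exact hη.v2

theorem tabulate_ord {σ : State} (h : At σ [] σ) (hr : Ranked I σ)
    (hm : ∀ p < I.w + 1, (σ 13 p ≠ 0 ↔ I.Mark p)) :
    ∀ p < I.w + 1, tabulate X 15 0 ordT σ (I.w + 1) 15 p = I.ord p := by
  classical
  refine h.tabulate_eq rfl (by omega) fun p hp ρ θ hρ hj hθ => ?_
  have hr : Ranked I ρ := hr.congr fun b hb => hρ b (by omega)
  rw [ordT, hθ.eval_countT (d := 1) rfl (p := fun q => q < p ∧ I.Mark q), hr.w1]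
  · unfold Inst.ord
    rw [Nat.count_eq_card_filter_range]
    congr 1
    ext q
    simp only [Finset.mem_filter, Finset.mem_range]
    exact ⟨fun h => h.2, fun h => ⟨by omega, h⟩⟩
  · intro q hq v η hη
    rw [hr.w1] at hq
    rw [eval_andT, eval_ltT, hη.eval_rd (by omega) (by omega), hη.v0, hη.v2, hρ 13 (by omega),
      hm q hq]

/-- The machine has no remainder operation; parities come from `1 - ·` applied to the preceding
entry. -/
theorem tabulate_parity {σ : State} (h : At σ [] σ) (n : ℕ) :
    ∀ p < n, tabulate X 24 0 parityT σ n 24 p = p % 2 := by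
  refine h.tabulate_eq rfl (by omega) fun p hp ρ θ hρ hj hθ => ?_
  rw [parityT, eval_ite_of (eval_eqT _ _), hθ.v0, eval_const]
  split_ifs with h0
  · rw [h0]
  · rw [eval_sub, eval_const, hθ.eval_rd (by omega) (by omega), eval_predT, hθ.v0,
      hj _ (by omega)]
    omega

theorem eval_baseT {σ : State} (h : At σ [] σ) (hr : Ranked I σ)
    (hm : ∀ p < I.w + 1, (σ 13 p ≠ 0 ↔ I.Mark p)) : baseT.eval X σ = I.total + 1 := by
  classical
  rw [baseT, eval_add, h.eval_countT (d := 0) rfl (p := I.Mark), hr.w1, Inst.total,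
    Nat.count_eq_card_filter_range, eval_const]
  intro q hq v η hη
  rw [hr.w1] at hq
  rw [hη.eval_rd (by omega) (by omega), hη.v1, hm q hq]

/-- The number of guesses to try. -/
noncomputable def Inst.guesses (I : Inst) : ℕ :=
  if I.small ≤ I.k + 1 then (I.total + 1) ^ I.k else 0

/-- Multiplication is repeated addition with bound `total + 1`, and the power is its `k`-fold
iteration. -/
theorem eval_guessesT {σ : State} (h : At σ [] σ) (hr : Ranked I σ)
    (hm : ∀ p < I.w + 1, (σ 13 p ≠ 0 ↔ I.Mark p)) (hb : σ 6 5 = I.total + 1) :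
    guessesT.eval X σ = I.guesses := by
  classical
  have e : (Term.countT 0 3 (.andT (.le (.var 1) (sc 8)) (.rd 13 (.var 1)))).eval X σ =
      I.small := by
    rw [h.eval_countT (d := 0) rfl (p := fun p => p ≤ I.off ∧ I.Mark p), hr.w1]
    · unfold Inst.small
      rw [Nat.count_eq_card_filter_range]
      have := I.off_lt
      refine congrArg Finset.card (Finset.ext fun q => ?_)
      simp only [Finset.mem_filter, Finset.mem_range]
      exact ⟨fun h => ⟨by omega, h.2.2⟩, fun h => ⟨by omega, by omega, h.2⟩⟩
    · intro q hq v η hη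
      rw [hr.w1] at hq
      rw [eval_andT, eval_le, hη.eval_sc, hη.eval_rd (by omega) (by omega), hη.v1, hr.off, hm q hq]
  rw [guessesT, eval_ite_of (eval_le _ _), h.eval_sc, hr.k1, e, Inst.guesses,
    h.eval_iter (d := 0) rfl (fun i => (I.total + 1) ^ i) (by simp [eval_const]),
    eval_const, hr.k]
  intro i _ θ hθ
  rw [hθ.eval_sumT (d := 2) rfl (f := fun _ => (I.total + 1) ^ i), Finset.sum_const,
    Finset.card_range, hb, smul_eq_mul, pow_succ, mul_comm]
  intro j _ v η hη
  exact hη.v0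

/-! ### The strips of a guess -/

/-- The state holds the marks of an instance. -/
structure Marked (I : Inst) (σ : State) : Prop extends Ranked I σ where
  mark : ∀ p < I.w + 1, (σ 13 p ≠ 0 ↔ I.Mark p)
  prev : ∀ p < I.w + 1, σ 21 p = I.prev p
  ord : ∀ p < I.w + 1, σ 15 p = I.ord p
  parity : ∀ p < I.w + 1, σ 24 p = p % 2
  base : σ 6 5 = I.total + 1
  guesses : σ 6 6 = I.guesses

theorem Marked.congr {σ ρ : State} (h : Marked I σ)
    (e : ∀ b, b = 6 ∨ b = 9 ∨ b = 10 ∨ b = 11 ∨ b = 12 ∨ b = 13 ∨ b = 15 ∨ b = 21 ∨ b = 24 →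
      ρ b = σ b) : Marked I ρ where
  toRanked := h.toRanked.congr fun b hb => e b (by omega)
  mark := by rw [e 13 (by omega)]; exact h.mark
  prev := by rw [e 21 (by omega)]; exact h.prev
  ord := by rw [e 15 (by omega)]; exact h.ord
  parity := by rw [e 24 (by omega)]; exact h.parity
  base := by rw [e 6 (by omega)]; exact h.base
  guesses := by rw [e 6 (by omega)]; exact h.guesses

/-- The next entry of the table of quotients of the guess by powers of the base, in array `22`. -/
def quotT : Term :=
  .ite (.eqT (.var 2) (.const 0)) (.var 1)
    (.countT 3 6 (.le (.sumT 5 5 (.add (.var 4) (.const 1))) (.rd 22 (predT (.var 2)))))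

/-- The digits of the guess. -/
def digitT : Term := .sub (.rd 22 (.var 2)) (.sumT 3 5 (.rd 22 (.add (.var 2) (.const 1))))

/-- `Inst.guess` -/
def guessT : Term := .countT 3 2 (.eqT (.rd 23 (.var 4)) (.rd 15 (.var 2)))

/-- `Inst.Single` -/
def singleT : Term :=
  .andT (.le (.var 2) (sc 8)) (.andT (.eqT (.rd 16 (.var 2)) (.const 1))
    (.eqT (.rd 24 (.rd 15 (.var 2))) (.var 0)))

/-- Division counts the positive multiples of the base that do not exceed the dividend. Candidates
up to `guesses` are enough because every quotient is at most `g`. -/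
theorem tabulate_quot {σ : State} {c g : ℕ} (h : At σ [c, g] σ) (hr : Marked I σ)
    (hg : g < I.guesses) :
    ∀ i < I.k + 1, tabulate X 22 2 quotT σ (I.k + 1) 22 i = g / (I.total + 1) ^ i := by
  classical
  refine h.tabulate_eq rfl (by omega) fun p hp ρ θ hρ hj hθ => ?_
  have hr : Marked I ρ := hr.congr fun b hb => hρ b (by omega)
  rw [quotT, eval_ite_of (eval_eqT _ _), hθ.v2, eval_const, hθ.v1]
  split_ifs with h0
  · rw [h0]; simp
  obtain ⟨i, rfl⟩ := Nat.exists_eq_succ_of_ne_zero h0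
  rw [hθ.eval_countT (d := 3) rfl
    (p := fun j => (I.total + 1) * (j + 1) ≤ g / (I.total + 1) ^ i), hr.guesses]
  · rw [Nat.succ_eq_add_one, pow_succ, ← Nat.div_div_eq_div_mul]
    set x := g / (I.total + 1) ^ i with hx
    have hxg : x ≤ g := Nat.div_le_self _ _
    have hq : x / (I.total + 1) ≤ x := Nat.div_le_self _ _
    refine Eq.trans (congrArg Finset.card ?_) (Finset.card_range (x / (I.total + 1)))
    ext j
    have := Nat.le_div_iff_mul_le (x := j + 1) (y := x) (by omega : 0 < I.total + 1)
    simp only [Finset.mem_filter, Finset.mem_range]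
    rw [mul_comm, ← this]
    omega
  · intro j _ v η hη
    rw [eval_le, hη.eval_rd (by omega) (by omega), eval_predT, hη.v2, Nat.succ_sub_one,
      hj i (by omega), hη.eval_sumT (d := 5) rfl (f := fun _ => j + 1), Finset.sum_const,
      Finset.card_range, hr.base, smul_eq_mul]
    intro _ _ w ζ hζ
    rw [eval_add, At.v4 hζ, eval_const]

theorem tabulate_digit {σ : State} {c g : ℕ} (h : At σ [c, g] σ) (hr : Marked I σ)
    (hq : ∀ i < I.k + 1, σ 22 i = g / (I.total + 1) ^ i) :
    ∀ i < I.k, tabulate X 23 2 digitT σ I.k 23 i = g / (I.total + 1) ^ i % (I.total + 1) := by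
  refine h.tabulate_eq rfl (by omega) fun i hi ρ θ hρ hj hθ => ?_
  have hr : Marked I ρ := hr.congr fun b hb => hρ b (by omega)
  rw [digitT, eval_sub, hθ.eval_rd (by omega) (by omega), hθ.v2, hρ 22 (by omega),
    hq i (by omega), hθ.eval_sumT (d := 3) rfl (f := fun _ => g / (I.total + 1) ^ (i + 1)),
    Finset.sum_const, Finset.card_range, hr.base, smul_eq_mul, pow_succ,
    ← Nat.div_div_eq_div_mul]
  · exact (Nat.mod_eq_sub_mul_div).symm
  · intro _ _ v η hη
    rw [hη.eval_rd (by omega) (by omega), eval_add, hη.v2, hρ 22 (by omega), eval_const,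
      hq _ (by omega)]

theorem tabulate_guess {σ : State} {c g : ℕ} (h : At σ [c, g] σ) (hr : Marked I σ)
    (hd : ∀ i < I.k, σ 23 i = g / (I.total + 1) ^ i % (I.total + 1)) :
    ∀ p < I.w + 1, tabulate X 16 2 guessT σ (I.w + 1) 16 p = I.guess g p := by
  classical
  refine h.tabulate_eq rfl (by omega) fun p hp ρ θ hρ hj hθ => ?_
  have hr : Marked I ρ := hr.congr fun b hb => hρ b (by omega)
  rw [guessT, hθ.eval_countT (d := 3) rfl
    (p := fun i => g / (I.total + 1) ^ i % (I.total + 1) = I.ord p), hr.k, Inst.guess]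
  · congr
  · intro i hi v η hη
    rw [hr.k] at hi
    rw [eval_eqT, hη.eval_rd (by omega) (by omega), hη.eval_rd (by omega) (by omega), hη.v4, hη.v2,
      hρ 23 (by omega), hd i hi, hr.ord p hp]

/-- The term compares the tabulated parity of `ord p` with `c`; this expresses `(ord p + c) % 2 = 0`
only for `c < 2`. -/
theorem tabulate_single {σ : State} {c g : ℕ} (hc : c < 2) (h : At σ [c, g] σ) (hr : Marked I σ)
    (hm : ∀ p < I.w + 1, σ 16 p = I.guess g p) :
    ∀ p < I.w + 1, (tabulate X 17 2 singleT σ (I.w + 1) 17 p ≠ 0 ↔ I.Single c (I.guess g) p) := by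
  refine h.tabulate_iff rfl (by omega) fun p hp ρ θ hρ _ hθ => ?_
  have hr : Marked I ρ := hr.congr fun b hb => hρ b (by omega)
  have ho : I.ord p ≤ p := by classical exact Nat.count_le I.Mark
  rw [singleT, eval_andT, eval_andT, eval_le, eval_eqT, eval_eqT, hθ.eval_sc,
    hθ.eval_rd (by omega) (by omega), hθ.eval_rd (by omega) (by omega),
    hθ.eval_rd (by omega) (by omega), hθ.v0, hθ.v2, hr.off, hρ 16 (by omega), hm p hp, hr.ord p hp,
    hr.parity _ (by omega), eval_const]
  unfold Inst.Single
  omega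

end RectStab

/-! ### Tables of one round: selected positions, hits, flags -/

namespace RectStab

variable {X : Coords} {I : Inst}

/-- `Inst.lo` -/
def loT (p R : Term) : Term := .ite (.le p (sc 8)) (.rd 9 R) (.rd 11 R)

/-- `Inst.hi` -/
def hiT (p R : Term) : Term := .ite (.le p (sc 8)) (.rd 10 R) (.rd 12 R)

/-- `Inst.Inside` -/
def insideT (p R : Term) : Term := .andT (.ltT (.rd 21 p) (loT p R)) (.ltT (hiT p R) p)

/-- `Inst.single` -/
def pickT : Term :=
  .minT 4 0 (.andT (.rd 18 (.var 5)) (insideT (.var 3) (.var 5))) (hiT (.var 3) (.var 5)) (.var 3)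

/-- `Inst.Sel` -/
def selT : Term :=
  .anyT 4 3 (.andT (.andT (.rd 13 (.var 5)) (.ltT (.const 0) (.rd 16 (.var 5))))
    (.orT (.andT (.rd 17 (.var 5)) (.eqT (.var 3) (.rd 25 (.var 5))))
      (.andT (.notT (.rd 17 (.var 5))) (.orT (.eqT (.var 3) (.var 5))
        (.anyT 6 2 (.andT (.ltT (.var 7) (.rd 16 (.var 5))) (.eqT (.var 3)
          (.greedyT 8 (.andT (.rd 18 (.var 11)) (insideT (.var 5) (.var 11)))
            (loT (.var 5) (.var 11)) (hiT (.var 5) (.var 11)) (.rd 21 (.var 5))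
            (.add (sc 9) (.const 1)) (.add (.var 7) (.const 1))))))))))

/-- `Inst.HitBy` -/
def hitT : Term :=
  .anyT 4 3 (.andT (.rd 19 (.var 5))
    (.orT (.andT (.le (.rd 9 (.var 3)) (.var 5)) (.le (.var 5) (.rd 10 (.var 3))))
      (.andT (.le (.rd 11 (.var 3)) (.var 5)) (.le (.var 5) (.rd 12 (.var 3))))))

/-- The next entry of `Inst.Flag`. -/
def flagT : Term := .orT (.rd 18 (.var 3)) (.notT (.rd 26 (.var 3)))

section
variable {ρ θ : State} {l : List ℕ} {P Q : Term} {p R : ℕ}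

theorem At.eval_loT (h : At ρ l θ) (hr : Ranked I ρ) (hP : P.eval X θ = p) (hQ : Q.eval X θ = R) :
    (loT P Q).eval X θ = I.lo p R := by
  rw [loT, eval_ite_of (eval_le _ _), h.eval_sc, h.eval_rd (by omega) (by omega),
    h.eval_rd (by omega) (by omega), hP, hQ, hr.off, hr.lx, hr.ly]
  rfl

theorem At.eval_hiT (h : At ρ l θ) (hr : Ranked I ρ) (hP : P.eval X θ = p) (hQ : Q.eval X θ = R) :
    (hiT P Q).eval X θ = I.hi p R := by
  rw [hiT, eval_ite_of (eval_le _ _), h.eval_sc, h.eval_rd (by omega) (by omega),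
    h.eval_rd (by omega) (by omega), hP, hQ, hr.off, hr.hx, hr.hy]
  rfl

theorem At.eval_insideT (h : At ρ l θ) (hr : Marked I ρ) (hP : P.eval X θ = p) (hp : p < I.w + 1)
    (hQ : Q.eval X θ = R) : (insideT P Q).eval X θ ≠ 0 ↔ I.Inside p R := by
  rw [insideT, eval_andT, eval_ltT, eval_ltT, h.eval_rd (by omega) (by omega),
    h.eval_loT hr.toRanked hP hQ, h.eval_hiT hr.toRanked hP hQ, hP, hr.prev p hp]
  rfl

end

/-- The state holds the strips of a guess. -/
structure Stripped (I : Inst) (c g : ℕ) (σ : State) : Prop extends Marked I σ where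
  m : ∀ p < I.w + 1, σ 16 p = I.guess g p
  single : ∀ p < I.w + 1, (σ 17 p ≠ 0 ↔ I.Single c (I.guess g) p)

theorem Stripped.congr {c g : ℕ} {σ ρ : State} (h : Stripped I c g σ)
    (e : ∀ b, b = 6 ∨ b = 9 ∨ b = 10 ∨ b = 11 ∨ b = 12 ∨ b = 13 ∨ b = 15 ∨ b = 21 ∨ b = 24 ∨
      b = 16 ∨ b = 17 → ρ b = σ b) : Stripped I c g ρ where
  toMarked := h.toMarked.congr fun b hb => e b (by omega)
  m := by rw [e 16 (by omega)]; exact h.m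
  single := by rw [e 17 (by omega)]; exact h.single

section
variable {σ : State} {c g r : ℕ} {F : ℕ → Prop}

theorem tabulate_pick (h : At σ [c, g, r] σ) (hr : Marked I σ)
    (hF : ∀ R < I.n, (σ 18 R ≠ 0 ↔ F R)) :
    ∀ p < I.w + 1, tabulate X 25 3 pickT σ (I.w + 1) 25 p = I.single F p := by
  refine h.tabulate_eq rfl (by omega) fun p hp ρ θ hρ _ hθ => ?_
  have hr : Marked I ρ := hr.congr fun b hb => hρ b (by omega)
  rw [pickT, hθ.eval_minT (d := 4) rfl (C := fun R => F R ∧ I.Inside p R) (f := I.hi p) hθ.v3, hr.n]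
  · rfl
  · intro R hR v η hη
    rw [hr.n] at hR
    rw [eval_andT, hη.eval_insideT hr hη.v3 hp hη.v5, hη.eval_rd (by omega) (by omega), hη.v5,
      hρ 18 (by omega), hF R hR]
  · intro R _ v η hη
    exact hη.eval_hiT hr.toRanked hη.v3 hη.v5

theorem tabulate_sel (h : At σ [c, g, r] σ) (hr : Stripped I c g σ)
    (hF : ∀ R < I.n, (σ 18 R ≠ 0 ↔ F R)) (hS : ∀ p < I.w + 1, σ 25 p = I.single F p) :
    ∀ x < I.w + 1, (tabulate X 19 3 selT σ (I.w + 1) 19 x ≠ 0 ↔ I.Sel c (I.guess g) F x) := by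
  refine h.tabulate_iff rfl (by omega) fun x hx ρ θ hρ _ hθ => ?_
  have hr : Stripped I c g ρ := hr.congr fun b hb => hρ b (by omega)
  rw [selT, hθ.eval_anyT (d := 4) rfl
    (p := fun p => (I.Mark p ∧ 0 < I.guess g p) ∧ I.SelIn c (I.guess g) F p x), hr.w1]
  · exact ⟨fun ⟨p, hp, h⟩ => ⟨p, by omega, h⟩, fun ⟨p, hp, h⟩ => ⟨p, by omega, h⟩⟩
  intro p hp v η hη
  rw [hr.w1] at hp
  rw [eval_andT, eval_andT, eval_orT, eval_andT, eval_andT, eval_notT, eval_orT, eval_ltT,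
    eval_eqT, eval_eqT, eval_const, hη.eval_rd (by omega) (by omega),
    hη.eval_rd (by omega) (by omega), hη.eval_rd (by omega) (by omega),
    hη.eval_rd (by omega) (by omega), hη.v5, hη.v3, hr.mark p hp, hr.m p hp, hr.single p hp,
    hρ 25 (by omega), hS p hp]
  unfold Inst.SelIn
  refine and_congr Iff.rfl (or_congr Iff.rfl (and_congr Iff.rfl (or_congr Iff.rfl ?_)))
  rw [hη.eval_anyT (d := 6) rfl (p := fun i => i < I.guess g p ∧ x = I.inner F p (i + 1)), hr.k]
  intro i hi u ζ hζ
  rw [hr.k] at hi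
  rw [eval_andT, eval_ltT, eval_eqT, At.v7 hζ, hζ.eval_rd (by omega) (by omega), At.v5 hζ,
    At.v3 hζ, hr.m p hp, hζ.eval_greedyT (d := 8) rfl (z := I.w + 1) (m := i + 1) (y := I.prev p)
      (C := fun R => F R ∧ I.Inside p R) (f := I.lo p) (g := I.hi p), hr.n]
  · rfl
  · rw [eval_add, hζ.eval_sc, hr.w]; rfl
  · rw [hr.k]; omega
  · intro _ _ κ hκ
    rw [eval_add, At.v7 hκ]; rfl
  · intro _ _ κ hκ
    rw [hκ.eval_rd (by omega) (by omega), At.v5 hκ, hr.prev p hp]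
  · intro R hR _ _ _ κ hκ
    rw [hr.n] at hR
    rw [eval_andT, hκ.eval_insideT hr.toMarked (At.v5 hκ) hp (At.v11 hκ),
      hκ.eval_rd (by omega) (by omega), At.v11 hκ, hρ 18 (by omega), hF R hR]
  · intro R _ _ _ _ κ hκ
    exact hκ.eval_loT hr.toRanked (At.v5 hκ) (At.v11 hκ)
  · intro R _ _ _ _ κ hκ
    exact hκ.eval_hiT hr.toRanked (At.v5 hκ) (At.v11 hκ)

theorem tabulate_hit (h : At σ [c, g, r] σ) (hr : Stripped I c g σ)
    (hS : ∀ x < I.w + 1, (σ 19 x ≠ 0 ↔ I.Sel c (I.guess g) F x)) :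
    ∀ R < I.n, (tabulate X 26 3 hitT σ I.n 26 R ≠ 0 ↔ I.HitBy c (I.guess g) F R) := by
  refine h.tabulate_iff rfl (by omega) fun R hR ρ θ hρ _ hθ => ?_
  have hr : Stripped I c g ρ := hr.congr fun b hb => hρ b (by omega)
  rw [hitT, hθ.eval_anyT (d := 4) rfl
    (p := fun x => I.Sel c (I.guess g) F x ∧ I.Hit x R), hr.w1]
  · exact ⟨fun ⟨p, hp, h⟩ => ⟨p, by omega, h⟩, fun ⟨p, hp, h⟩ => ⟨p, by omega, h⟩⟩
  intro x hx v η hη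
  rw [hr.w1] at hx
  rw [eval_andT, eval_orT, eval_andT, eval_andT, eval_le, eval_le, eval_le, eval_le,
    hη.eval_rd (by omega) (by omega), hη.eval_rd (by omega) (by omega),
    hη.eval_rd (by omega) (by omega), hη.eval_rd (by omega) (by omega),
    hη.eval_rd (by omega) (by omega), hη.v3, hη.v5, hρ 19 (by omega), hS x hx, hr.lx, hr.hx, hr.ly,
    hr.hy]
  rfl

theorem tabulate_flag (h : At σ [c, g, r] σ) (hF : ∀ R < I.n, (σ 18 R ≠ 0 ↔ I.Flag c (I.guess g) r R))
    (hH : ∀ R < I.n, (σ 26 R ≠ 0 ↔ I.HitBy c (I.guess g) (I.Flag c (I.guess g) r) R)) :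
    ∀ R < I.n, (tabulate X 18 3 flagT σ I.n 18 R ≠ 0 ↔ I.Flag c (I.guess g) (r + 1) R) := by
  refine h.tabulate_iff rfl (by omega) fun R hR ρ θ hρ hρ' hθ => ?_
  rw [flagT, eval_orT, eval_notT, hθ.eval_rd (by omega) (by omega),
    hθ.eval_rd (by omega) (by omega), hθ.v3, hρ', hρ 26 (by omega), hF R hR, hH R hR]
  unfold Inst.Flag
  simp only [hR, true_and]
  cases r <;> rfl

end
end RectStab

/-! ### The search over parities and guesses -/

namespace RectStab

variable {X : Coords} {I : Inst}

/-- Computation of the marks. -/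
def marksC : Cmd :=
  .seq (.tab 14 3 0 lastT) (.seq (.tab 13 3 0 markT) (.seq (.tab 21 3 0 prevT)
    (.seq (.tab 15 3 0 ordT) (.seq (.tab 24 3 0 parityT) (.seq (.set 6 5 baseT)
      (.set 6 6 guessesT))))))

/-- One round of selecting lines and flagging rectangles. -/
def roundC : Cmd :=
  .seq (.tab 25 3 3 pickT) (.seq (.tab 19 3 3 selT) (.seq (.tab 26 0 3 hitT) (.tab 18 0 3 flagT)))

/-- The strips of a guess. -/
def stripsC : Cmd :=
  .seq (.tab 22 10 2 quotT) (.seq (.tab 23 2 2 digitT) (.seq (.tab 16 3 2 guessT)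
    (.seq (.tab 17 3 2 singleT) (.tab 18 0 2 (.const 0)))))

/-- All rectangles are stabbed, and few positions are selected. -/
def successT : Term :=
  .andT (.allT 2 0 (.rd 26 (.var 3)))
    (.le (.sumT 2 11 (.countT 4 3 (.rd 19 (.var 5)))) (.sumT 2 12 (sc 2)))

/-- Recording a solution. -/
def recordC : Cmd :=
  .seq (.set 20 0 successT) (.seq
    (.tab 3 1 2 (.ite (.rd 20 (.const 0)) (.rd 19 (.rd 8 (.var 2))) (.rd 3 (.var 2))))
    (.set 2 0 (.ite (.rd 20 (.const 0)) (.const 1) (.rd 2 (.const 0)))))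

/-- Trying a guess. -/
def guessC : Cmd := .seq stripsC (.seq (.rep 2 4 roundC) recordC)

/-- Trying all guesses. -/
def searchC : Cmd := .rep 0 7 (.rep 1 6 guessC)

theorem At.congr {σ τ : State} {l : List ℕ} (h : At σ l σ) (e : τ 5 = σ 5) : At τ l τ :=
  ⟨fun _ _ _ => rfl, fun i hi => by rw [e]; exact h.reg i hi⟩

theorem at_nil (σ : State) : At σ [] σ := ⟨fun _ _ _ => rfl, fun i hi => absurd hi (by simp)⟩

theorem exec_marksC {σ : State} (hr : Ranked I σ) : Marked I (marksC.exec X σ) := by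
  set σ₁ := (Cmd.tab 14 3 0 lastT).exec X σ with h₁
  have e₁ : ∀ b, b ≠ 14 → σ₁ b = σ b := fun b hb => tabulate_of_ne X _ _ hb _
  have hr₁ : Ranked I σ₁ := hr.congr fun b hb => e₁ b (by omega)
  have t₁ : ∀ p < I.w + 1, σ₁ 14 p = I.last p := by
    rw [h₁, Cmd.exec, hr.w1]; exact tabulate_last (at_nil σ) hr
  set σ₂ := (Cmd.tab 13 3 0 markT).exec X σ₁ with h₂
  have e₂ : ∀ b, b ≠ 13 → σ₂ b = σ₁ b := fun b hb => tabulate_of_ne X _ _ hb _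
  have hr₂ : Ranked I σ₂ := hr₁.congr fun b hb => e₂ b (by omega)
  have t₂ : ∀ p < I.w + 1, (σ₂ 13 p ≠ 0 ↔ I.Mark p) := by
    rw [h₂, Cmd.exec, hr₁.w1]; exact tabulate_mark (at_nil σ₁) hr₁ t₁
  set σ₃ := (Cmd.tab 21 3 0 prevT).exec X σ₂ with h₃
  have e₃ : ∀ b, b ≠ 21 → σ₃ b = σ₂ b := fun b hb => tabulate_of_ne X _ _ hb _
  have hr₃ : Ranked I σ₃ := hr₂.congr fun b hb => e₃ b (by omega)
  have t₃ : ∀ p < I.w + 1, σ₃ 21 p = I.prev p := by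
    rw [h₃, Cmd.exec, hr₂.w1]; exact tabulate_prev (at_nil σ₂) hr₂ t₂
  have m₃ : ∀ p < I.w + 1, (σ₃ 13 p ≠ 0 ↔ I.Mark p) := by rw [e₃ 13 (by omega)]; exact t₂
  set σ₄ := (Cmd.tab 15 3 0 ordT).exec X σ₃ with h₄
  have e₄ : ∀ b, b ≠ 15 → σ₄ b = σ₃ b := fun b hb => tabulate_of_ne X _ _ hb _
  have hr₄ : Ranked I σ₄ := hr₃.congr fun b hb => e₄ b (by omega)
  have t₄ : ∀ p < I.w + 1, σ₄ 15 p = I.ord p := by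
    rw [h₄, Cmd.exec, hr₃.w1]; exact tabulate_ord (at_nil σ₃) hr₃ m₃
  set σ₅ := (Cmd.tab 24 3 0 parityT).exec X σ₄ with h₅
  have e₅ : ∀ b, b ≠ 24 → σ₅ b = σ₄ b := fun b hb => tabulate_of_ne X _ _ hb _
  have hr₅ : Ranked I σ₅ := hr₄.congr fun b hb => e₅ b (by omega)
  have t₅ : ∀ p < I.w + 1, σ₅ 24 p = p % 2 := by
    rw [h₅, Cmd.exec, hr₄.w1]; exact tabulate_parity (at_nil σ₄) _
  have m₅ : ∀ p < I.w + 1, (σ₅ 13 p ≠ 0 ↔ I.Mark p) := by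
    rw [e₅ 13 (by omega), e₄ 13 (by omega)]; exact m₃
  set σ₆ := (Cmd.set 6 5 baseT).exec X σ₅ with h₆
  have e₆ : ∀ b j, ¬ (b = 6 ∧ j = 5) → σ₆ b j = σ₅ b j := fun b j hb => State.store_of_ne _ hb
  have b₆ : σ₆ 6 5 = I.total + 1 := by
    rw [h₆, Cmd.exec, State.store_self]; exact eval_baseT (at_nil σ₅) hr₅ m₅
  have arr₆ : ∀ b, b ≠ 6 → σ₆ b = σ₅ b := fun b hb => funext fun j => e₆ b j fun h => hb h.1
  have hr₆ : Ranked I σ₆ := by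
    constructor
    all_goals first
      | rw [e₆ _ _ (by omega)]
      | rw [arr₆ _ (by omega)]
    exacts [hr₅.n, hr₅.k, hr₅.w1, hr₅.n1, hr₅.two, hr₅.off, hr₅.w, hr₅.k1, hr₅.four, hr₅.seven, hr₅.lx,
      hr₅.hx, hr₅.ly,
      hr₅.hy]
  have m₆ : ∀ p < I.w + 1, (σ₆ 13 p ≠ 0 ↔ I.Mark p) := by rw [arr₆ 13 (by omega)]; exact m₅
  set σ₇ := (Cmd.set 6 6 guessesT).exec X σ₆ with h₇
  have e₇ : ∀ b j, ¬ (b = 6 ∧ j = 6) → σ₇ b j = σ₆ b j := fun b j hb => State.store_of_ne _ hb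
  have b₇ : σ₇ 6 6 = I.guesses := by
    rw [h₇, Cmd.exec, State.store_self]; exact eval_guessesT (at_nil σ₆) hr₆ m₆ b₆
  have arr₇ : ∀ b, b ≠ 6 → σ₇ b = σ₆ b := fun b hb => funext fun j => e₇ b j fun h => hb h.1
  have hr₇ : Ranked I σ₇ := by
    constructor
    all_goals first
      | rw [e₇ _ _ (by omega)]
      | rw [arr₇ _ (by omega)]
    exacts [hr₆.n, hr₆.k, hr₆.w1, hr₆.n1, hr₆.two, hr₆.off, hr₆.w, hr₆.k1, hr₆.four, hr₆.seven, hr₆.lx,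
      hr₆.hx, hr₆.ly,
      hr₆.hy]
  change Marked I σ₇
  refine ⟨hr₇, ?_, ?_, ?_, ?_, ?_, b₇⟩
  · rw [arr₇ 13 (by omega)]; exact m₆
  · rw [arr₇ 21 (by omega), arr₆ 21 (by omega), e₅ 21 (by omega), e₄ 21 (by omega)]; exact t₃
  · rw [arr₇ 15 (by omega), arr₆ 15 (by omega), e₅ 15 (by omega)]; exact t₄
  · rw [arr₇ 24 (by omega), arr₆ 24 (by omega)]; exact t₅
  · rw [e₇ _ _ (by omega)]; exact b₆

theorem exec_stripsC {σ : State} {c g : ℕ} (hc : c < 2) (hg : g < I.guesses)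
    (h : At σ [c, g] σ) (hr : Marked I σ) :
    Stripped I c g (stripsC.exec X σ) ∧ ∀ R < I.n, stripsC.exec X σ 18 R = 0 := by
  set σ₁ := (Cmd.tab 22 10 2 quotT).exec X σ with h₁
  have e₁ : ∀ b, b ≠ 22 → σ₁ b = σ b := fun b hb => tabulate_of_ne X _ _ hb _
  have hr₁ : Marked I σ₁ := hr.congr fun b hb => e₁ b (by omega)
  have at₁ : At σ₁ [c, g] σ₁ := h.congr (e₁ 5 (by omega))
  have t₁ : ∀ i < I.k + 1, σ₁ 22 i = g / (I.total + 1) ^ i := by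
    rw [h₁, Cmd.exec, hr.k1]; exact tabulate_quot h hr hg
  set σ₂ := (Cmd.tab 23 2 2 digitT).exec X σ₁ with h₂
  have e₂ : ∀ b, b ≠ 23 → σ₂ b = σ₁ b := fun b hb => tabulate_of_ne X _ _ hb _
  have hr₂ : Marked I σ₂ := hr₁.congr fun b hb => e₂ b (by omega)
  have at₂ : At σ₂ [c, g] σ₂ := at₁.congr (e₂ 5 (by omega))
  have t₂ : ∀ i < I.k, σ₂ 23 i = g / (I.total + 1) ^ i % (I.total + 1) := by
    rw [h₂, Cmd.exec, hr₁.k]; exact tabulate_digit at₁ hr₁ t₁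
  set σ₃ := (Cmd.tab 16 3 2 guessT).exec X σ₂ with h₃
  have e₃ : ∀ b, b ≠ 16 → σ₃ b = σ₂ b := fun b hb => tabulate_of_ne X _ _ hb _
  have hr₃ : Marked I σ₃ := hr₂.congr fun b hb => e₃ b (by omega)
  have at₃ : At σ₃ [c, g] σ₃ := at₂.congr (e₃ 5 (by omega))
  have t₃ : ∀ p < I.w + 1, σ₃ 16 p = I.guess g p := by
    rw [h₃, Cmd.exec, hr₂.w1]; exact tabulate_guess at₂ hr₂ t₂
  set σ₄ := (Cmd.tab 17 3 2 singleT).exec X σ₃ with h₄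
  have e₄ : ∀ b, b ≠ 17 → σ₄ b = σ₃ b := fun b hb => tabulate_of_ne X _ _ hb _
  have hr₄ : Marked I σ₄ := hr₃.congr fun b hb => e₄ b (by omega)
  have at₄ : At σ₄ [c, g] σ₄ := at₃.congr (e₄ 5 (by omega))
  have t₄ : ∀ p < I.w + 1, (σ₄ 17 p ≠ 0 ↔ I.Single c (I.guess g) p) := by
    rw [h₄, Cmd.exec, hr₃.w1]; exact tabulate_single hc at₃ hr₃ t₃
  set σ₅ := (Cmd.tab 18 0 2 (.const 0)).exec X σ₄ with h₅
  have e₅ : ∀ b, b ≠ 18 → σ₅ b = σ₄ b := fun b hb => tabulate_of_ne X _ _ hb _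
  change Stripped I c g σ₅ ∧ ∀ R < I.n, σ₅ 18 R = 0
  refine ⟨⟨hr₄.congr fun b hb => e₅ b (by omega), ?_, ?_⟩, ?_⟩
  · rw [e₅ 16 (by omega), e₄ 16 (by omega)]; exact t₃
  · rw [e₅ 17 (by omega)]; exact t₄
  · rw [h₅, Cmd.exec, hr₄.n]
    exact at₄.tabulate_eq rfl (by omega) fun _ _ _ _ _ _ _ => rfl

/-- The state after `r` rounds. -/
structure Round (I : Inst) (c g r : ℕ) (σ : State) : Prop extends Stripped I c g σ where
  reg₀ : σ 5 0 = c
  reg₁ : σ 5 1 = g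
  flag : ∀ R < I.n, (σ 18 R ≠ 0 ↔ I.Flag c (I.guess g) r R)
  sel : ∀ s < r, s + 1 = r → ∀ x < I.w + 1,
    (σ 19 x ≠ 0 ↔ I.Sel c (I.guess g) (I.Flag c (I.guess g) s) x)
  hit : ∀ s < r, s + 1 = r → ∀ R < I.n,
    (σ 26 R ≠ 0 ↔ I.HitBy c (I.guess g) (I.Flag c (I.guess g) s) R)

theorem at_three {σ : State} {c g r : ℕ} (hc : σ 5 0 = c) (hg : σ 5 1 = g) (hr : σ 5 2 = r) :
    At σ [c, g, r] σ := by
  refine ⟨fun _ _ _ => rfl, fun i hi => ?_⟩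
  simp only [List.length_cons, List.length_nil] at hi
  interval_cases i
  exacts [hc, hg, hr]

theorem at_two {σ : State} {c g : ℕ} (hc : σ 5 0 = c) (hg : σ 5 1 = g) : At σ [c, g] σ := by
  refine ⟨fun _ _ _ => rfl, fun i hi => ?_⟩
  simp only [List.length_cons, List.length_nil] at hi
  interval_cases i
  exacts [hc, hg]

theorem exec_roundC {σ : State} {c g r : ℕ} (hr : Round I c g r σ) :
    Round I c g (r + 1) (roundC.exec X (σ.store 5 2 r)) := by
  set σ₀ := σ.store 5 2 r with h₀
  have e₀ : ∀ b, b ≠ 5 → σ₀ b = σ b := fun b hb => funext fun j => State.store_of_ne _ fun h => hb h.1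
  have hr₀ : Stripped I c g σ₀ := hr.toStripped.congr fun b hb => e₀ b (by omega)
  have c₀ : σ₀ 5 0 = c := (State.store_of_ne _ (by omega)).trans hr.reg₀
  have g₀ : σ₀ 5 1 = g := (State.store_of_ne _ (by omega)).trans hr.reg₁
  have at₀ : At σ₀ [c, g, r] σ₀ := at_three c₀ g₀ (State.store_self _ _ _ _)
  have f₀ : ∀ R < I.n, (σ₀ 18 R ≠ 0 ↔ I.Flag c (I.guess g) r R) := by
    rw [e₀ 18 (by omega)]; exact hr.flag
  set σ₁ := (Cmd.tab 25 3 3 pickT).exec X σ₀ with h₁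
  have e₁ : ∀ b, b ≠ 25 → σ₁ b = σ₀ b := fun b hb => tabulate_of_ne X _ _ hb _
  have hr₁ : Stripped I c g σ₁ := hr₀.congr fun b hb => e₁ b (by omega)
  have at₁ : At σ₁ [c, g, r] σ₁ := at₀.congr (e₁ 5 (by omega))
  have t₁ : ∀ p < I.w + 1, σ₁ 25 p = I.single (I.Flag c (I.guess g) r) p := by
    rw [h₁, Cmd.exec, hr₀.w1]; exact tabulate_pick at₀ hr₀.toMarked f₀
  have f₁ : ∀ R < I.n, (σ₁ 18 R ≠ 0 ↔ I.Flag c (I.guess g) r R) := by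
    rw [e₁ 18 (by omega)]; exact f₀
  set σ₂ := (Cmd.tab 19 3 3 selT).exec X σ₁ with h₂
  have e₂ : ∀ b, b ≠ 19 → σ₂ b = σ₁ b := fun b hb => tabulate_of_ne X _ _ hb _
  have hr₂ : Stripped I c g σ₂ := hr₁.congr fun b hb => e₂ b (by omega)
  have at₂ : At σ₂ [c, g, r] σ₂ := at₁.congr (e₂ 5 (by omega))
  have t₂ : ∀ x < I.w + 1, (σ₂ 19 x ≠ 0 ↔ I.Sel c (I.guess g) (I.Flag c (I.guess g) r) x) := by
    rw [h₂, Cmd.exec, hr₁.w1]; exact tabulate_sel at₁ hr₁ f₁ t₁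
  set σ₃ := (Cmd.tab 26 0 3 hitT).exec X σ₂ with h₃
  have e₃ : ∀ b, b ≠ 26 → σ₃ b = σ₂ b := fun b hb => tabulate_of_ne X _ _ hb _
  have hr₃ : Stripped I c g σ₃ := hr₂.congr fun b hb => e₃ b (by omega)
  have at₃ : At σ₃ [c, g, r] σ₃ := at₂.congr (e₃ 5 (by omega))
  have t₃ : ∀ R < I.n, (σ₃ 26 R ≠ 0 ↔ I.HitBy c (I.guess g) (I.Flag c (I.guess g) r) R) := by
    rw [h₃, Cmd.exec, hr₂.n]; exact tabulate_hit at₂ hr₂ t₂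
  have f₃ : ∀ R < I.n, (σ₃ 18 R ≠ 0 ↔ I.Flag c (I.guess g) r R) := by
    rw [e₃ 18 (by omega), e₂ 18 (by omega)]; exact f₁
  set σ₄ := (Cmd.tab 18 0 3 flagT).exec X σ₃ with h₄
  have e₄ : ∀ b, b ≠ 18 → σ₄ b = σ₃ b := fun b hb => tabulate_of_ne X _ _ hb _
  have r₄ : σ₄ 5 = σ₀ 5 := by
    rw [e₄ 5 (by omega), e₃ 5 (by omega), e₂ 5 (by omega), e₁ 5 (by omega)]
  change Round I c g (r + 1) σ₄
  refine ⟨hr₃.congr fun b hb => e₄ b (by omega), by rw [r₄]; exact c₀, by rw [r₄]; exact g₀,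
    ?_, ?_, ?_⟩
  · rw [h₄, Cmd.exec, hr₃.n]; exact tabulate_flag at₃ f₃ t₃
  · intro s _ hs
    obtain rfl : s = r := by omega
    rw [e₄ 19 (by omega), e₃ 19 (by omega)]; exact t₂
  · intro s _ hs
    obtain rfl : s = r := by omega
    rw [e₄ 26 (by omega)]; exact t₃

theorem round_rounds {σ : State} {c g : ℕ} (hr : Round I c g 0 σ) (r : ℕ) :
    Round I c g r (rounds (roundC.exec X) 2 σ r) := by
  induction r with
  | zero => exact hr
  | succ r ih => exact exec_roundC ih

open Classical in
/-- The guess `g` with parity `c` leads to a solution. -/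
def Inst.Success (I : Inst) (c g : ℕ) : Prop :=
  (∀ R < I.n, I.HitBy c (I.guess g) (I.Flag c (I.guess g) I.n) R) ∧
    4 * ((Finset.range (I.w + 1)).filter
      (I.Sel c (I.guess g) (I.Flag c (I.guess g) I.n))).card ≤ 7 * I.k

/-- A round computes selection and hits from the flags of the round before, so one round beyond `n`
is needed to have them for `Flag` at `n`. The factors 4 and 7 are sums of constant length. -/
theorem eval_successT {σ : State} {c g : ℕ} (hr : Round I c g (I.n + 1) σ) :
    successT.eval X σ ≠ 0 ↔ I.Success c g := by
  classical
  have h := at_two hr.reg₀ hr.reg₁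
  rw [successT, eval_andT, eval_le, h.eval_allT (d := 2) rfl
    (p := I.HitBy c (I.guess g) (I.Flag c (I.guess g) I.n)), hr.n,
    h.eval_sumT (d := 2) rfl (f := fun _ => ((Finset.range (I.w + 1)).filter
      (I.Sel c (I.guess g) (I.Flag c (I.guess g) I.n))).card),
    h.eval_sumT (d := 2) rfl (f := fun _ => I.k), Finset.sum_const, Finset.sum_const,
    Finset.card_range, Finset.card_range, hr.four, hr.seven, smul_eq_mul, smul_eq_mul]
  · rfl
  · intro _ _ v η hη
    rw [hη.eval_sc, hr.k]
  · intro _ _ v η hη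
    rw [hη.eval_countT (d := 4) rfl (p := I.Sel c (I.guess g) (I.Flag c (I.guess g) I.n)), hr.w1]
    intro x hx w ζ hζ
    rw [hr.w1] at hx
    rw [hζ.eval_rd (by omega) (by omega), At.v5 hζ]
    exact hr.sel _ (Nat.lt_succ_self _) rfl x hx
  · intro R hR v η hη
    rw [hr.n] at hR
    rw [hη.eval_rd (by omega) (by omega), hη.v3]
    exact hr.hit _ (Nat.lt_succ_self _) rfl R hR

/-- The effect of trying a guess on the recorded solution. -/
structure Recorded (I : Inst) (c g : ℕ) (σ τ : State) : Prop where
  flag_pos : I.Success c g → τ 2 0 = 1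
  lines_pos : I.Success c g → ∀ j < σ 6 1, σ 8 j < I.w + 1 →
    (τ 3 j ≠ 0 ↔ I.Sel c (I.guess g) (I.Flag c (I.guess g) I.n) (σ 8 j))
  flag_neg : ¬ I.Success c g → τ 2 0 = σ 2 0
  lines_neg : ¬ I.Success c g → ∀ j < σ 6 1, (τ 3 j ≠ 0 ↔ σ 3 j ≠ 0)

/-- A success overwrites what was recorded before, and a failure keeps it; array `8` translates
lines into positions. -/
theorem exec_recordC {σ : State} {c g : ℕ} (hr : Round I c g (I.n + 1) σ) :
    Recorded I c g σ (recordC.exec X σ) := by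
  classical
  have h := at_two hr.reg₀ hr.reg₁
  set σ₁ := (Cmd.set 20 0 successT).exec X σ with h₁
  have e₁ : ∀ b, b ≠ 20 → σ₁ b = σ b := fun b hb =>
    funext fun j => State.store_of_ne _ fun h => hb h.1
  have at₁ : At σ₁ [c, g] σ₁ := h.congr (e₁ 5 (by omega))
  have t₁ : σ₁ 20 0 ≠ 0 ↔ I.Success c g := by
    rw [h₁, Cmd.exec, State.store_self]; exact eval_successT hr
  set σ₂ := (Cmd.tab 3 1 2 (.ite (.rd 20 (.const 0)) (.rd 19 (.rd 8 (.var 2)))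
    (.rd 3 (.var 2)))).exec X σ₁ with h₂
  have e₂ : ∀ b, b ≠ 3 → σ₂ b = σ₁ b := fun b hb => tabulate_of_ne X _ _ hb _
  have t₂ : ∀ j < σ 6 1,
      (σ₂ 3 j ≠ 0 ↔ if I.Success c g then σ 19 (σ 8 j) ≠ 0 else σ 3 j ≠ 0) := by
    rw [h₂, Cmd.exec, e₁ 6 (by omega)]
    refine at₁.tabulate_iff rfl (by omega) fun j hj ρ θ hρ hρ' hθ => ?_
    rw [eval_ite_of (p := I.Success c g)]
    · rw [hθ.eval_rd (by omega) (by omega), hθ.eval_rd (by omega) (by omega),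
        hθ.eval_rd (by omega) (by omega), hθ.v2, hρ', hρ 19 (by omega), hρ 8 (by omega),
        e₁ 3 (by omega), e₁ 19 (by omega), e₁ 8 (by omega)]
      split_ifs <;> rfl
    · rw [hθ.eval_rd (by omega) (by omega), hρ 20 (by omega)]
      exact t₁
  set σ₃ := (Cmd.set 2 0 (.ite (.rd 20 (.const 0)) (.const 1) (.rd 2 (.const 0)))).exec X σ₂
    with h₃
  have e₃ : ∀ b, b ≠ 2 → σ₃ b = σ₂ b := fun b hb =>
    funext fun j => State.store_of_ne _ fun h => hb h.1
  have t₃ : σ₃ 2 0 = if I.Success c g then 1 else σ 2 0 := by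
    rw [h₃, Cmd.exec, State.store_self, eval_ite_of (p := I.Success c g)]
    · rw [(at_nil σ₂).eval_rd (by omega) (by omega), eval_const, eval_const, e₂ 2 (by omega),
        e₁ 2 (by omega)]
    · rw [(at_nil σ₂).eval_rd (by omega) (by omega), e₂ 20 (by omega)]
      exact t₁
  change Recorded I c g σ σ₃
  refine ⟨fun hs => by rw [t₃, if_pos hs], fun hs j hj hw => ?_, fun hs => by rw [t₃, if_neg hs],
    fun hs j hj => ?_⟩
  · rw [e₃ 3 (by omega), t₂ j hj, if_pos hs]
    exact hr.sel _ (Nat.lt_succ_self _) rfl _ hw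
  · rw [e₃ 3 (by omega), t₂ j hj, if_neg hs]

theorem exec_guessC {σ : State} {c g : ℕ} (hc : c < 2) (hg : g < I.guesses)
    (h₀ : σ 5 0 = c) (h₁ : σ 5 1 = g) (hr : Marked I σ) :
    Recorded I c g σ (guessC.exec X σ) := by
  obtain ⟨hs, hz⟩ := exec_stripsC (X := X) hc hg (at_two h₀ h₁) hr
  set σ₁ := stripsC.exec X σ with e₁
  have ne : ∀ b, b ≠ 5 → stripsC.writes b = false → σ₁ b = σ b :=
    fun b hb hw => stripsC.exec_of_not_writes X hb σ hw
  have reg : ∀ i < 2, σ₁ 5 i = σ 5 i := stripsC.exec_register X 2 σ rfl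
  have hr₁ : Round I c g 0 σ₁ := ⟨hs, (reg 0 (by omega)).trans h₀, (reg 1 (by omega)).trans h₁,
    fun R hR => by rw [hz R hR]; simp [Inst.Flag], fun s hs => absurd hs (by omega),
    fun s hs => absurd hs (by omega)⟩
  have hr₂ : Round I c g (I.n + 1) ((Cmd.rep 2 4 roundC).exec X σ₁) := by
    rw [Cmd.exec, hr₁.n1]; exact round_rounds hr₁ _
  set σ₂ := (Cmd.rep 2 4 roundC).exec X σ₁ with e₂
  have ne' : ∀ b, b ≠ 5 → roundC.writes b = false → σ₂ b = σ₁ b :=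
    fun b hb hw => (Cmd.rep 2 4 roundC).exec_of_not_writes X hb σ₁ hw
  have arr : ∀ b, b ≠ 5 → stripsC.writes b = false → roundC.writes b = false → σ₂ b = σ b :=
    fun b hb hw hw' => (ne' b hb hw').trans (ne b hb hw)
  have := exec_recordC (X := X) hr₂
  change Recorded I c g σ (recordC.exec X σ₂)
  refine ⟨this.flag_pos, ?_, ?_, ?_⟩
  · have h := this.lines_pos
    rwa [arr 6 (by omega) rfl rfl, arr 8 (by omega) rfl rfl] at h
  · have h := this.flag_neg
    rwa [arr 2 (by omega) rfl rfl] at h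
  · have h := this.lines_neg
    rwa [arr 6 (by omega) rfl rfl, arr 3 (by omega) rfl rfl] at h

/-- The search does not change what it needs to know about the instance. -/
structure Frame (I : Inst) (σ ρ : State) : Prop extends Marked I ρ where
  scalars : ρ 6 = σ 6
  pos : ρ 8 = σ 8

theorem Frame.store {σ ρ : State} (h : Frame I σ ρ) (i v : ℕ) : Frame I σ (ρ.store 5 i v) := by
  have e : ∀ b, b ≠ 5 → (ρ.store 5 i v) b = ρ b := fun b hb =>
    funext fun j => State.store_of_ne _ fun h => hb h.1
  exact ⟨h.toMarked.congr fun b hb => e b (by omega), by rw [e 6 (by omega), h.scalars],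
    by rw [e 8 (by omega), h.pos]⟩

theorem Frame.exec_guessC {σ ρ : State} (h : Frame I σ ρ) : Frame I σ (guessC.exec X ρ) := by
  have e : ∀ b, b ≠ 5 → guessC.writes b = false → guessC.exec X ρ b = ρ b :=
    fun b hb hw => guessC.exec_of_not_writes X hb ρ hw
  refine ⟨h.toMarked.congr fun b hb => e b (by omega) ?_, by rw [e 6 (by omega) rfl, h.scalars],
    by rw [e 8 (by omega) rfl, h.pos]⟩
  rcases hb with rfl | rfl | rfl | rfl | rfl | rfl | rfl | rfl | rfl <;> rfl

/-- A property of states that is preserved when a guess is tried is preserved by the search, and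
holds after the search if it is established by one of the guesses. -/
theorem exec_searchC {σ : State} (hr : Marked I σ) (J : State → Prop)
    (hJ5 : ∀ ρ i v, J ρ → J (State.store ρ 5 i v))
    (hJ : ∀ c < 2, ∀ g < I.guesses, ∀ ρ, Frame I σ ρ → ρ 5 0 = c → ρ 5 1 = g → J ρ →
      J (guessC.exec X ρ)) :
    (J σ → J (searchC.exec X σ)) ∧
    ∀ c < 2, ∀ g < I.guesses, (∀ ρ, Frame I σ ρ → ρ 5 0 = c → ρ 5 1 = g →
      J (guessC.exec X ρ)) → J (searchC.exec X σ) := by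
  have inner : ∀ c < 2, ∀ ρ, Frame I σ ρ → ρ 5 0 = c → ∀ i ≤ I.guesses,
      (Frame I σ (rounds (guessC.exec X) 1 ρ i) ∧ rounds (guessC.exec X) 1 ρ i 5 0 = c) ∧
      (J ρ → J (rounds (guessC.exec X) 1 ρ i)) ∧
      ∀ g < i, (∀ ρ, Frame I σ ρ → ρ 5 0 = c → ρ 5 1 = g → J (guessC.exec X ρ)) →
        J (rounds (guessC.exec X) 1 ρ i) := by
    intro c hc ρ hF h0 i
    induction i with
    | zero => exact fun _ => ⟨⟨hF, h0⟩, id, fun g hg => absurd hg (by omega)⟩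
    | succ i ih =>
      intro hi
      obtain ⟨⟨hF, h0⟩, h1, h2⟩ := ih (by omega)
      have hF' := hF.store 1 i
      have h0' : ((rounds (guessC.exec X) 1 ρ i).store 5 1 i) 5 0 = c :=
        (State.store_of_ne _ (by omega)).trans h0
      have h1' : ((rounds (guessC.exec X) 1 ρ i).store 5 1 i) 5 1 = i := State.store_self _ _ _ _
      refine ⟨⟨hF'.exec_guessC, ?_⟩, fun h => ?_, fun g hg h => ?_⟩
      · rw [rounds, guessC.exec_register X 2 _ rfl 0 (by omega), h0']
      · exact hJ c hc i hi _ hF' h0' h1' (hJ5 _ _ _ (h1 h))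
      · rcases Nat.lt_succ_iff_lt_or_eq.1 hg with hg | rfl
        · exact hJ c hc i hi _ hF' h0' h1' (hJ5 _ _ _ (h2 g hg h))
        · exact h _ hF' h0' h1'
  have outer : ∀ i ≤ 2,
      Frame I σ (rounds ((Cmd.rep 1 6 guessC).exec X) 0 σ i) ∧
      (J σ → J (rounds ((Cmd.rep 1 6 guessC).exec X) 0 σ i)) ∧
      ∀ c < i, ∀ g < I.guesses, (∀ ρ, Frame I σ ρ → ρ 5 0 = c → ρ 5 1 = g →
        J (guessC.exec X ρ)) → J (rounds ((Cmd.rep 1 6 guessC).exec X) 0 σ i) := by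
    intro i
    induction i with
    | zero => exact fun _ => ⟨⟨hr, rfl, rfl⟩, id, fun c hc => absurd hc (by omega)⟩
    | succ i ih =>
      intro hi
      obtain ⟨hF, h1, h2⟩ := ih (by omega)
      have hF' := hF.store 0 i
      have h0' : ((rounds ((Cmd.rep 1 6 guessC).exec X) 0 σ i).store 5 0 i) 5 0 = i :=
        State.store_self _ _ _ _
      obtain ⟨⟨hI, -⟩, h3, h4⟩ := inner i hi _ hF' h0' I.guesses le_rfl
      rw [rounds, Cmd.exec, hF'.guesses]
      refine ⟨hI, fun h => h3 (hJ5 _ _ _ (h1 h)), fun c hc g hg h => ?_⟩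
      rcases Nat.lt_succ_iff_lt_or_eq.1 hc with hc | rfl
      · exact h3 (hJ5 _ _ _ (h2 c hc g hg h))
      · exact h4 g hg h
  obtain ⟨-, h1, h2⟩ := outer 2 le_rfl
  rw [searchC, Cmd.exec, hr.two]
  exact ⟨h1, h2⟩

end RectStab

namespace RectStab

/-! ### Ranks -/

section ranks
variable (X : Coords) (D : ℕ → ℕ) (m : ℕ)

open Classical in
/-- The number of lines of direction `e`. -/
noncomputable def kind (e : ℕ) : ℕ := ((Finset.range m).filter fun j => D j = e).card

open Classical in
/-- The number of lines of direction `e` before rectangle `R`. -/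
noncomputable def lowRank (e R : ℕ) : ℕ :=
  ((Finset.range m).filter fun j => D j = e ∧ ¬ X (2 - 2 * e) R ≤ X 4 j).card

open Classical in
/-- The number of lines of direction `e` that are not behind rectangle `R`. -/
noncomputable def highRank (e R : ℕ) : ℕ :=
  ((Finset.range m).filter fun j => D j = e ∧ X 4 j ≤ X (3 - 2 * e) R).card

open Classical in
/-- The rank of line `j` among the lines of its direction. -/
noncomputable def lineRank (j : ℕ) : ℕ :=
  ((Finset.range m).filter fun i => D i = D j ∧ X 4 i ≤ X 4 j).card

/-- Line `j` meets rectangle `R`. -/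
def Meets (j R : ℕ) : Prop := X (2 - 2 * D j) R ≤ X 4 j ∧ X 4 j ≤ X (3 - 2 * D j) R

/-- The position of line `j` on the axis, if the lines of direction `e` come first. -/
noncomputable def axisPos (e j : ℕ) : ℕ :=
  (if D j = e then 0 else 1 + kind D m e) + lineRank X D m j

variable {X D m}

theorem kind_add (hD : ∀ j < m, D j ≤ 1) {e : ℕ} (he : e ≤ 1) : kind D m e + kind D m (1 - e) = m := by
  unfold kind
  rw [← Finset.card_union_of_disjoint, ← Finset.filter_or]
  · refine (congrArg Finset.card (Finset.filter_true_of_mem fun j hj => ?_)).trans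
      (Finset.card_range m)
    have := hD j (Finset.mem_range.1 hj)
    omega
  · refine Finset.disjoint_filter.2 fun j _ h => ?_
    omega

theorem lowRank_le (e R : ℕ) : lowRank X D m e R ≤ kind D m e :=
  Finset.card_le_card (Finset.monotone_filter_right _ fun _ _ h => h.1)

theorem highRank_le (e R : ℕ) : highRank X D m e R ≤ kind D m e :=
  Finset.card_le_card (Finset.monotone_filter_right _ fun _ _ h => h.1)

theorem lineRank_le (j : ℕ) : lineRank X D m j ≤ kind D m (D j) :=
  Finset.card_le_card (Finset.monotone_filter_right _ fun _ _ h => h.1)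

theorem lineRank_pos {j : ℕ} (hj : j < m) : 0 < lineRank X D m j :=
  Finset.card_pos.2 ⟨j, Finset.mem_filter.2 ⟨Finset.mem_range.2 hj, rfl, le_rfl⟩⟩

/-- If line `j` is not before `R`, all lines before `R` are counted in its rank and `j` itself is
one more; otherwise every line counted in its rank is before `R`. -/
theorem lowRank_lt_lineRank {j R : ℕ} (hj : j < m) :
    lowRank X D m (D j) R < lineRank X D m j ↔ X (2 - 2 * D j) R ≤ X 4 j := by
  constructor
  · intro h
    by_contra h'
    refine absurd h (not_lt.2 (Finset.card_le_card fun i hi => ?_))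
    rw [Finset.mem_filter] at hi ⊢
    exact ⟨hi.1, hi.2.1, fun h => h' (h.trans hi.2.2)⟩
  · intro h
    refine Finset.card_lt_card ((Finset.ssubset_iff_of_subset fun i hi => ?_).2 ⟨j, ?_, ?_⟩)
    · rw [Finset.mem_filter] at hi ⊢
      exact ⟨hi.1, hi.2.1, (not_le.1 hi.2.2).le.trans h⟩
    · exact Finset.mem_filter.2 ⟨Finset.mem_range.2 hj, rfl, le_rfl⟩
    · rw [Finset.mem_filter]
      exact fun h' => h'.2.2 h

theorem lineRank_le_highRank {j R : ℕ} (hj : j < m) :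
    lineRank X D m j ≤ highRank X D m (D j) R ↔ X 4 j ≤ X (3 - 2 * D j) R := by
  constructor
  · intro h
    by_contra h'
    refine absurd h (not_le.2 (Finset.card_lt_card
      ((Finset.ssubset_iff_of_subset fun i hi => ?_).2 ⟨j, ?_, ?_⟩)))
    · rw [Finset.mem_filter] at hi ⊢
      exact ⟨hi.1, hi.2.1, hi.2.2.trans (not_le.1 h').le⟩
    · exact Finset.mem_filter.2 ⟨Finset.mem_range.2 hj, rfl, le_rfl⟩
    · rw [Finset.mem_filter]
      exact fun h => h' h.2.2
  · intro h
    refine Finset.card_le_card fun i hi => ?_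
    rw [Finset.mem_filter] at hi ⊢
    exact ⟨hi.1, hi.2.1, hi.2.2.trans h⟩

theorem lineRank_inj (hinj : ∀ i < m, ∀ j < m, D i = D j → X 4 i = X 4 j → i = j) {i j : ℕ}
    (hi : i < m) (hj : j < m) (hD : D i = D j) (h : lineRank X D m i = lineRank X D m j) :
    i = j := by
  have key : ∀ i < m, ∀ j < m, D i = D j → lineRank X D m i = lineRank X D m j →
      X 4 i ≤ X 4 j := by
    intro i hi j hj hD h
    by_contra h'
    refine absurd h (Finset.card_lt_card
      ((Finset.ssubset_iff_of_subset fun l hl => ?_).2 ⟨i, ?_, ?_⟩)).ne'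
    · rw [Finset.mem_filter] at hl ⊢
      exact ⟨hl.1, hl.2.1.trans hD.symm, hl.2.2.trans (not_le.1 h').le⟩
    · exact Finset.mem_filter.2 ⟨Finset.mem_range.2 hi, rfl, le_rfl⟩
    · rw [Finset.mem_filter]
      exact fun h => h' h.2.2
  exact hinj i hi j hj hD (le_antisymm (key i hi j hj hD h) (key j hj i hi hD.symm h.symm))

/-- Distinct lines of a direction have distinct ranks between 1 and their number, so by counting
every rank is attained. -/
theorem exists_lineRank (hinj : ∀ i < m, ∀ j < m, D i = D j → X 4 i = X 4 j → i = j) {e x : ℕ}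
    (h0 : 0 < x) (h : x ≤ kind D m e) : ∃ j < m, D j = e ∧ lineRank X D m j = x := by
  classical
  have hsub : ((Finset.range m).filter fun j => D j = e).image (lineRank X D m) ⊆
      Finset.Icc 1 (kind D m e) := by
    intro y hy
    obtain ⟨j, hj, rfl⟩ := Finset.mem_image.1 hy
    rw [Finset.mem_filter, Finset.mem_range] at hj
    have := lineRank_le (X := X) (D := D) (m := m) j
    rw [hj.2] at this
    exact Finset.mem_Icc.2 ⟨lineRank_pos hj.1, this⟩
  have heq := Finset.eq_of_subset_of_card_le hsub (by
    rw [Finset.card_image_of_injOn, Nat.card_Icc]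
    · unfold kind
      simp
    · intro i hi j hj hij
      rw [Finset.mem_coe, Finset.mem_filter, Finset.mem_range] at hi hj
      exact lineRank_inj hinj hi.1 hj.1 (hi.2.trans hj.2.symm) hij)
  have hx : x ∈ ((Finset.range m).filter fun j => D j = e).image (lineRank X D m) := by
    rw [heq]; exact Finset.mem_Icc.2 ⟨h0, h⟩
  obtain ⟨j, hj, hjx⟩ := Finset.mem_image.1 hx
  rw [Finset.mem_filter, Finset.mem_range] at hj
  exact ⟨j, hj.1, hj.2, hjx⟩

end ranks

/-- The instance `I` consists of the ranks of the input, with the lines of direction `e` first. -/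
structure Ranks (X : Coords) (D : ℕ → ℕ) (m e : ℕ) (I : Inst) : Prop where
  off : I.off = 1 + kind D m e
  w : I.w = m + 2
  lx : ∀ R < I.n, I.lx R = 1 + lowRank X D m e R
  hx : ∀ R < I.n, I.hx R = highRank X D m e R
  ly : ∀ R < I.n, I.ly R = I.off + 1 + lowRank X D m (1 - e) R
  hy : ∀ R < I.n, I.hy R = I.off + highRank X D m (1 - e) R

/-! ### From the coordinates to the axis and back -/

section geometry
variable {X : Coords} {D : ℕ → ℕ} {m e : ℕ} {I : Inst} (hI : Ranks X D m e I) (he : e ≤ 1)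
  (hD : ∀ j < m, D j ≤ 1)
include hI he hD

theorem Ranks.axisPos_mem {j : ℕ} (hj : j < m) :
    0 < axisPos X D m e j ∧ axisPos X D m e j < I.w ∧ axisPos X D m e j ≠ I.off ∧
      (I.off < axisPos X D m e j ↔ D j ≠ e) := by
  have h1 := lineRank_pos (X := X) (D := D) hj
  have h2 := lineRank_le (X := X) (D := D) (m := m) j
  have h3 := kind_add hD he
  have h4 := hD j hj
  unfold axisPos
  rw [hI.off, hI.w]
  split_ifs with h
  · rw [h] at h2; omega
  · rw [show D j = 1 - e by omega] at h2; omega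

/-- Ranks preserve the comparisons between a line and the sides of a rectangle, and the shift by
`off` keeps each direction away from the interval of the other. -/
theorem Ranks.hit_axisPos {j R : ℕ} (hj : j < m) (hR : R < I.n) :
    I.Hit (axisPos X D m e j) R ↔ Meets X D j R := by
  have h1 := lineRank_pos (X := X) (D := D) hj
  have h2 := lineRank_le (X := X) (D := D) (m := m) j
  have h4 := hD j hj
  have h5 := lowRank_lt_lineRank (X := X) (D := D) (R := R) hj
  have h6 := lineRank_le_highRank (X := X) (D := D) (R := R) hj
  have h7 := highRank_le (X := X) (D := D) (m := m) e R
  unfold Inst.Hit Meets axisPos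
  rw [hI.lx R hR, hI.hx R hR, hI.ly R hR, hI.hy R hR, hI.off, ← h5, ← h6]
  split_ifs with h
  · rw [h] at h2 ⊢; omega
  · rw [show D j = 1 - e by omega] at h2 ⊢; omega

variable (hinj : ∀ i < m, ∀ j < m, D i = D j → X 4 i = X 4 j → i = j)
include hinj

theorem Ranks.axisPos_inj {i j : ℕ} (hi : i < m) (hj : j < m)
    (h : axisPos X D m e i = axisPos X D m e j) : i = j := by
  have h1 := hI.axisPos_mem he hD hi
  have h2 := hI.axisPos_mem he hD hj
  have h3 := hD i hi
  have h4 := hD j hj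
  have hij : D i = D j := by rw [h] at h1; omega
  refine lineRank_inj hinj hi hj hij ?_
  unfold axisPos at h
  rw [hij] at h
  omega

omit hD in
-- Both intervals of a rectangle consist of ranks of lines. Selected positions without a line, such
-- as `off` and `w`, thus stab nothing and may be dropped from the output.
theorem Ranks.exists_axisPos {x R : ℕ} (hR : R < I.n) (h : I.Hit x R) :
    ∃ j < m, axisPos X D m e j = x := by
  have h1 := highRank_le (X := X) (D := D) (m := m) e R
  have h2 := highRank_le (X := X) (D := D) (m := m) (1 - e) R
  unfold Inst.Hit at h
  rw [hI.lx R hR, hI.hx R hR, hI.ly R hR, hI.hy R hR, hI.off] at h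
  unfold axisPos
  rcases h with h | h
  · obtain ⟨j, hj, hDj, hx⟩ := exists_lineRank hinj (e := e) (by omega : 0 < x) (by omega)
    exact ⟨j, hj, by rw [if_pos hDj, hx]; omega⟩
  · obtain ⟨j, hj, hDj, hx⟩ := exists_lineRank hinj (e := 1 - e)
      (by omega : 0 < x - (1 + kind D m e)) (by omega)
    exact ⟨j, hj, by rw [if_neg (by omega), hx]; omega⟩

/-- The lines of a solution of the input, as positions on the axis. -/
theorem Ranks.sol {B : Finset ℕ} (hB : ∀ j ∈ B, j < m) (hk : B.card ≤ I.k)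
    (hit : ∀ R < I.n, ∃ j ∈ B, Meets X D j R)
    (half : 2 * (B.filter fun j => D j ≠ e).card ≤ B.card) :
    I.Sol (B.image (axisPos X D m e)) := by
  classical
  have hcard : (B.image (axisPos X D m e)).card = B.card :=
    Finset.card_image_of_injOn fun i hi j hj h =>
      hI.axisPos_inj he hD hinj (hB i hi) (hB j hj) h
  refine ⟨by rw [hcard]; exact hk, fun x hx => ?_, fun R hR => ?_, ?_⟩
  · obtain ⟨j, hj, rfl⟩ := Finset.mem_image.1 hx
    have := hI.axisPos_mem he hD (hB j hj)
    exact ⟨this.1, this.2.1, this.2.2.1⟩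
  · obtain ⟨j, hj, h⟩ := hit R hR
    exact ⟨_, Finset.mem_image_of_mem _ hj, (hI.hit_axisPos he hD (hB j hj) hR).2 h⟩
  · rw [hcard]
    refine le_trans (Nat.mul_le_mul_left 2 ?_) half
    rw [Finset.filter_image]
    refine Finset.card_image_le.trans (Finset.card_le_card fun j hj => ?_)
    rw [Finset.mem_filter] at hj ⊢
    exact ⟨hj.1, (hI.axisPos_mem he hD (hB j hj.1)).2.2.2.1 hj.2⟩

theorem Ranks.exists_success {B : Finset ℕ} (hB : ∀ j ∈ B, j < m) (hk : B.card ≤ I.k)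
    (hit : ∀ R < I.n, ∃ j ∈ B, Meets X D j R)
    (half : 2 * (B.filter fun j => D j ≠ e).card ≤ B.card) :
    ∃ c < 2, ∃ g < I.guesses, I.Success c g := by
  have hA := hI.sol he hD hinj hB hk hit half
  obtain ⟨g, hg, hm⟩ := hA.exists_guess
  obtain ⟨c, hc, h⟩ := hA.exists_parity hm
  exact ⟨c, hc, g, by rw [Inst.guesses, if_pos hA.small_le]; exact hg, h⟩

open Classical in
/-- The positions selected for a successful guess are a solution of the input. -/
theorem Ranks.sound {c g : ℕ} (hs : I.Success c g) {B : Finset ℕ}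
    (hB : ∀ j, j ∈ B ↔ j < m ∧
      I.Sel c (I.guess g) (I.Flag c (I.guess g) I.n) (axisPos X D m e j)) :
    (∀ R < I.n, ∃ j ∈ B, Meets X D j R) ∧ 4 * B.card ≤ 7 * I.k := by
  refine ⟨fun R hR => ?_, ?_⟩
  · obtain ⟨x, -, hx, hit⟩ := hs.1 R hR
    obtain ⟨j, hj, rfl⟩ := hI.exists_axisPos he hinj hR hit
    exact ⟨j, (hB j).2 ⟨hj, hx⟩, (hI.hit_axisPos he hD hj hR).1 hit⟩
  · refine le_trans (Nat.mul_le_mul_left 4 ?_) hs.2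
    refine Finset.card_le_card_of_injOn (axisPos X D m e) (fun j hj => ?_) fun i hi j hj h => ?_
    · have := (hB j).1 hj
      rw [Finset.mem_coe, Finset.mem_filter, Finset.mem_range]
      have := (hI.axisPos_mem he hD this.1).2.1
      exact ⟨by omega, ((hB j).1 hj).2⟩
    · exact hI.axisPos_inj he hD hinj ((hB i).1 hi).1 ((hB j).1 hj).1 h

end geometry
end RectStab

/-! ### Computing the ranks on the machine -/

namespace RectStab

variable {X : Coords} {D : ℕ → ℕ} {n m k e : ℕ} {I : Inst}

/-- Computation of the scalars that only depend on the size of the input. -/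
def sizesC : Cmd :=
  .seq (.set 6 0 (.rd 0 (.const 1))) (.seq (.set 6 1 (.rd 0 (.const 2)))
  (.seq (.set 6 2 (.rd 0 (.const 0))) (.seq (.set 6 3 (.add (.rd 0 (.const 2)) (.const 3)))
  (.seq (.set 6 4 (.add (.rd 0 (.const 1)) (.const 1))) (.seq (.set 6 7 (.const 2))
  (.seq (.set 6 9 (.add (.rd 0 (.const 2)) (.const 2)))
  (.seq (.set 6 10 (.add (.rd 0 (.const 0)) (.const 1)))
  (.seq (.set 6 11 (.const 4)) (.set 6 12 (.const 7))))))))))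

/-- `1 + kind D m e` -/
def offT (e : ℕ) : Term := .add (.const 1) (.countT 0 1 (.eqT (.rd 1 (.var 1)) (.const e)))

/-- `axisPos` -/
def axisPosT (e : ℕ) : Term :=
  .add (.ite (.eqT (.rd 1 (.var 0)) (.const e)) (.const 0) (sc 8))
    (.countT 1 1 (.andT (.eqT (.rd 1 (.var 2)) (.rd 1 (.var 0))) (.cle 4 (.var 2) 4 (.var 0))))

/-- `lowRank` -/
def lowRankT (e : ℕ) : Term :=
  .countT 1 1 (.andT (.eqT (.rd 1 (.var 2)) (.const e))
    (.notT (.cle (2 - 2 * e) (.var 0) 4 (.var 2))))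

/-- `highRank` -/
def highRankT (e : ℕ) : Term :=
  .countT 1 1 (.andT (.eqT (.rd 1 (.var 2)) (.const e)) (.cle 4 (.var 2) (3 - 2 * e) (.var 0)))

/-- Computation of the ranks. -/
def tablesC (e : ℕ) : Cmd :=
  .seq (.tab 8 1 0 (axisPosT e)) (.seq (.tab 9 0 0 (.add (.const 1) (lowRankT e)))
    (.seq (.tab 10 0 0 (highRankT e))
    (.seq (.tab 11 0 0 (.add (.add (sc 8) (.const 1)) (lowRankT (1 - e))))
      (.tab 12 0 0 (.add (sc 8) (highRankT (1 - e)))))))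

/-- Computation of the scalars and ranks. -/
def ranksC (e : ℕ) : Cmd := .seq sizesC (.seq (.set 6 8 (offT e)) (tablesC e))

/-- The arrays of the input. -/
structure Input (D : ℕ → ℕ) (n m k : ℕ) (σ : State) : Prop where
  k : σ 0 0 = k
  n : σ 0 1 = n
  m : σ 0 2 = m
  dir : σ 1 = D

section terms
variable {ρ θ : State} {l : List ℕ} {j R : ℕ}

theorem At.eval_axisPosT (h : At ρ ([] ++ [j]) θ) (hD : ρ 1 = D) (hm : ρ 6 1 = m)
    (h8 : ρ 6 8 = 1 + kind D m e) : (axisPosT e).eval X θ = axisPos X D m e j := by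
  classical
  rw [axisPosT, eval_add, eval_ite_of (eval_eqT _ _), h.eval_rd (by omega) (by omega), h.eval_sc,
    h.v0, eval_const, eval_const, hD, h8, h.eval_countT (d := 1) rfl
      (p := fun i => D i = D j ∧ X 4 i ≤ X 4 j), hm]
  · unfold axisPos lineRank
    congr
  · intro i _ v η hη
    rw [eval_andT, eval_eqT, eval_cle, hη.eval_rd (by omega) (by omega),
      hη.eval_rd (by omega) (by omega), hη.v0, hη.v2, hD]

theorem At.eval_lowRankT (h : At ρ ([] ++ [R]) θ) (hD : ρ 1 = D) (hm : ρ 6 1 = m) :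
    (lowRankT e).eval X θ = lowRank X D m e R := by
  classical
  rw [lowRankT, h.eval_countT (d := 1) rfl
    (p := fun j => D j = e ∧ ¬ X (2 - 2 * e) R ≤ X 4 j), hm]
  · unfold lowRank
    congr
  · intro i _ v η hη
    rw [eval_andT, eval_notT, eval_eqT, eval_cle, hη.eval_rd (by omega) (by omega), hη.v0, hη.v2,
      hD, eval_const]

theorem At.eval_highRankT (h : At ρ ([] ++ [R]) θ) (hD : ρ 1 = D) (hm : ρ 6 1 = m) :
    (highRankT e).eval X θ = highRank X D m e R := by
  classical
  rw [highRankT, h.eval_countT (d := 1) rfl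
    (p := fun j => D j = e ∧ X 4 j ≤ X (3 - 2 * e) R), hm]
  · unfold highRank
    congr
  · intro i _ v η hη
    rw [eval_andT, eval_eqT, eval_cle, hη.eval_rd (by omega) (by omega), hη.v0, hη.v2,
      hD, eval_const]

end terms

theorem exec_sizesC {σ : State} (h : Input D n m k σ) :
    let τ := sizesC.exec X σ
    (τ 6 0 = n ∧ τ 6 1 = m ∧ τ 6 2 = k ∧ τ 6 3 = m + 3 ∧ τ 6 4 = n + 1 ∧ τ 6 7 = 2 ∧
      τ 6 9 = m + 2 ∧ τ 6 10 = k + 1 ∧ τ 6 11 = 4 ∧ τ 6 12 = 7) := by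
  simp [sizesC, Cmd.exec, Term.eval, State.store, h.k, h.n, h.m]

theorem exec_ranksC {σ : State} (h : Input D n m k σ) (hD : ∀ j < m, D j ≤ 1) (he : e ≤ 1) :
    ∃ I : Inst, I.n = n ∧ I.k = k ∧ Ranks X D m e I ∧ Ranked I ((ranksC e).exec X σ) ∧
      (ranksC e).exec X σ 6 1 = m ∧
      ∀ j < m, (ranksC e).exec X σ 8 j = axisPos X D m e j := by
  classical
  obtain ⟨s0, s1, s2, s3, s4, s7, s9, s10, s11, s12⟩ := exec_sizesC (X := X) h
  set σ₁ := sizesC.exec X σ with h₁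
  have d₁ : σ₁ 1 = D := (sizesC.exec_of_not_writes X (by omega) σ rfl).trans h.dir
  set σ₂ := (Cmd.set 6 8 (offT e)).exec X σ₁ with h₂
  have e₂ : ∀ b j, ¬ (b = 6 ∧ j = 8) → σ₂ b j = σ₁ b j := fun b j hb => State.store_of_ne _ hb
  have t₂ : σ₂ 6 8 = 1 + kind D m e := by
    rw [h₂, Cmd.exec, State.store_self, offT, eval_add, (at_nil σ₁).eval_countT (d := 0) rfl
      (p := fun j => D j = e), s1, eval_const]
    · unfold kind
      congr
    · intro j _ v η hη
      rw [eval_eqT, hη.eval_rd (by omega) (by omega), hη.v1, d₁, eval_const]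
  have d₂ : σ₂ 1 = D := (funext fun j => e₂ 1 j (by omega)).trans d₁
  set σ₃ := (Cmd.tab 8 1 0 (axisPosT e)).exec X σ₂ with h₃
  have e₃ : ∀ b, b ≠ 8 → σ₃ b = σ₂ b := fun b hb => tabulate_of_ne X _ _ hb _
  have m₃ : σ₂ 6 1 = m := (e₂ 6 1 (by omega)).trans s1
  have n₃ : σ₂ 6 0 = n := (e₂ 6 0 (by omega)).trans s0
  have t₃ : ∀ j < m, σ₃ 8 j = axisPos X D m e j := by
    rw [h₃, Cmd.exec, m₃]
    exact (at_nil σ₂).tabulate_eq rfl (by omega) fun j _ ρ θ hρ _ hθ => hθ.eval_axisPosT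
      (by rw [hρ 1 (by omega), d₂]) (by rw [hρ 6 (by omega), m₃]) (by rw [hρ 6 (by omega), t₂])
  set σ₄ := (Cmd.tab 9 0 0 (.add (.const 1) (lowRankT e))).exec X σ₃ with h₄
  have e₄ : ∀ b, b ≠ 9 → σ₄ b = σ₃ b := fun b hb => tabulate_of_ne X _ _ hb _
  have t₄ : ∀ R < n, σ₄ 9 R = 1 + lowRank X D m e R := by
    rw [h₄, Cmd.exec, e₃ 6 (by omega), n₃]
    refine (at_nil σ₃).tabulate_eq rfl (by omega) fun j _ ρ θ hρ _ hθ => ?_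
    rw [eval_add, hθ.eval_lowRankT (by rw [hρ 1 (by omega), e₃ 1 (by omega), d₂])
      (by rw [hρ 6 (by omega), e₃ 6 (by omega), m₃])]
    rfl
  set σ₅ := (Cmd.tab 10 0 0 (highRankT e)).exec X σ₄ with h₅
  have e₅ : ∀ b, b ≠ 10 → σ₅ b = σ₄ b := fun b hb => tabulate_of_ne X _ _ hb _
  have a₄ : ∀ b, b ≠ 8 → b ≠ 9 → σ₄ b = σ₂ b := fun b hb hb' => (e₄ b hb').trans (e₃ b hb)
  have t₅ : ∀ R < n, σ₅ 10 R = highRank X D m e R := by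
    rw [h₅, Cmd.exec, a₄ 6 (by omega) (by omega), n₃]
    refine (at_nil σ₄).tabulate_eq rfl (by omega) fun j _ ρ θ hρ _ hθ => ?_
    exact hθ.eval_highRankT (by rw [hρ 1 (by omega), a₄ 1 (by omega) (by omega), d₂])
      (by rw [hρ 6 (by omega), a₄ 6 (by omega) (by omega), m₃])
  set σ₆ := (Cmd.tab 11 0 0 (.add (.add (sc 8) (.const 1)) (lowRankT (1 - e)))).exec X σ₅ with h₆
  have e₆ : ∀ b, b ≠ 11 → σ₆ b = σ₅ b := fun b hb => tabulate_of_ne X _ _ hb _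
  have a₅ : ∀ b, b ≠ 8 → b ≠ 9 → b ≠ 10 → σ₅ b = σ₂ b :=
    fun b h8 h9 h10 => (e₅ b h10).trans (a₄ b h8 h9)
  have t₆ : ∀ R < n, σ₆ 11 R = 1 + kind D m e + 1 + lowRank X D m (1 - e) R := by
    rw [h₆, Cmd.exec, a₅ 6 (by omega) (by omega) (by omega), n₃]
    refine (at_nil σ₅).tabulate_eq rfl (by omega) fun j _ ρ θ hρ _ hθ => ?_
    have r6 : ρ 6 = σ₂ 6 := (hρ 6 (by omega)).trans (a₅ 6 (by omega) (by omega) (by omega))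
    rw [eval_add, eval_add, hθ.eval_sc, hθ.eval_lowRankT (by
      rw [hρ 1 (by omega), a₅ 1 (by omega) (by omega) (by omega), d₂]) (by rw [r6, m₃]), r6, t₂]
    rfl
  set σ₇ := (Cmd.tab 12 0 0 (.add (sc 8) (highRankT (1 - e)))).exec X σ₆ with h₇
  have e₇ : ∀ b, b ≠ 12 → σ₇ b = σ₆ b := fun b hb => tabulate_of_ne X _ _ hb _
  have a₆ : ∀ b, b ≠ 8 → b ≠ 9 → b ≠ 10 → b ≠ 11 → σ₆ b = σ₂ b :=
    fun b h8 h9 h10 h11 => (e₆ b h11).trans (a₅ b h8 h9 h10)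
  have t₇ : ∀ R < n, σ₇ 12 R = 1 + kind D m e + highRank X D m (1 - e) R := by
    rw [h₇, Cmd.exec, a₆ 6 (by omega) (by omega) (by omega) (by omega), n₃]
    refine (at_nil σ₆).tabulate_eq rfl (by omega) fun j _ ρ θ hρ _ hθ => ?_
    have r6 : ρ 6 = σ₂ 6 :=
      (hρ 6 (by omega)).trans (a₆ 6 (by omega) (by omega) (by omega) (by omega))
    rw [eval_add, hθ.eval_sc, hθ.eval_highRankT (by
      rw [hρ 1 (by omega), a₆ 1 (by omega) (by omega) (by omega) (by omega), d₂]) (by rw [r6, m₃]),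
      r6, t₂]
  have f6 : σ₇ 6 = σ₂ 6 :=
    (e₇ 6 (by omega)).trans (a₆ 6 (by omega) (by omega) (by omega) (by omega))
  have f8 : σ₇ 8 = σ₃ 8 := by
    rw [e₇ 8 (by omega), e₆ 8 (by omega), e₅ 8 (by omega), e₄ 8 (by omega)]
  have f9 : σ₇ 9 = σ₄ 9 := by rw [e₇ 9 (by omega), e₆ 9 (by omega), e₅ 9 (by omega)]
  have f10 : σ₇ 10 = σ₅ 10 := by rw [e₇ 10 (by omega), e₆ 10 (by omega)]
  have f11 : σ₇ 11 = σ₆ 11 := e₇ 11 (by omega)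
  have hkind := kind_add hD he
  have g1 := fun R => lowRank_le (X := X) (D := D) (m := m) e R
  have g2 := fun R => highRank_le (X := X) (D := D) (m := m) e R
  have g3 := fun R => lowRank_le (X := X) (D := D) (m := m) (1 - e) R
  have g4 := fun R => highRank_le (X := X) (D := D) (m := m) (1 - e) R
  -- The interval ends are taken from the final tables as they are, also beyond `n`, so that the
  -- array equations of `Ranked` hold by reflexivity.
  let I : Inst :=
    { n := n, k := k, off := 1 + kind D m e, w := m + 2
      lx := σ₇ 9, hx := σ₇ 10, ly := σ₇ 11, hy := σ₇ 12
      off_pos := by omega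
      off_lt := by omega
      lx_pos := fun R hR => by rw [f9, t₄ R hR]; omega
      hx_lt := fun R hR => by rw [f10, t₅ R hR]; have := g2 R; omega
      ly_gt := fun R hR => by rw [f11, t₆ R hR]; omega
      hy_lt := fun R hR => by rw [t₇ R hR]; have := g4 R; omega }
  refine ⟨I, rfl, rfl, ⟨rfl, rfl, fun R hR => ?_, fun R hR => ?_, fun R hR => ?_, fun R hR => ?_⟩,
    ?_, ?_, ?_⟩
  · change σ₇ 9 R = _; rw [f9, t₄ R hR]
  · change σ₇ 10 R = _; rw [f10, t₅ R hR]
  · change σ₇ 11 R = _; rw [f11, t₆ R hR]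
  · change σ₇ 12 R = _; rw [t₇ R hR]
  · change Ranked I σ₇
    constructor
    all_goals first
      | rfl
      | rw [f6]
    exacts [n₃, (e₂ 6 2 (by omega)).trans s2, (e₂ 6 3 (by omega)).trans s3,
      (e₂ 6 4 (by omega)).trans s4, (e₂ 6 7 (by omega)).trans s7, t₂, (e₂ 6 9 (by omega)).trans s9,
      (e₂ 6 10 (by omega)).trans s10, (e₂ 6 11 (by omega)).trans s11,
      (e₂ 6 12 (by omega)).trans s12]
  · change σ₇ 6 1 = m; rw [f6, m₃]
  · intro j hj
    change σ₇ 8 j = _; rw [f8, t₃ j hj]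

end RectStab

/-! ### The whole algorithm -/

namespace RectStab

variable {X : Coords} {D : ℕ → ℕ} {n m k e M : ℕ} {I : Inst}

/-- The search with the lines of direction `e` first. -/
def runC (e : ℕ) : Cmd := .seq (ranksC e) (.seq marksC searchC)

/-- The whole algorithm. -/
def mainC : Cmd := .seq (runC 0) (runC 1)

theorem Input.congr {σ τ : State} (h : Input D n m k σ) (h0 : τ 0 = σ 0) (h1 : τ 1 = σ 1) :
    Input D n m k τ := by
  constructor
  · rw [h0, h.k]
  · rw [h0, h.n]
  · rw [h0, h.m]
  · rw [h1, h.dir]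

/-! ### Loop bounds -/

/-- The loop bounds stay at most `M` until the end of the command. -/
def SafeTo (X : Coords) (M : ℕ) (c : Cmd) (σ : State) : Prop :=
  c.Safe X M σ ∧ Bdd M (c.exec X σ)

theorem SafeTo.seq {c c' : Cmd} {σ : State} (h : SafeTo X M c σ)
    (h' : SafeTo X M c' (c.exec X σ)) : SafeTo X M (.seq c c') σ := ⟨⟨h.1, h'.1⟩, h'.2⟩

theorem safeTo_of_not_writes {c : Cmd} {σ : State} (hw : c.writes 6 = false) (h : Bdd M σ) :
    SafeTo X M c σ :=
  ⟨c.safe_of_not_writes X hw h, fun j => by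
    rw [c.exec_of_not_writes X (by omega) σ hw]; exact h j⟩

theorem safeTo_set {i : ℕ} {t : Term} {σ : State} (h : Bdd M σ) (ht : t.eval X σ ≤ M) :
    SafeTo X M (.set 6 i t) σ := by
  refine ⟨h, fun j => ?_⟩
  rw [Cmd.exec]
  simp only [State.store]
  split_ifs
  · exact ht
  · exact h j

/-- These scalars are computed from the input arrays alone, which the assignments leave unchanged,
so each value is bounded independently of the others. -/
theorem SafeTo.set_seq {i : ℕ} {t : Term} {c : Cmd} {σ : State} (h : Input D n m k σ)
    (hB : Bdd M σ) (ht : ∀ τ, Input D n m k τ → t.eval X τ ≤ M)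
    (hc : ∀ τ, Input D n m k τ → Bdd M τ → SafeTo X M c τ) :
    SafeTo X M (.seq (.set 6 i t) c) σ := by
  have hs := safeTo_set (i := i) hB (ht σ h)
  refine hs.seq (hc _ (h.congr ?_ ?_) hs.2) <;>
    exact funext fun j => State.store_of_ne _ (by omega)

theorem safeTo_sizesC {σ : State} (h : Input D n m k σ) (hB : Bdd M σ) (hn : n + 1 ≤ M)
    (hm : m + 4 ≤ M) (hk : k + 1 ≤ M) (h7 : 7 ≤ M) : SafeTo X M sizesC σ := by
  refine .set_seq h hB (fun τ h => ?_) fun τ h hB => ?_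
  · simp only [Term.eval, h.n]; omega
  refine .set_seq h hB (fun τ h => ?_) fun τ h hB => ?_
  · simp only [Term.eval, h.m]; omega
  refine .set_seq h hB (fun τ h => ?_) fun τ h hB => ?_
  · simp only [Term.eval, h.k]; omega
  refine .set_seq h hB (fun τ h => ?_) fun τ h hB => ?_
  · simp only [Term.eval, h.m]; omega
  refine .set_seq h hB (fun τ h => ?_) fun τ h hB => ?_
  · simp only [Term.eval, h.n]; omega
  refine .set_seq h hB (fun τ h => ?_) fun τ h hB => ?_
  · simp only [Term.eval]; omega
  refine .set_seq h hB (fun τ h => ?_) fun τ h hB => ?_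
  · simp only [Term.eval, h.m]; omega
  refine .set_seq h hB (fun τ h => ?_) fun τ h hB => ?_
  · simp only [Term.eval, h.k]; omega
  refine .set_seq h hB (fun τ h => ?_) fun τ h hB => ?_
  · simp only [Term.eval]; omega
  exact safeTo_set hB (by simp only [Term.eval]; omega)

theorem safeTo_ranksC {σ : State} (h : Input D n m k σ) (hB : Bdd M σ)
    (hn : n + 1 ≤ M) (hm : m + 4 ≤ M) (hk : k + 1 ≤ M) (h7 : 7 ≤ M)
    (hr : Ranked I ((ranksC e).exec X σ)) (hoff : I.off ≤ M) : SafeTo X M (ranksC e) σ := by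
  have hs := safeTo_sizesC (X := X) h hB hn hm hk h7
  have ht : (tablesC e).writes 6 = false := rfl
  have hv : (offT e).eval X (sizesC.exec X σ) = I.off := by
    have := hr.off
    rw [ranksC, Cmd.exec, Cmd.exec, (tablesC e).exec_of_not_writes X (by omega) _ ht, Cmd.exec,
      State.store_self] at this
    exact this
  have h8 := safeTo_set (i := 8) hs.2 (hv.le.trans hoff)
  exact hs.seq (h8.seq (safeTo_of_not_writes ht h8.2))

theorem exec_marksC_scalar (σ : State) {j : ℕ} (h5 : j ≠ 5) (h6 : j ≠ 6) :
    marksC.exec X σ 6 j = σ 6 j := by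
  simp only [marksC, Cmd.exec]
  rw [State.store_of_ne _ (by omega), State.store_of_ne _ (by omega),
    tabulate_of_ne X _ _ (by omega), tabulate_of_ne X _ _ (by omega), tabulate_of_ne X _ _ (by omega),
    tabulate_of_ne X _ _ (by omega), tabulate_of_ne X _ _ (by omega)]

/-- The two bounds set here are read back from the final state, where `Marked` identifies them. -/
theorem safeTo_marksC {σ : State} (hB : Bdd M σ) (hr : Marked I (marksC.exec X σ))
    (ht : I.total + 1 ≤ M) (hg : I.guesses ≤ M) : SafeTo X M marksC σ := by
  have a₁ := safeTo_of_not_writes (X := X) (c := .tab 14 3 0 lastT) rfl hB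
  have a₂ := safeTo_of_not_writes (X := X) (c := .tab 13 3 0 markT) rfl a₁.2
  have a₃ := safeTo_of_not_writes (X := X) (c := .tab 21 3 0 prevT) rfl a₂.2
  have a₄ := safeTo_of_not_writes (X := X) (c := .tab 15 3 0 ordT) rfl a₃.2
  have a₅ := safeTo_of_not_writes (X := X) (c := .tab 24 3 0 parityT) rfl a₄.2
  have hb := hr.base
  have hg' := hr.guesses
  rw [marksC] at hb hg'
  simp only [Cmd.exec] at hb hg'
  rw [State.store_of_ne _ (by omega), State.store_self] at hb
  rw [State.store_self] at hg'
  have a₆ := safeTo_set (i := 5) (t := baseT) a₅.2 (by simp only [Cmd.exec]; rw [hb]; exact ht)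
  have a₇ := safeTo_set (i := 6) (t := guessesT) a₆.2 (by simp only [Cmd.exec]; rw [hg']; exact hg)
  exact a₁.seq (a₂.seq (a₃.seq (a₄.seq (a₅.seq (a₆.seq a₇)))))

/-! ### Correctness of the search -/

/-- The recorded lines, if there are any, are a solution. -/
def Valid (X : Coords) (D : ℕ → ℕ) (n m k : ℕ) (σ : State) : Prop :=
  σ 2 0 ≠ 0 → ∀ B : Finset ℕ, (∀ j, j ∈ B ↔ j < m ∧ σ 3 j ≠ 0) →
    (∀ R < n, ∃ j ∈ B, Meets X D j R) ∧ 4 * B.card ≤ 7 * k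

/-- What is needed to run the two directions in succession: the record stays valid and is never
lost, a solution with at most half of its lines in the other direction is noticed, the input
survives, and the loop bounds stay small. -/
theorem exec_runC {σ : State} (h : Input D n m k σ) (hD : ∀ j < m, D j ≤ 1) (he : e ≤ 1)
    (hinj : ∀ i < m, ∀ j < m, D i = D j → X 4 i = X 4 j → i = j) :
    (Valid X D n m k σ → Valid X D n m k ((runC e).exec X σ)) ∧
    (σ 2 0 ≠ 0 → (runC e).exec X σ 2 0 ≠ 0) ∧
    (∀ B : Finset ℕ, (∀ j ∈ B, j < m) → B.card ≤ k → (∀ R < n, ∃ j ∈ B, Meets X D j R) →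
      2 * (B.filter fun j => D j ≠ e).card ≤ B.card → (runC e).exec X σ 2 0 ≠ 0) ∧
    Input D n m k ((runC e).exec X σ) ∧
    (Bdd M σ → 7 * (k ^ (5 * k) * (n + m + 1)) ≤ M → SafeTo X M (runC e) σ) := by
  obtain ⟨I, rfl, rfl, hI, hr, h1, h8⟩ := exec_ranksC (X := X) h hD he
  have hM := exec_marksC (X := X) hr
  set σ₁ := (ranksC e).exec X σ with e₁
  set σ₂ := marksC.exec X σ₁ with e₂
  have arr : ∀ b, b ≠ 5 → (ranksC e).writes b = false → marksC.writes b = false → σ₂ b = σ b :=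
    fun b hb hw hw' => (marksC.exec_of_not_writes X hb σ₁ hw').trans
      ((ranksC e).exec_of_not_writes X hb σ hw)
  have s1 : σ₂ 6 1 = m := (exec_marksC_scalar σ₁ (by omega) (by omega)).trans h1
  have s8 : ∀ j < m, σ₂ 8 j = axisPos X D m e j := by
    rw [e₂, marksC.exec_of_not_writes X (by omega) σ₁ rfl]; exact h8
  have a2 : σ₂ 2 = σ 2 := arr 2 (by omega) rfl rfl
  have a3 : σ₂ 3 = σ 3 := arr 3 (by omega) rfl rfl
  have store5 : ∀ (ρ : State) i v b, b ≠ 5 → ρ.store 5 i v b = ρ b := fun ρ i v b hb =>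
    funext fun j => State.store_of_ne _ fun h => hb h.1
  have hrun : (runC e).exec X σ = searchC.exec X σ₂ := rfl
  have hrec : ∀ c < 2, ∀ g < I.guesses, ∀ ρ, Frame I σ₂ ρ → ρ 5 0 = c → ρ 5 1 = g →
      Recorded I c g ρ (guessC.exec X ρ) := fun c hc g hg ρ hF h0 h1 =>
    exec_guessC hc hg h0 h1 hF.toMarked
  -- Validity is only preserved by the guesses, whereas the success flag below is also established
  -- by a right one.
  obtain ⟨v1, -⟩ := exec_searchC (X := X) hM (Valid X D I.n m I.k)
    (fun ρ i v h => by
      unfold Valid at h ⊢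
      rw [store5 _ _ _ 2 (by omega), store5 _ _ _ 3 (by omega)]; exact h)
    (fun c hc g hg ρ hF h0 h1 hv => by
      have hR := hrec c hc g hg ρ hF h0 h1
      intro hne B hB
      by_cases hs : I.Success c g
      · refine hI.sound he hD hinj hs fun j => (hB j).trans (and_congr_right fun hj => ?_)
        have hj' : j < ρ 6 1 := by rw [hF.scalars, s1]; exact hj
        have hp : ρ 8 j = axisPos X D m e j := by rw [hF.pos, s8 j hj]
        have hw := (hI.axisPos_mem he hD hj).2.1
        rw [hR.lines_pos hs j hj' (by rw [hp]; omega), hp]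
      · refine hv (by rwa [← hR.flag_neg hs]) B fun j => (hB j).trans
          (and_congr_right fun hj => hR.lines_neg hs j ?_)
        rw [hF.scalars, s1]; exact hj)
  obtain ⟨f1, f2⟩ := exec_searchC (X := X) hM (fun ρ => ρ 2 0 ≠ 0)
    (fun ρ i v h => by rw [store5 _ _ _ 2 (by omega)]; exact h)
    (fun c hc g hg ρ hF h0 h1 hv => by
      have hR := hrec c hc g hg ρ hF h0 h1
      by_cases hs : I.Success c g
      · rw [hR.flag_pos hs]; omega
      · rw [hR.flag_neg hs]; exact hv)
  rw [hrun]
  refine ⟨fun hv => v1 ?_, fun hne => f1 (by rw [a2]; exact hne), fun B hB hk hit half => ?_,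
    h.congr ?_ ?_, fun hB hle => ?_⟩
  · unfold Valid at hv ⊢
    rw [a2, a3]; exact hv
  · obtain ⟨c, hc, g, hg, hs⟩ := hI.exists_success he hD hinj hB hk hit half
    exact f2 c hc g hg fun ρ hF h0 h1 => by
      rw [(hrec c hc g hg ρ hF h0 h1).flag_pos hs]; omega
  · rw [searchC.exec_of_not_writes X (by omega) σ₂ rfl]; exact arr 0 (by omega) rfl rfl
  · rw [searchC.exec_of_not_writes X (by omega) σ₂ rfl]; exact arr 1 (by omega) rfl rfl
  · have hpos : 0 < I.k ^ (5 * I.k) := by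
      rcases Nat.eq_zero_or_pos I.k with h0 | h0
      · rw [h0]; exact Nat.one_pos
      · exact Nat.pow_pos h0
    have hkk : I.k ≤ I.k ^ (5 * I.k) := by
      rcases Nat.eq_zero_or_pos I.k with h0 | h0
      · omega
      · exact Nat.le_self_pow (by omega) _
    have hN : I.n + m + 1 ≤ I.k ^ (5 * I.k) * (I.n + m + 1) := Nat.le_mul_of_pos_left _ hpos
    have hK : I.k ^ (5 * I.k) ≤ I.k ^ (5 * I.k) * (I.n + m + 1) :=
      Nat.le_mul_of_pos_right _ (by omega)
    have hkind := kind_add hD he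
    have htot : I.total ≤ I.w + 1 := by
      classical exact Nat.count_le I.Mark
    -- If there are too many marks, no guess is tried at all, so the bound of `Inst.pow_le` is
    -- always available. The factor 7 in `M` covers its factor 6, the bounds of size `m + 4` and the
    -- constant bound 7.
    have hgs : I.guesses ≤ M := by
      unfold Inst.guesses
      split_ifs with hs
      · have := I.pow_le hs
        omega
      · omega
    have hoff := hI.off
    have hw := hI.w
    have q₁ : SafeTo X M (ranksC e) σ := safeTo_ranksC h hB (by omega) (by omega) (by omega)
      (by omega) hr (by omega)
    have q₂ : SafeTo X M marksC σ₁ := safeTo_marksC q₁.2 hM (by omega) hgs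
    exact q₁.seq (q₂.seq (safeTo_of_not_writes rfl q₂.2))

/-! ### The input -/

section input
variable {rs : List Rect} {ls : List Line}

/-- A line is unbounded in its own direction and the rectangle is nonempty, so only one coordinate
matters; `2 - 2 * D j` and `3 - 2 * D j` pick the two arrays holding it. -/
theorem meets_iff {j R : ℕ} (hj : j < ls.length) (hR : R < rs.length) :
    Meets (inputCoords rs ls) (fun i => (ls.map Line.dir).getD i 0) j R ↔ Stabs ls[j] rs[R] := by
  have h0 : inputCoords rs ls 0 R = rs[R].left := by simp [inputCoords, hR]
  have h1 : inputCoords rs ls 1 R = rs[R].right := by simp [inputCoords, hR]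
  have h2 : inputCoords rs ls 2 R = rs[R].bottom := by simp [inputCoords, hR]
  have h3 : inputCoords rs ls 3 R = rs[R].top := by simp [inputCoords, hR]
  have h4 : inputCoords rs ls 4 j = ls[j].pos := by simp [inputCoords, hj]
  have hd : (ls.map Line.dir).getD j 0 = ls[j].dir := by simp [hj]
  unfold Meets
  simp only [hd, h4]
  generalize ls[j] = l
  have hx := rs[R].left_le_right
  have hy := rs[R].bottom_le_top
  cases l with
  | horizontal y =>
    simp only [Line.dir, Line.pos, Nat.mul_zero, Nat.sub_zero, h2, h3]
    constructor
    · exact fun h => ⟨(rs[R].left, y), ⟨⟨le_rfl, hx⟩, h⟩, ⟨trivial, rfl⟩⟩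
    · rintro ⟨p, ⟨-, hp⟩, ⟨-, rfl⟩⟩
      exact hp
  | vertical x =>
    simp only [Line.dir, Line.pos, Nat.mul_one, Nat.sub_self, h0]
    rw [show 3 - 2 = 1 from rfl, h1]
    constructor
    · exact fun h => ⟨(x, rs[R].bottom), ⟨h, ⟨le_rfl, hy⟩⟩, ⟨rfl, trivial⟩⟩
    · rintro ⟨p, ⟨hp, -⟩, ⟨rfl, -⟩⟩
      exact hp

theorem line_ext {l l' : Line} (hd : l.dir = l'.dir) (hp : l.pos = l'.pos) : l = l' := by
  cases l <;> cases l' <;> simp_all [Line.dir, Line.pos]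

end input

theorem Lists.card {α : Type*} {l : List α} {S : Finset α} (h : Lists l S) :
    S.card = l.length := by
  classical
  rw [← List.toFinset_card_of_nodup h.1]
  congr 1
  ext x
  rw [List.mem_toFinset, h.2]

end RectStab

theorem theorem1 :
    ∃ (P : RectStab.Program) (A B D : ℕ),
      ∀ (𝓡 : Finset RectStab.Rect) (𝓛 : Finset RectStab.Line) (k : ℕ)
        (rs : List RectStab.Rect) (ls : List RectStab.Line),
        RectStab.Lists rs 𝓡 → RectStab.Lists ls 𝓛 →
        ∃ (τ : RectStab.State) (t : ℕ),
          RectStab.Exec (RectStab.inputCoords rs ls) P (RectStab.inputState rs ls k) τ t ∧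
          t ≤ A * k ^ (B * k) * (𝓡.card + 𝓛.card + 1) ^ D ∧
          (RectStab.answer ls τ = none →
            ¬ ∃ S : Finset RectStab.Line, RectStab.IsSolution 𝓡 𝓛 S ∧ S.card ≤ k) ∧
          (∀ S : Finset RectStab.Line, RectStab.answer ls τ = some S →
            RectStab.IsSolution 𝓡 𝓛 S ∧ (S.card : ℚ) ≤ 7 / 4 * (k : ℚ)) := by
  open RectStab in
  classical
  obtain ⟨C, E, hCE⟩ := mainC.polyBdd_cost
  -- The cost is at most `C * (7 * x + 1) ^ E ≤ C * (8 * x) ^ E`, where `x` is `k ^ (5 * k)` times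
  -- the input size plus one; the power `E` distributes over the product.
  refine ⟨mainC.compile, C * 8 ^ E, 5 * E, E, fun 𝓡 𝓛 k rs ls hrs hls => ?_⟩
  rw [hrs.card, hls.card]
  set X := inputCoords rs ls with hX
  set σ := inputState rs ls k with hσ
  set D : ℕ → ℕ := fun i => (ls.map Line.dir).getD i 0 with hDdef
  set n := rs.length with hn
  set m := ls.length with hm
  set x := k ^ (5 * k) * (n + m + 1) with hx
  have hin : Input D n m k σ := ⟨rfl, rfl, rfl, rfl⟩
  have hdir : ∀ j (hj : j < m), D j = ls[j].dir := fun j hj => by simp [hDdef, hm ▸ hj]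
  have hpos : ∀ j (hj : j < m), X 4 j = ls[j].pos := fun j hj => by
    simp [hX, inputCoords, hm ▸ hj]
  have hD : ∀ j < m, D j ≤ 1 := fun j hj => by
    rw [hdir j hj]; cases ls[j] <;> simp [Line.dir]
  have hinj : ∀ i < m, ∀ j < m, D i = D j → X 4 i = X 4 j → i = j := by
    intro i hi j hj h h'
    rw [hdir i hi, hdir j hj] at h
    rw [hpos i hi, hpos j hj] at h'
    exact (List.Nodup.getElem_inj_iff hls.1).1 (line_ext h h')
  have hB : Bdd (7 * x) σ := fun j => Nat.zero_le _
  obtain ⟨a1, a2, a3, a4, a5⟩ := exec_runC (M := 7 * x) hin hD (e := 0) (by omega) hinj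
  have q₀ := a5 hB le_rfl
  obtain ⟨b1, b2, b3, b4, b5⟩ := exec_runC (M := 7 * x) a4 hD (e := 1) (by omega) hinj
  have q₁ := q₀.seq (b5 q₀.2 le_rfl)
  obtain ⟨τ, t, hexec, ht, hτ⟩ := mainC.compile_correct X (7 * x) 0 σ σ rfl (Agree.refl 0 σ) q₁.1
  have hmain : mainC.exec X σ = (runC 1).exec X ((runC 0).exec X σ) := rfl
  have τ2 : τ 2 0 = mainC.exec X σ 2 0 := (hτ 2 0 (by omega) (by omega)).symm
  have τ3 : ∀ j, τ 3 j = mainC.exec X σ 3 j := fun j => (hτ 3 j (by omega) (by omega)).symm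
  refine ⟨τ, t, hexec, ?_, ?_, ?_⟩
  · have hx1 : 1 ≤ x := by
      refine Nat.mul_pos ?_ (Nat.succ_pos _)
      rcases Nat.eq_zero_or_pos k with h0 | h0
      · rw [h0]; exact Nat.one_pos
      · exact Nat.pow_pos h0
    calc t ≤ C * (7 * x + 1) ^ E := ht.trans (hCE _)
      _ ≤ C * (8 * x) ^ E := Nat.mul_le_mul_left _ (Nat.pow_le_pow_left (by omega) _)
      _ = C * 8 ^ E * k ^ (5 * E * k) * (n + m + 1) ^ E := by
        rw [hx, mul_pow, mul_pow, ← pow_mul, show 5 * k * E = 5 * E * k by ring]; ring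
  · rintro hans ⟨S, ⟨hS, hstab⟩, hk⟩
    have h0 : τ 2 0 = 0 := by
      by_contra h
      rw [answer, if_neg h] at hans
      exact absurd hans (by simp)
    rw [τ2, hmain] at h0
    set B : Finset ℕ := (Finset.univ.filter fun j : Fin m => ls.get j ∈ S).map Fin.valEmbedding
      with hBdef
    have hBm : ∀ j ∈ B, j < m := fun j hj => by
      obtain ⟨i, -, rfl⟩ := Finset.mem_map.1 hj
      exact i.2
    have hBk : B.card ≤ k := by
      rw [hBdef, Finset.card_map]
      refine le_trans (Finset.card_le_card_of_injOn ls.get (fun j hj => ?_) fun i _ j _ h => ?_) hk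
      · exact (Finset.mem_filter.1 hj).2
      · exact List.nodup_iff_injective_get.1 hls.1 h
    have hit : ∀ R < n, ∃ j ∈ B, Meets X D j R := by
      intro R hR
      obtain ⟨l, hl, hs⟩ := hstab rs[R] ((hrs.2 _).1 (List.getElem_mem _))
      obtain ⟨j, hj, rfl⟩ := List.getElem_of_mem ((hls.2 l).2 (hS hl))
      refine ⟨j, Finset.mem_map.2 ⟨⟨j, hj⟩, Finset.mem_filter.2 ⟨Finset.mem_univ _, hl⟩, rfl⟩, ?_⟩
      exact (meets_iff hj hR).2 hs
    -- One of the two directions makes up at most half of the solution, so the run with the other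
    -- one first must succeed; a success of the first run survives the second.
    have hsum := Finset.card_filter_add_card_filter_not (s := B) (fun j => D j ≠ 0)
    have hsub : (B.filter fun j => D j ≠ 1).card ≤ (B.filter fun j => ¬ D j ≠ 0).card := by
      refine Finset.card_le_card fun j hj => ?_
      rw [Finset.mem_filter] at hj ⊢
      have := hD j (hBm j hj.1)
      exact ⟨hj.1, by omega⟩
    by_cases hhalf : 2 * (B.filter fun j => D j ≠ 1).card ≤ B.card
    · exact b3 B hBm hBk hit hhalf h0
    · exact b2 (a3 B hBm hBk hit (by omega)) h0
  · intro S hans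
    have h0 : τ 2 0 ≠ 0 := by
      intro h
      rw [answer, if_pos h] at hans
      exact absurd hans (by simp)
    rw [answer, if_neg h0] at hans
    have hS := (Option.some.inj hans).symm
    rw [τ2, hmain] at h0
    set F : Finset (Fin m) := Finset.univ.filter fun j : Fin m => τ 3 j ≠ 0 with hF
    have hv := b1 (a1 fun h => absurd rfl h) h0 (F.map Fin.valEmbedding) (fun j => by
      rw [Finset.mem_map, ← hmain, ← τ3]
      constructor
      · rintro ⟨i, hi, rfl⟩
        exact ⟨i.2, (Finset.mem_filter.1 hi).2⟩
      · rintro ⟨hj, h⟩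
        exact ⟨⟨j, hj⟩, Finset.mem_filter.2 ⟨Finset.mem_univ _, h⟩, rfl⟩)
    rw [Finset.card_map] at hv
    have hS' : S = F.image ls.get := by
      rw [hS]
    refine ⟨⟨fun l hl => ?_, fun R hR => ?_⟩, ?_⟩
    · rw [hS'] at hl
      obtain ⟨j, -, rfl⟩ := Finset.mem_image.1 hl
      exact (hls.2 _).1 (List.get_mem _ _)
    · obtain ⟨i, hi, rfl⟩ := List.getElem_of_mem ((hrs.2 R).2 hR)
      obtain ⟨j, hj, hmeet⟩ := hv.1 i hi
      obtain ⟨j, hjF, rfl⟩ := Finset.mem_map.1 hj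
      refine ⟨ls.get j, ?_, (meets_iff j.2 hi).1 hmeet⟩
      rw [hS']
      exact Finset.mem_image_of_mem _ hjF
    · have h1 : S.card ≤ F.card := by rw [hS']; exact Finset.card_image_le
      have h2 : 4 * S.card ≤ 7 * k := by have := hv.2; omega
      have h3 : (4 : ℚ) * S.card ≤ 7 * k := by exact_mod_cast h2
      linarith
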